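/- **Setting.** Let $p=(a_0,a_1,a_2,a_3,c,d)\in(\mathbb C\setminus\{0\})^6$ and let $q$ be defined by $a_0a_1a_2a_3=q^{-1}$. Let $\varphi=\varphi_p:\mathbb P^1\times\mathbb P^1\dashrightarrow\mathbb P^1\times\mathbb P^1$, $(x,y)\mapsto(\bar x,\bar y)$, be given by $$\bar x=\frac{qa_0a_1xy+c(d+a_0dx+qa_0a_1a_2y)}{qx\,(1+a_0(x+a_1a_2cy+a_1xy))},\qquad \bar y=\frac{c(d+a_0dx+a_0a_1dxy+qa_0a_1a_2y)}{y\,(qa_0x(1+a_1y)+c(d+qa_0a_1a_2y))},$$ together with the change of parameters $p\mapsto\bar p=(a_0,a_1,a_2,a_3,d/q,c/q)$. Let $X_p$ be the blow-up of $\mathbb P^1\times\mathbb P^1$ at the eight points $$(0,-da_3),\ (0,-a_1),\ (-\tfrac1{a_0},0),\ (-\tfrac c{a_2},0),\ (\infty,-\tfrac1{a_1}),\ (\infty,-\tfrac d{a_3}),\ (-ca_2,\infty),\ (-a_0,\infty),$$ let $E_1,\dots,E_8\in\mathrm{Pic}(X_p)$ be the classes of the corresponding exceptional curves, and let $H_0,H_1$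 be the classes of the total transforms of $x=\mathrm{const}$, $y=\mathrm{const}$. Let $\Lambda=\mathbb ZH_0\oplus\mathbb ZH_1\oplus\mathbb ZE_1\oplus\dots\oplus\mathbb ZE_8$ with the form $H_i\cdot H_j=1-\delta_{ij}$, $E_k\cdot E_l=-\delta_{kl}$, $H_i\cdot E_k=0$. Put $\alpha_0=E_5-E_6$, $\alpha_1=E_1-E_2$, $\alpha_2=H_1-E_1-E_5$, $\alpha_3=H_0-E_3-E_7$, $\alpha_4=E_3-E_4$, $\alpha_5=E_7-E_8$, $K=-K_X=2H_0+2H_1-E_1-\dots-E_8$, and $w_i(D)=D-\frac{2D\cdot\alpha_i}{\alpha_i\cdot\alpha_i}\alpha_i$. Let $\sigma_{10}$ be the automorphism of $\Lambda$ exchanging $E_1\leftrightarrow E_5$, $E_2\leftrightarrow E_6$ (other basis elements fixed), $\sigma_{543210}$ the one exchanging $H_0\leftrightarrow H_1$, $E_1\leftrightarrow E_3$, $E_2\leftrightarrow E_4$, $E_5\leftrightarrow E_7$, $E_6\leftrightarrow E_8$, and $\sigma_{54}=\sigma_{543210}\circ\sigma_{10}\circ\sigma_{543210}$. Let $\widetilde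 W(D_5^{(1)})$ be the group generated by $w_0,\dots,w_5,\sigma_{10},\sigma_{543210}$; composition is composition of maps on $\Lambda$. Call $p$ generic if, with $$(\chi_0,\dots,\chi_5)=\Bigl(\tfrac{a_3}{a_1d},\ \tfrac{a_1}{da_3},\ a_1a_3d,\ a_0a_2c,\ \tfrac{a_2}{a_0c},\ \tfrac{a_0}{ca_2}\Bigr),$$ one has $\prod_i\chi_i^{n_i}\ne1$ for every $\alpha=\sum_i n_i\alpha_i$ ($n_i\in\mathbb Z$) with $\alpha\cdot\alpha=-2$ (no real root is effective on $X_p$; in particular the eight points are distinct). **Corollary.** Let $p$ be generic. Then for each of the parameters $p,\bar p,\bar{\bar p}$ the natural map $\Lambda\to\mathrm{Pic}(X)$ is bijective, the mappings $\varphi_p$ and $\varphi^2=\varphi_{\bar p}\circ\varphi_p$ are birational and lift to isomorphisms $X_p\to X_{\bar p}$ and $X_p\to X_{\bar{\bar p}}$, and, identifying the Picard groups with $\Lambda$, their push-forward actions on divisor classes are as follows. 1. $\varphi^2$ acts on the root basis as $$(\alpha_0,\alpha_1,\alpha_2,\alpha_3,\alpha_4,\alpha_5)\mapsto(\alpha_0+K,\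 \alpha_1+K,\ \alpha_2-K,\ \alpha_3-K,\ \alpha_4+K,\ \alpha_5+K),$$ where $K=\alpha_0+\alpha_1+2\alpha_2+2\alpha_3+\alpha_4+\alpha_5$. 2. The action of $\varphi$ is the element $$\varphi=\sigma_{54}\circ\sigma_{10}\circ w_5\circ w_4\circ w_1\circ w_0\circ w_2\circ w_3\circ w_2$$ of $\widetilde W(D_5^{(1)})$. -/

import Mathlib

namespace QSurface

open MvPolynomial

noncomputable section

/-! The lattice with basis `H_0, H_1, E_1, …, E_8`, its intersection form, the root basis
and the extended affine Weyl group. -/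

/-- `ℤ H_0 + ℤ H_1 + ℤ E_1 + ⋯ + ℤ E_8`; the pair `(h, e)` stands for
`h 0 H_0 + h 1 H_1 + e 0 E_1 + ⋯ + e 7 E_8`. -/
abbrev Lat : Type := (Fin 2 → ℤ) × (Fin 8 → ℤ)

/-- The basis vector `H_i`. -/
def H (i : Fin 2) : Lat := (Pi.single i 1, 0)

/-- `E k` is the basis vector `E_{k+1}`. -/
def E (k : Fin 8) : Lat := (0, Pi.single k 1)

/-- The intersection form: `H_i · H_j = 1 - δ_{ij}`, `E_k · E_l = - δ_{kl}`, `H_i · E_k = 0`. -/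
def inter (D D' : Lat) : ℤ :=
  D.1 0 * D'.1 1 + D.1 1 * D'.1 0 - ∑ k, D.2 k * D'.2 k

/-- The anticanonical class `-K_X = 2 H_0 + 2 H_1 - E_1 - ⋯ - E_8`. -/
def antiK : Lat := (2 : ℤ) • H 0 + (2 : ℤ) • H 1 - ∑ k, E k

/-- The root basis `E_5 - E_6, E_1 - E_2, H_1 - E_1 - E_5, H_0 - E_3 - E_7, E_3 - E_4, E_7 - E_8`
(recall that `E k` is `E_{k+1}`). -/
def α : Fin 6 → Lat :=
  ![E 4 - E 5, E 0 - E 1, H 1 - E 0 - E 4, H 0 - E 2 - E 6, E 2 - E 3, E 6 - E 7]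

theorem inter_α_self (i : Fin 6) : inter (α i) (α i) = -2 := by
  revert i; unfold α H E inter; decide

theorem inter_add_left (D D' F : Lat) : inter (D + D') F = inter D F + inter D' F := by
  simp only [inter, Prod.fst_add, Prod.snd_add, Pi.add_apply, add_mul, Finset.sum_add_distrib]
  ring

theorem inter_smul_left (n : ℤ) (D F : Lat) : inter (n • D) F = n * inter D F := by
  simp only [inter, Prod.smul_fst, Prod.smul_snd, Pi.smul_apply, smul_eq_mul, mul_sub, mul_add,
    Finset.mul_sum, mul_assoc]

/-- The formula of the reflection: `D ↦ D - (2 D · α_i / α_i · α_i) α_i`. -/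
def reflect (i : Fin 6) (D : Lat) : Lat :=
  D - (2 * inter D (α i) / inter (α i) (α i)) • α i

theorem reflect_eq (i : Fin 6) (D : Lat) : reflect i D = D + inter D (α i) • α i := by
  have h : 2 * inter D (α i) / inter (α i) (α i) = - inter D (α i) := by
    rw [inter_α_self]; omega
  rw [reflect, h, neg_smul, sub_neg_eq_add]

/-- The reflection `w_i` as an automorphism of the lattice. -/
def w (i : Fin 6) : Lat ≃ₗ[ℤ] Lat :=
  LinearEquiv.ofInvolutive
    { toFun := reflect i
      map_add' := fun D D' => by
        simp only [reflect_eq, inter_add_left]; module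
      map_smul' := fun n D => by
        simp only [reflect_eq, inter_smul_left, RingHom.id_apply]; module }
    (fun D => by
      simp only [LinearMap.coe_mk, AddHom.coe_mk, reflect_eq,
        inter_add_left, inter_smul_left, inter_α_self]
      module)

/-- The automorphism of the lattice that sends `H_i` to `H_{s i}` and `E_k` to `E_{t k}`. -/
def permute (s : Equiv.Perm (Fin 2)) (t : Equiv.Perm (Fin 8)) : Lat ≃ₗ[ℤ] Lat :=
  (LinearEquiv.funCongrLeft ℤ ℤ s.symm).prodCongr (LinearEquiv.funCongrLeft ℤ ℤ t.symm)

/-- `σ_{102345}`: exchanges `E_1, E_5` and `E_2, E_6`. -/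
def σ₁₀ : Lat ≃ₗ[ℤ] Lat := permute 1 (Equiv.swap 0 4 * Equiv.swap 1 5)

/-- `σ_{543210}`: exchanges `H_0, H_1`; `E_1, E_3`; `E_2, E_4`; `E_5, E_7`; `E_6, E_8`. -/
def σ₅₄₃₂₁₀ : Lat ≃ₗ[ℤ] Lat :=
  permute (Equiv.swap 0 1)
    (Equiv.swap 0 2 * Equiv.swap 1 3 * Equiv.swap 4 6 * Equiv.swap 5 7)

/-- `σ_{012354} = σ_{543210} ∘ σ_{102345} ∘ σ_{543210}`. -/
def σ₅₄ : Lat ≃ₗ[ℤ] Lat := σ₅₄₃₂₁₀ * σ₁₀ * σ₅₄₃₂₁₀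

/-- The extended affine Weyl group of type `D_5^{(1)}`, acting on the lattice; the group
operation is composition of maps. -/
def extendedWeylGroup : Subgroup (Lat ≃ₗ[ℤ] Lat) :=
  Subgroup.closure (Set.range w ∪ {σ₁₀, σ₅₄₃₂₁₀})

/-! Parameters and the mapping. -/

/-- The parameters of the surface and of the mapping. -/
structure Params where
  a₀ : ℂ
  a₁ : ℂ
  a₂ : ℂ
  a₃ : ℂ
  c : ℂ
  d : ℂ

/-- `q`, defined by `a₀ a₁ a₂ a₃ = q⁻¹`. -/
def Params.q (p : Params) : ℂ := 1 / (p.a₀ * p.a₁ * p.a₂ * p.a₃)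

/-- The evolution of the parameters under the mapping. -/
def Params.next (p : Params) : Params :=
  { p with c := p.d / p.q, d := p.c / p.q }

/-- The value on `α_i` of the multiplicative character of the root lattice that is attached to
the eight points. A real root `Σ n_i α_i` can be effective on the surface only if
`∏ (rootVar i) ^ n_i = 1`: for instance `α_1 = E_1 - E_2` if the points 1 and 2 coincide, and
`α_2 = H_1 - E_1 - E_5` if the points 1 and 5 lie on one line `y = constant`. -/
def Params.rootVar (p : Params) : Fin 6 → ℂ :=
  ![p.a₃ / (p.a₁ * p.d), p.a₁ / (p.d * p.a₃), p.a₁ * p.a₃ * p.d, p.a₀ * p.a₂ * p.c,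
    p.a₂ / (p.a₀ * p.c), p.a₀ / (p.c * p.a₂)]

/-- Generic parameters: all of them nonzero, and the character is different from `1` on every
real root, i.e. on every element of square `-2` of the root lattice. In particular the eight
points are distinct. -/
structure Params.IsGeneric (p : Params) : Prop where
  a₀_ne : p.a₀ ≠ 0
  a₁_ne : p.a₁ ≠ 0
  a₂_ne : p.a₂ ≠ 0
  a₃_ne : p.a₃ ≠ 0
  c_ne : p.c ≠ 0
  d_ne : p.d ≠ 0
  root_ne : ∀ n : Fin 6 → ℤ, inter (∑ i, n i • α i) (∑ i, n i • α i) = -2 →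
    ∏ i, p.rootVar i ^ n i ≠ 1

/-- Polynomials in two variables. -/
abbrev Poly : Type := MvPolynomial (Fin 2) ℂ

/-- The function field `ℂ(x, y)` of `ℙ¹ × ℙ¹`. -/
abbrev FunField : Type := FractionRing Poly

/-- The coordinate `x`. -/
def x : FunField := algebraMap Poly FunField (X 0)

/-- The coordinate `y`. -/
def y : FunField := algebraMap Poly FunField (X 1)

/-- Constants as rational functions. -/
def con (z : ℂ) : FunField := algebraMap ℂ FunField z

/-- The first component of the mapping `φ`. -/
def xbar (p : Params) : FunField :=
  (con (p.q * p.a₀ * p.a₁) * x * y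
      + con p.c * (con p.d + con (p.a₀ * p.d) * x + con (p.q * p.a₀ * p.a₁ * p.a₂) * y)) /
    (con p.q * x * (1 + con p.a₀ * (x + con (p.a₁ * p.a₂ * p.c) * y + con p.a₁ * x * y)))

/-- The second component of the mapping `φ`. -/
def ybar (p : Params) : FunField :=
  (con p.c * (con p.d + con (p.a₀ * p.d) * x + con (p.a₀ * p.a₁ * p.d) * x * y
      + con (p.q * p.a₀ * p.a₁ * p.a₂) * y)) /
    (y * (con (p.q * p.a₀) * x * (1 + con p.a₁ * y)
      + con p.c * (con p.d + con (p.q * p.a₀ * p.a₁ * p.a₂) * y)))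

/-- `Φ` is the automorphism `f ↦ f ∘ φ` of the function field that belongs to the birational
mapping `φ : (x, y) ↦ (xbar, ybar)`. There is at most one such `Φ`. -/
def IsPullback (p : Params) (Φ : FunField ≃ₐ[ℂ] FunField) : Prop :=
  Φ x = xbar p ∧ Φ y = ybar p

/-! The surface `X` obtained from `ℙ¹ × ℙ¹` by blowing up the eight points: its prime divisors,
divisors, and divisor classes. A prime divisor is identified with the order of vanishing
along it, a function on the function field. -/

/-- The order of vanishing of a nonzero polynomial along an ideal. -/
def polyOrd (I : Ideal Poly) (A : Poly) : ℕ := sSup {n : ℕ | A ∈ I ^ n}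

open Classical in
/-- The order of vanishing, along the subscheme with ideal `I` of the affine plane with
coordinates `s, t`, of the rational function `f = A(s, t) / B(s, t)`. It is used only for `s, t`
with `ℂ(s, t) = ℂ(x, y)` and for `I` generated by an irreducible polynomial or by both variables,
where it does not depend on `A` and `B`; by convention it is `0` at `f = 0`. -/
def ordAlong (s t : FunField) (I : Ideal Poly) (f : FunField) : ℤ :=
  if h : ∃ AB : Poly × Poly, AB.1 ≠ 0 ∧ AB.2 ≠ 0 ∧
      f * aeval ![s, t] AB.2 = aeval ![s, t] AB.1 then
    (polyOrd I h.choose.1 : ℤ) - (polyOrd I h.choose.2 : ℤ)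
  else 0

/-- Local coordinates on `ℙ¹ × ℙ¹` that vanish at the `k`-th of the eight points (counted from 0),
which are `(0, -d a₃)`, `(0, -a₁)`, `(-1/a₀, 0)`, `(-c/a₂, 0)`, `(∞, -1/a₁)`, `(∞, -d/a₃)`,
`(-c a₂, ∞)`, `(-a₀, ∞)`. -/
def localCoord (p : Params) : Fin 8 → FunField × FunField :=
  ![(x, y + con (p.d * p.a₃)), (x, y + con p.a₁),
    (x + con (1 / p.a₀), y), (x + con (p.c / p.a₂), y),
    (x⁻¹, y + con (1 / p.a₁)), (x⁻¹, y + con (p.d / p.a₃)),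
    (x + con (p.c * p.a₂), y⁻¹), (x + con p.a₀, y⁻¹)]

/-- The order along the exceptional curve over the `k`-th point, i.e. the order of vanishing
(multiplicity) at that point. -/
def excOrd (p : Params) (k : Fin 8) : FunField → ℤ :=
  ordAlong (localCoord p k).1 (localCoord p k).2 (Ideal.span {X 0, X 1})

/-- The prime divisors of the surface: the strict transforms of the irreducible curves of
`ℙ¹ × ℙ¹`, each of which is given in one of the four standard charts by an irreducible polynomial,
and the eight exceptional curves. -/
def primeDivisors (p : Params) : Set (FunField → ℤ) :=
  {v | ∃ s ∈ ({x, x⁻¹} : Set FunField), ∃ t ∈ ({y, y⁻¹} : Set FunField),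
      ∃ A : Poly, Irreducible A ∧ v = ordAlong s t (Ideal.span {A})} ∪
    Set.range (excOrd p)

/-- The group of divisors of the surface. -/
abbrev Div (p : Params) : Type := primeDivisors p →₀ ℤ

/-- The subgroup of divisors of nonzero rational functions. -/
def principal (p : Params) : AddSubgroup (Div p) :=
  AddSubgroup.closure {D | ∃ f : FunField, f ≠ 0 ∧ ∀ v : primeDivisors p, D v = v.1 f}

/-- The Picard group of the surface: divisors modulo linear equivalence. -/
abbrev Pic (p : Params) : Type := Div p ⧸ principal p

/-- The exceptional curve over the `k`-th point. -/
def excDiv (p : Params) (k : Fin 8) : Div p :=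
  Finsupp.single ⟨excOrd p k, Or.inr ⟨k, rfl⟩⟩ 1

/-- The strict transform of the line `x = 0` (for `i = 0`) or `y = 0` (for `i = 1`). -/
def lineDiv (p : Params) (i : Fin 2) : Div p :=
  Finsupp.single ⟨ordAlong x y (Ideal.span {X i}),
    Or.inl ⟨x, Or.inl rfl, y, Or.inl rfl, X i, (X_prime).irreducible, rfl⟩⟩ 1

/-- The total transform of the line `x = 0`, which contains the first two of the eight points
(for `i = 0`), and of the line `y = 0`, which contains the next two (for `i = 1`). -/
def fibreDiv (p : Params) : Fin 2 → Div p :=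
  ![lineDiv p 0 + excDiv p 0 + excDiv p 1, lineDiv p 1 + excDiv p 2 + excDiv p 3]

/-- The homomorphism from the lattice to the Picard group that sends `H_0`, `H_1` to the classes
of the total transforms of `x = constant`, `y = constant`, and `E_1, …, E_8` to the classes of the
exceptional curves. -/
def marking (p : Params) (D : Lat) : Pic p :=
  QuotientAddGroup.mk (∑ i, D.1 i • fibreDiv p i + ∑ k, D.2 k • excDiv p k)

/-- The birational mapping `ψ` with `f ∘ ψ = Φ f` lifts to an isomorphism from the surface with
parameters `p` to the one with parameters `p'`: it neither contracts nor extracts a curve, i.e.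
the prime divisors of the two surfaces correspond. The order along the image of a prime divisor
`v` is `f ↦ v (f ∘ ψ)`. -/
def LiftsToIso (Φ : FunField ≃ₐ[ℂ] FunField) (p p' : Params) : Prop :=
  ∀ v : FunField → ℤ, v ∈ primeDivisors p ↔ v ∘ Φ ∈ primeDivisors p'

open Classical in
/-- The push-forward of divisors: a prime divisor goes to its image, or to `0` if it is
contracted. -/
def pushDiv (Φ : FunField ≃ₐ[ℂ] FunField) (p p' : Params) : Div p →+ Div p' :=
  Finsupp.liftAddHom fun v =>
    if h : v.1 ∘ Φ ∈ primeDivisors p' then Finsupp.singleAddHom ⟨v.1 ∘ Φ, h⟩ else 0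

/-- The birational mapping belonging to `Φ` lifts to an isomorphism of the surfaces, and the
push-forward `F` of divisor classes that it induces is `L` when both Picard groups are identified
with the lattice. -/
def ActsBy (Φ : FunField ≃ₐ[ℂ] FunField) (p p' : Params) (L : Lat ≃ₗ[ℤ] Lat) : Prop :=
  Function.Bijective (marking p) ∧ Function.Bijective (marking p') ∧ LiftsToIso Φ p p' ∧
    ∃ F : Pic p ≃+ Pic p',
      (∀ D : Div p, F (QuotientAddGroup.mk D) = QuotientAddGroup.mk (pushDiv Φ p p' D)) ∧
      ∀ D : Lat, F (marking p D) = marking p' (L D)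

end

end QSurface

/-! Curves are handled through their valuations. A curve on `ℙ¹ × ℙ¹` is a normalized discrete
valuation of `ℂ(x, y)`, trivial on `ℂ`, for which `x` or `y` has transcendental residue
(`isCurve_iff`). The exceptional curve over the point `s = t = 0` is the valuation with `v s = 1`
for which `t / s` has transcendental residue (`isGauss_point_iff`). Such data determine the
valuation (`IsGauss.unique`), so the image `v ∘ Φ` of a prime divisor is recognised from a few
values and residues.

The mapping is a product of simple ones. The elementary transformation `(x, y) ↦ (x (y + b 4) / (y +
b 0), y)` blows up `(0, -b 0)` and `(∞, -b 4)` and contracts the two horizontal lines through them.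
It lifts to an isomorphism from the blow-up for the configuration `b` to the one for `elemPts b`,
and acts as `w 2` (`IsElem.actsOn`). Conjugation with the exchange of the factors turns this into `w
3`. The inversion `(1 / x, ρ / y)` acts as `σ₅₄ * σ₁₀ * w 5 * w 4 * w 1 * w 0` (`IsInv.actsOn`). Now
`φ` is an elementary transformation in `x`, one in `y`, one in `x`, and the inversion with `ρ = c d
/ q` (`xbar_identity`, `ybar_identity`), and this chain carries the points of `p` to the points of
`p.next` (`invPts_pts₃`). Since actions compose (`ActsOn.trans`), the word in the generators
follows, and its square on the roots is a finite computation in the lattice.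

Genericity enters because all intermediate configurations must be `Good`: each inequality required
says that the character is not `1` on one real root. It is inherited by `p.next`, whose character is
that of `p` composed with an isometry of the root lattice (`Params.IsGeneric.next`).

The marking is injective because a function without zeros and poles in the affine plane is constant,
and surjective because an affine curve has an irreducible equation, whose divisor expresses its
class by lines at infinity and exceptional curves (`mark_injective`, `mark_surjective`). -/

namespace QSurface

open MvPolynomial

noncomputable section

/-! Constants -/

theorem con_zero : con 0 = 0 := map_zero _

theorem con_one : con 1 = 1 := map_one _

theorem con_add (a b : ℂ) : con (a + b) = con a + con b := map_add _ _ _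

theorem con_sub (a b : ℂ) : con (a - b) = con a - con b := map_sub _ _ _

theorem con_neg (a : ℂ) : con (-a) = -con a := map_neg _ _

theorem con_mul (a b : ℂ) : con (a * b) = con a * con b := map_mul _ _ _

theorem con_inv (a : ℂ) : con a⁻¹ = (con a)⁻¹ := map_inv₀ _ _

theorem con_div (a b : ℂ) : con (a / b) = con a / con b := map_div₀ _ _ _

theorem con_injective : Function.Injective con := (algebraMap ℂ FunField).injective

theorem con_eq_zero {a : ℂ} : con a = 0 ↔ a = 0 :=
  map_eq_zero_iff _ con_injective

theorem con_ne_zero {a : ℂ} (h : a ≠ 0) : con a ≠ 0 := fun h' => h (con_eq_zero.1 h')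

theorem algEquiv_con (Φ : FunField ≃ₐ[ℂ] FunField) (a : ℂ) : Φ (con a) = con a := Φ.commutes a

/-! Discrete valuations of the function field, with the convention `v 0 = 0`. -/

/-- A discrete valuation of the function field, trivial on the constants; by convention `v 0 = 0`. -/
structure IsVal (v : FunField → ℤ) : Prop where
  zero : v 0 = 0
  mul : ∀ {f g}, f ≠ 0 → g ≠ 0 → v (f * g) = v f + v g
  add : ∀ {f g}, f ≠ 0 → g ≠ 0 → f + g ≠ 0 → min (v f) (v g) ≤ v (f + g)
  const : ∀ z, v (con z) = 0

namespace IsVal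

variable {v : FunField → ℤ}

theorem comp (hv : IsVal v) (Φ : FunField ≃ₐ[ℂ] FunField) : IsVal (v ∘ Φ) where
  zero := by simp [hv.zero]
  mul hf hg := by
    simp only [Function.comp, map_mul]
    exact hv.mul (by simpa using hf) (by simpa using hg)
  add hf hg hfg := by
    simp only [Function.comp, map_add]
    exact hv.add (by simpa using hf) (by simpa using hg) (by rwa [← map_add, Ne, EmbeddingLike.map_eq_zero_iff])
  const z := by simp only [Function.comp, algEquiv_con, hv.const]

theorem one (hv : IsVal v) : v 1 = 0 := by rw [← con_one, hv.const]

theorem inv (hv : IsVal v) (f : FunField) : v f⁻¹ = -v f := by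
  rcases eq_or_ne f 0 with rfl | hf
  · simp [hv.zero]
  · have := hv.mul hf (inv_ne_zero hf)
    rw [mul_inv_cancel₀ hf, hv.one] at this
    omega

theorem div (hv : IsVal v) {f g : FunField} (hf : f ≠ 0) (hg : g ≠ 0) :
    v (f / g) = v f - v g := by
  rw [div_eq_mul_inv, hv.mul hf (inv_ne_zero hg), hv.inv]; ring

theorem neg (hv : IsVal v) (f : FunField) : v (-f) = v f := by
  rcases eq_or_ne f 0 with rfl | hf
  · simp
  · rw [neg_eq_neg_one_mul, ← con_one, ← con_neg, hv.mul (con_ne_zero (by norm_num)) hf, hv.const,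
      zero_add]

theorem pow (hv : IsVal v) {f : FunField} (hf : f ≠ 0) (n : ℕ) : v (f ^ n) = n * v f := by
  induction n with
  | zero => simp [hv.one]
  | succ n ih => rw [pow_succ, hv.mul (pow_ne_zero n hf) hf, ih]; push_cast; ring

theorem zpow (hv : IsVal v) {f : FunField} (hf : f ≠ 0) (n : ℤ) : v (f ^ n) = n * v f := by
  cases n with
  | ofNat n => simp [hv.pow hf]
  | negSucc n => rw [zpow_negSucc, hv.inv, hv.pow hf, Int.negSucc_eq]; push_cast; ring

/-- The convention `v 0 = 0` makes `0 ≤ v f` describe the whole valuation ring, zero included. The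
price is that `0 < v f` misses zero in the maximal ideal, whence the alternative `f = 0` in `Pos`.
-/
theorem nonneg_add (hv : IsVal v) {f g : FunField} (hf : 0 ≤ v f) (hg : 0 ≤ v g) :
    0 ≤ v (f + g) := by
  rcases eq_or_ne f 0 with rfl | hf0
  · simpa
  rcases eq_or_ne g 0 with rfl | hg0
  · simpa
  rcases eq_or_ne (f + g) 0 with h | h
  · rw [h, hv.zero]
  · exact (le_min hf hg).trans (hv.add hf0 hg0 h)

theorem nonneg_mul (hv : IsVal v) {f g : FunField} (hf : 0 ≤ v f) (hg : 0 ≤ v g) :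
    0 ≤ v (f * g) := by
  rcases eq_or_ne f 0 with rfl | hf0
  · simp [hv.zero]
  rcases eq_or_ne g 0 with rfl | hg0
  · simp [hv.zero]
  rw [hv.mul hf0 hg0]; omega

end IsVal

/-- `f` belongs to the maximal ideal of the valuation ring of `v`. -/
def Pos (v : FunField → ℤ) (f : FunField) : Prop := f = 0 ∨ 0 < v f

/-- `f` belongs to the valuation ring of `v`, with residue the constant `c`. -/
def Res (v : FunField → ℤ) (f : FunField) (c : ℂ) : Prop := Pos v (f - con c)

/-- `s` is a unit for `v`, with residue transcendental over the constants. -/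
def RT (v : FunField → ℤ) (s : FunField) : Prop := ∀ c : ℂ, s + con c ≠ 0 ∧ v (s + con c) = 0

/-! ### Calculus of residues for a fixed valuation. -/

section

variable {v : FunField → ℤ}

namespace Pos

theorem nonneg (hv : IsVal v) {f : FunField} (h : Pos v f) : 0 ≤ v f := by
  rcases h with rfl | h
  · rw [hv.zero]
  · exact h.le

theorem add (hv : IsVal v) {f g : FunField} (hf : Pos v f) (hg : Pos v g) : Pos v (f + g) := by
  rcases hf with rfl | hf
  · simpa
  rcases hg with rfl | hg
  · rw [add_zero]; exact Or.inr hf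
  rcases eq_or_ne (f + g) 0 with h | h
  · exact Or.inl h
  refine Or.inr ((lt_min hf hg).trans_le (hv.add ?_ ?_ h))
  · rintro rfl; simp [hv.zero] at hf
  · rintro rfl; simp [hv.zero] at hg

theorem neg (hv : IsVal v) {f : FunField} (hf : Pos v f) : Pos v (-f) := by
  rcases hf with rfl | hf
  · exact Or.inl neg_zero
  · exact Or.inr (by rwa [hv.neg])

theorem mul_nonneg (hv : IsVal v) {f g : FunField} (hf : Pos v f) (hg : 0 ≤ v g) :
    Pos v (f * g) := by
  rcases hf with rfl | hf
  · exact Or.inl (zero_mul g)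
  rcases eq_or_ne g 0 with rfl | hg0
  · exact Or.inl (mul_zero f)
  refine Or.inr ?_
  rw [hv.mul (by rintro rfl; simp [hv.zero] at hf) hg0]; omega

end Pos

/-- Adding an element of the maximal ideal does not change a unit into a non-unit. -/
theorem IsVal.unit_add (hv : IsVal v) {f g : FunField} (hf0 : f ≠ 0) (hf : v f = 0)
    (hg : Pos v g) : f + g ≠ 0 ∧ v (f + g) = 0 := by
  have key : ¬ Pos v (f + g) := by
    intro h
    have h2 := h.add hv (hg.neg hv)
    rw [add_neg_cancel_right] at h2
    rcases h2 with h2 | h2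
    · exact hf0 h2
    · omega
  have h1 : 0 ≤ v (f + g) := hv.nonneg_add hf.ge (hg.nonneg hv)
  simp only [Pos, not_or, not_lt] at key
  exact ⟨key.1, by omega⟩

namespace Res

theorem const (v : FunField → ℤ) (c : ℂ) : Res v (con c) c := Or.inl (sub_self _)

theorem of_pos {f : FunField} (h : Pos v f) : Res v f 0 := by
  rwa [Res, con_zero, sub_zero]

theorem of_add_pos {f : FunField} {c : ℂ} (h : 0 < v (f + con c)) : Res v f (-c) := by
  rw [Res, con_neg, sub_neg_eq_add]; exact Or.inr h

theorem nonneg (hv : IsVal v) {f : FunField} {c : ℂ} (h : Res v f c) : 0 ≤ v f := by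
  have := hv.nonneg_add (Pos.nonneg hv h) (hv.const c).ge
  rwa [sub_add_cancel] at this

theorem unit (hv : IsVal v) {f : FunField} {c : ℂ} (h : Res v f c) (hc : c ≠ 0) :
    f ≠ 0 ∧ v f = 0 := by
  have := hv.unit_add (con_ne_zero hc) (hv.const c) h
  rwa [add_sub_cancel] at this

theorem add (hv : IsVal v) {f g : FunField} {a b : ℂ} (hf : Res v f a) (hg : Res v g b) :
    Res v (f + g) (a + b) := by
  have := Pos.add hv hf hg
  rwa [sub_add_sub_comm, ← con_add] at this

theorem mul (hv : IsVal v) {f g : FunField} {a b : ℂ} (hf : Res v f a) (hg : Res v g b) :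
    Res v (f * g) (a * b) := by
  have h1 := Pos.mul_nonneg hv hf (hg.nonneg hv)
  have h2 := Pos.mul_nonneg hv hg (hv.const a).ge
  have := h1.add hv h2
  have e : f * g - con (a * b) = (f - con a) * g + (g - con b) * con a := by
    rw [con_mul]; ring
  rwa [Res, e]

theorem inv (hv : IsVal v) {f : FunField} {a : ℂ} (hf : Res v f a) (ha : a ≠ 0) :
    Res v f⁻¹ a⁻¹ := by
  obtain ⟨h0, hu⟩ := hf.unit hv ha
  have h1 := (Pos.mul_nonneg hv hf (g := f⁻¹ * con a⁻¹)
    (hv.nonneg_mul (by rw [hv.inv, hu]; rfl) (hv.const _).ge)).neg hv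
  have := con_ne_zero ha
  have e : f⁻¹ - con a⁻¹ = -((f - con a) * (f⁻¹ * con a⁻¹)) := by
    rw [con_inv]; field_simp; ring
  rwa [Res, e]

theorem div (hv : IsVal v) {f g : FunField} {a b : ℂ} (hf : Res v f a) (hg : Res v g b)
    (hb : b ≠ 0) : Res v (f / g) (a / b) := by
  rw [div_eq_mul_inv, div_eq_mul_inv]; exact hf.mul hv (hg.inv hv hb)

end Res

/-- The values of `v` at the translates of an element of its valuation ring with constant
residue. -/
theorem Res.val_add_con (hv : IsVal v) {f : FunField} {a b : ℂ} (h : Res v f a) (hb : a + b ≠ 0) :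
    v (f + con b) = 0 := ((h.add hv (Res.const v b)).unit hv hb).2

theorem IsVal.val_add_con_of_neg (hv : IsVal v) {f : FunField} (h : v f < 0) (b : ℂ) :
    v (f + con b) = v f := by
  have h0 : f ≠ 0 := by rintro rfl; simp [hv.zero] at h
  have h1 : Res v (1 + con b * f⁻¹) 1 := by
    have h2 : Pos v (con b * f⁻¹) := by
      rw [mul_comm]
      exact Pos.mul_nonneg hv (Or.inr (by rw [hv.inv]; omega)) (hv.const b).ge
    have := (Res.const v 1).add hv (Res.of_pos h2)
    rwa [add_zero, con_one] at this
  obtain ⟨h3, h4⟩ := h1.unit hv one_ne_zero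
  have h5 : f + con b = f * (1 + con b * f⁻¹) := by field_simp
  rw [h5, hv.mul h0 h3, h4, add_zero]

namespace RT

theorem ne_zero {s : FunField} (h : RT v s) : s ≠ 0 := by simpa [con_zero] using (h 0).1

theorem val {s : FunField} (h : RT v s) : v s = 0 := by simpa [con_zero] using (h 0).2

theorem not_res {s : FunField} {c : ℂ} (h : RT v s) : ¬ Res v s c := by
  intro h'
  have h1 := h (-c)
  rw [con_neg, ← sub_eq_add_neg] at h1
  rcases h' with h' | h'
  · exact h1.1 h'
  · omega

/-- Affine transformations whose coefficients have constant residues. -/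
theorem affine (hv : IsVal v) {s u w : FunField} {k m : ℂ} (h : RT v s) (hu : Res v u k)
    (hk : k ≠ 0) (hw : Res v w m) : RT v (s * u + w) := by
  intro c
  have h1 := h ((m + c) / k)
  have h2 : con k * (s + con ((m + c) / k)) ≠ 0 := mul_ne_zero (con_ne_zero hk) h1.1
  have h3 : v (con k * (s + con ((m + c) / k))) = 0 := by
    rw [hv.mul (con_ne_zero hk) h1.1, hv.const, h1.2, add_zero]
  have h4 : Pos v ((u - con k) * s + (w - con m)) :=
    (Pos.mul_nonneg hv hu h.val.ge).add hv hw
  have := hv.unit_add h2 h3 h4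
  have e : con k * (s + con ((m + c) / k)) + ((u - con k) * s + (w - con m))
      = s * u + w + con c := by
    have := con_ne_zero hk
    rw [con_div, con_add]; field_simp; ring
  rwa [e] at this

theorem mul_res (hv : IsVal v) {s u : FunField} {k : ℂ} (h : RT v s) (hu : Res v u k)
    (hk : k ≠ 0) : RT v (s * u) := by
  have := h.affine hv hu hk (Res.const v 0)
  rwa [con_zero, add_zero] at this

theorem inv (hv : IsVal v) {s : FunField} (h : RT v s) : RT v s⁻¹ := by
  intro c
  have h0 := h.ne_zero
  rcases eq_or_ne c 0 with rfl | hc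
  · rw [con_zero, add_zero, hv.inv, h.val]; exact ⟨inv_ne_zero h0, neg_zero⟩
  have h1 := h c⁻¹
  have hc' := con_ne_zero hc
  have e : s⁻¹ + con c = con c * (s + con c⁻¹) * s⁻¹ := by
    rw [con_inv]; field_simp; ring
  have h2 : con c * (s + con c⁻¹) ≠ 0 := mul_ne_zero hc' h1.1
  rw [e]
  refine ⟨mul_ne_zero h2 (inv_ne_zero h0), ?_⟩
  rw [hv.mul h2 (inv_ne_zero h0), hv.mul hc' h1.1, hv.const, h1.2, hv.inv, h.val]; rfl

theorem inv_iff (hv : IsVal v) {s : FunField} : RT v s⁻¹ ↔ RT v s :=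
  ⟨fun h => by simpa using h.inv hv, fun h => h.inv hv⟩

theorem comp_iff {s : FunField} (Φ : FunField ≃ₐ[ℂ] FunField) : RT (v ∘ Φ) s ↔ RT v (Φ s) := by
  refine forall_congr' fun c => ?_
  have e : Φ s + con c = Φ (s + con c) := by rw [map_add, algEquiv_con]
  rw [Function.comp, e, Ne, Ne, EmbeddingLike.map_eq_zero_iff]

end RT

/-- A coordinate that fails to have transcendental residue has either a pole or the constant residue
`-c`. This is the case distinction used for horizontal lines. -/
theorem exists_of_not_RT {s : FunField} (hs : ∀ c, s + con c ≠ 0) (h : ¬ RT v s) (hv : IsVal v) :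
    v s < 0 ∨ ∃ c, 0 < v (s + con c) := by
  simp only [RT, not_forall, not_and] at h
  obtain ⟨c, hc⟩ := h
  have hc := hc (hs c)
  by_cases h0 : v s < 0
  · exact Or.inl h0
  · have := hv.nonneg_add (not_lt.1 h0) (hv.const c).ge
    exact Or.inr ⟨c, by omega⟩

end

end

noncomputable section

/-! Coordinates on the function field. -/

theorem aeval_xy (A : Poly) : aeval ![x, y] A = algebraMap Poly FunField A := by
  have : aeval ![x, y] = Algebra.algHom ℂ Poly FunField := by
    ext i; fin_cases i <;> simp [x, y] <;> rfl
  rw [this]; rfl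

theorem algebraMap_C (c : ℂ) : algebraMap Poly FunField (C c) = con c := by
  rw [con, IsScalarTower.algebraMap_apply ℂ Poly FunField]; rfl

theorem algebraMap_poly_injective : Function.Injective (algebraMap Poly FunField) :=
  IsFractionRing.injective _ _

theorem algebraMap_poly_ne_zero {A : Poly} (h : A ≠ 0) : algebraMap Poly FunField A ≠ 0 := by
  rwa [Ne, map_eq_zero_iff _ algebraMap_poly_injective]

theorem exists_eq_div {f : FunField} (hf : f ≠ 0) : ∃ A B : Poly, A ≠ 0 ∧ B ≠ 0 ∧
    f = algebraMap Poly FunField A / algebraMap Poly FunField B := by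
  obtain ⟨A, B, hB, rfl⟩ := IsFractionRing.div_surjective (A := Poly) f
  refine ⟨A, B, ?_, nonZeroDivisors.ne_zero hB, rfl⟩
  rintro rfl; simp at hf

theorem adjoin_xy : IntermediateField.adjoin ℂ {x, y} = ⊤ := by
  rw [eq_top_iff]
  intro f _
  have key : ∀ A : Poly, algebraMap Poly FunField A ∈ IntermediateField.adjoin ℂ {x, y} := by
    intro A
    rw [← aeval_xy]
    induction A using MvPolynomial.induction_on with
    | C a => simp
    | add p q hp hq => rw [map_add]; exact add_mem hp hq
    | mul_X p i hp =>
      rw [map_mul, aeval_X]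
      refine mul_mem hp (IntermediateField.subset_adjoin _ _ ?_)
      fin_cases i <;> simp
  obtain ⟨A, B, _, rfl⟩ := IsFractionRing.div_surjective (A := Poly) f
  exact div_mem (key A) (key B)

/-- `s, t` are the images of `x, y` under an automorphism of the function field. -/
def IsCoord (s t : FunField) : Prop := ∃ τ : FunField ≃ₐ[ℂ] FunField, τ x = s ∧ τ y = t

/-- Two generators of the function field are coordinates. -/
theorem isCoord_of_mem_adjoin {s t : FunField} (hx : x ∈ IntermediateField.adjoin ℂ {s, t})
    (hy : y ∈ IntermediateField.adjoin ℂ {s, t}) : IsCoord s t := by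
  have htop : IntermediateField.adjoin ℂ {s, t} = ⊤ := by
    rw [eq_top_iff, ← adjoin_xy, IntermediateField.adjoin_le_iff]
    rintro _ (rfl | rfl)
    exacts [hx, hy]
  have hr : Set.range ![s, t] = {s, t} := by simp [Set.pair_comm]
  have halg : Algebra.IsAlgebraic (Algebra.adjoin ℂ (Set.range ![s, t])) FunField := by
    constructor
    intro f
    have hf : f ∈ IntermediateField.adjoin ℂ {s, t} := by rw [htop]; trivial
    rw [← hr, IntermediateField.mem_adjoin_iff_div] at hf
    obtain ⟨a, ha, b, hb, rfl⟩ := hf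
    rw [div_eq_mul_inv]
    exact (isAlgebraic_algebraMap (⟨a, ha⟩ : Algebra.adjoin ℂ (Set.range ![s, t]))).mul
      (isAlgebraic_algebraMap (⟨b, hb⟩ : Algebra.adjoin ℂ (Set.range ![s, t]))).inv
  have hxy : AlgebraicIndependent ℂ ![x, y] := by
    intro A B h
    rw [aeval_xy, aeval_xy] at h
    exact algebraMap_poly_injective h
  -- The function field is algebraic over `ℂ[s, t]`, and its transcendence degree is at least two
  -- because of `x, y`. Hence the two generators form a transcendence basis.
  have hst : AlgebraicIndependent ℂ ![s, t] :=
    (Algebra.IsAlgebraic.isTranscendenceBasis_of_le_trdeg_of_finite ℂ ![s, t]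
      hxy.cardinalMk_le_trdeg).1
  have hst' : Function.Injective (aeval ![s, t] : Poly →ₐ[ℂ] FunField) := hst
  let τ : FunField →ₐ[ℂ] FunField := IsFractionRing.liftAlgHom hst'
  have hτ : ∀ A : Poly, τ (algebraMap Poly FunField A) = aeval ![s, t] A := fun A =>
    IsFractionRing.lift_algebraMap hst' A
  have h1 : τ x = s := by rw [x, hτ]; simp
  have h2 : τ y = t := by rw [y, hτ]; simp
  have hsurj : Function.Surjective τ := by
    rw [← AlgHom.fieldRange_eq_top, eq_top_iff, ← htop, IntermediateField.adjoin_le_iff]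
    rintro _ (rfl | rfl)
    exacts [⟨x, h1⟩, ⟨y, h2⟩]
  exact ⟨AlgEquiv.ofBijective τ ⟨τ.toRingHom.injective, hsurj⟩, h1, h2⟩

theorem aeval_algEquiv (τ : FunField ≃ₐ[ℂ] FunField) (s t : FunField) (A : Poly) :
    aeval ![τ s, τ t] A = τ (aeval ![s, t] A) := by
  have : aeval ![τ s, τ t] = (τ : FunField →ₐ[ℂ] FunField).comp (aeval ![s, t]) := by
    ext i; fin_cases i <;> simp
  rw [this]; rfl

open Classical in
theorem ordAlong_algEquiv (τ : FunField ≃ₐ[ℂ] FunField) (s t : FunField) (I : Ideal Poly)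
    (f : FunField) : ordAlong (τ s) (τ t) I (τ f) = ordAlong s t I f := by
  -- `ordAlong` chooses a fraction. The predicates that describe the admissible fractions on the two
  -- sides are equal, so the same fraction is chosen and independence of the choice is not needed
  -- here, for any ideal `I`.
  have : (fun AB : Poly × Poly => AB.1 ≠ 0 ∧ AB.2 ≠ 0 ∧
      τ f * aeval ![τ s, τ t] AB.2 = aeval ![τ s, τ t] AB.1) = fun AB => AB.1 ≠ 0 ∧ AB.2 ≠ 0 ∧
      f * aeval ![s, t] AB.2 = aeval ![s, t] AB.1 := by
    funext AB
    rw [aeval_algEquiv, aeval_algEquiv, ← map_mul, EmbeddingLike.apply_eq_iff_eq]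
  let F : (Poly × Poly → Prop) → ℤ := fun q =>
    if h : ∃ AB, q AB then (polyOrd I h.choose.1 : ℤ) - polyOrd I h.choose.2 else 0
  exact congrArg F this

theorem ordAlong_comp (τ : FunField ≃ₐ[ℂ] FunField) (s t : FunField) (I : Ideal Poly) :
    ordAlong (τ s) (τ t) I ∘ τ = ordAlong s t I := funext fun f => ordAlong_algEquiv τ s t I f

/-! Orders of vanishing of polynomials. -/

/-- The order of vanishing along an ideal is additive. -/
def Additive (I : Ideal Poly) : Prop :=
  ∀ A B : Poly, A ≠ 0 → B ≠ 0 → polyOrd I (A * B) = polyOrd I A + polyOrd I B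

/-- Additivity removes the dependence on the chosen fraction: two fractions for the same function
satisfy a cross-multiplied identity of polynomials, whose orders can be compared. -/
theorem ordAlong_div {I : Ideal Poly} (hI : Additive I) {A B : Poly} (hA : A ≠ 0) (hB : B ≠ 0) :
    ordAlong x y I (algebraMap Poly FunField A / algebraMap Poly FunField B)
      = (polyOrd I A : ℤ) - polyOrd I B := by
  have hB' := algebraMap_poly_ne_zero hB
  have h : ∃ AB : Poly × Poly, AB.1 ≠ 0 ∧ AB.2 ≠ 0 ∧
      algebraMap Poly FunField A / algebraMap Poly FunField B * aeval ![x, y] AB.2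
        = aeval ![x, y] AB.1 :=
    ⟨(A, B), hA, hB, by simp only [aeval_xy]; field_simp⟩
  rw [ordAlong, dif_pos h]
  obtain ⟨h1, h2, h3⟩ := h.choose_spec
  generalize h.choose = D at h1 h2 h3
  rw [aeval_xy, aeval_xy, div_mul_eq_mul_div, div_eq_iff hB', ← map_mul, ← map_mul] at h3
  have h4 := congrArg (polyOrd I) (algebraMap_poly_injective h3)
  rw [hI _ _ hA h2, hI _ _ h1 hB] at h4
  omega

theorem ordAlong_zero (I : Ideal Poly) : ordAlong x y I 0 = 0 := by
  rw [ordAlong, dif_neg]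
  rintro ⟨AB, h1, h2, h3⟩
  rw [zero_mul, aeval_xy] at h3
  exact algebraMap_poly_ne_zero h1 h3.symm

theorem finiteMultiplicity {P A : Poly} (hP : Irreducible P) (hA : A ≠ 0) :
    FiniteMultiplicity P A := FiniteMultiplicity.of_prime_left hP.prime hA

theorem multiplicity_self_eq_one {P : Poly} (hP : Irreducible P) : multiplicity P P = 1 := by
  refine multiplicity_eq_of_dvd_of_not_dvd (by simp) fun h => ?_
  rw [pow_two] at h
  have := (mul_dvd_mul_iff_left hP.ne_zero).1 (h.trans (mul_one P).symm.dvd)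
  exact hP.not_isUnit (isUnit_of_dvd_one this)

theorem polyOrd_span {P A : Poly} (hP : Irreducible P) (hA : A ≠ 0) :
    polyOrd (Ideal.span {P}) A = multiplicity P A := by
  have : {n : ℕ | A ∈ Ideal.span {P} ^ n} = Set.Iic (multiplicity P A) := by
    ext n
    rw [Set.mem_ofPred_eq, Ideal.span_singleton_pow, Ideal.mem_span_singleton,
      (finiteMultiplicity hP hA).pow_dvd_iff_le_multiplicity, Set.mem_Iic]
  rw [polyOrd, this, csSup_Iic]

theorem additive_span {P : Poly} (hP : Irreducible P) : Additive (Ideal.span {P}) := by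
  intro A B hA hB
  rw [polyOrd_span hP hA, polyOrd_span hP hB, polyOrd_span hP (mul_ne_zero hA hB),
    multiplicity_mul hP.prime (finiteMultiplicity hP (mul_ne_zero hA hB))]

theorem ordAlong_span_div {P A B : Poly} (hP : Irreducible P) (hA : A ≠ 0) (hB : B ≠ 0) :
    ordAlong x y (Ideal.span {P}) (algebraMap Poly FunField A / algebraMap Poly FunField B)
      = (multiplicity P A : ℤ) - multiplicity P B := by
  rw [ordAlong_div (additive_span hP) hA hB, polyOrd_span hP hA, polyOrd_span hP hB]

theorem ordAlong_span_algebraMap {P A : Poly} (hP : Irreducible P) (hA : A ≠ 0) :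
    ordAlong x y (Ideal.span {P}) (algebraMap Poly FunField A) = multiplicity P A := by
  have h := ordAlong_span_div hP hA one_ne_zero
  rw [map_one, div_one, multiplicity_eq_zero.2 (fun h => hP.not_isUnit (isUnit_of_dvd_one h))]
    at h
  simpa using h

theorem ordAlong_span_self {P : Poly} (hP : Irreducible P) :
    ordAlong x y (Ideal.span {P}) (algebraMap Poly FunField P) = 1 := by
  rw [ordAlong_span_algebraMap hP hP.ne_zero,
    multiplicity_self_eq_one hP, Nat.cast_one]

theorem isVal_ordAlong_xy {P : Poly} (hP : Irreducible P) :
    IsVal (ordAlong x y (Ideal.span {P})) where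
  zero := ordAlong_zero _
  mul {f g} hf hg := by
    obtain ⟨A, B, hA, hB, rfl⟩ := exists_eq_div hf
    obtain ⟨A', B', hA', hB', rfl⟩ := exists_eq_div hg
    rw [div_mul_div_comm, ← map_mul, ← map_mul, ordAlong_span_div hP hA hB,
      ordAlong_span_div hP hA' hB', ordAlong_span_div hP (mul_ne_zero hA hA') (mul_ne_zero hB hB'),
      multiplicity_mul hP.prime (finiteMultiplicity hP (mul_ne_zero hA hA')),
      multiplicity_mul hP.prime (finiteMultiplicity hP (mul_ne_zero hB hB'))]
    push_cast; ring
  add {f g} hf hg hfg := by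
    obtain ⟨A, B, hA, hB, rfl⟩ := exists_eq_div hf
    obtain ⟨A', B', hA', hB', rfl⟩ := exists_eq_div hg
    rw [div_add_div _ _ (algebraMap_poly_ne_zero hB) (algebraMap_poly_ne_zero hB'), ← map_mul,
      ← map_mul, ← map_mul, ← map_add] at hfg ⊢
    have h0 : A * B' + B * A' ≠ 0 := by
      intro h; rw [h] at hfg; simp at hfg
    rw [ordAlong_span_div hP hA hB, ordAlong_span_div hP hA' hB',
      ordAlong_span_div hP h0 (mul_ne_zero hB hB'),
      multiplicity_mul hP.prime (finiteMultiplicity hP (mul_ne_zero hB hB'))]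
    have h1 := (finiteMultiplicity hP (mul_ne_zero hA hB'))
    have h2 := (finiteMultiplicity hP (mul_ne_zero hB hA'))
    have h3 : min (multiplicity P (A * B')) (multiplicity P (B * A'))
        ≤ multiplicity P (A * B' + B * A') := by
      rw [← (finiteMultiplicity hP h0).pow_dvd_iff_le_multiplicity]
      exact dvd_add ((pow_dvd_pow _ (min_le_left _ _)).trans (pow_multiplicity_dvd _ _))
        ((pow_dvd_pow _ (min_le_right _ _)).trans (pow_multiplicity_dvd _ _))
    rw [multiplicity_mul hP.prime h1, multiplicity_mul hP.prime h2] at h3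
    omega
  const z := by
    rcases eq_or_ne z 0 with rfl | hz
    · rw [con_zero, ordAlong_zero]
    rw [← algebraMap_C, ordAlong_span_algebraMap hP (by simpa using hz),
      multiplicity_eq_zero.2, Nat.cast_zero]
    intro h
    exact hP.not_isUnit (isUnit_of_dvd_unit h ((isUnit_iff_ne_zero.2 hz).map C))

theorem IsCoord.isVal {s t : FunField} (h : IsCoord s t) {P : Poly} (hP : Irreducible P) :
    IsVal (ordAlong s t (Ideal.span {P})) := by
  obtain ⟨τ, rfl, rfl⟩ := h
  have := (isVal_ordAlong_xy hP).comp τ.symm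
  rwa [← ordAlong_comp τ, Function.comp_assoc, show (τ ∘ τ.symm : FunField → FunField) = id from
    funext fun f => τ.apply_symm_apply f] at this

theorem IsCoord.ordAlong_aeval {s t : FunField} (h : IsCoord s t) {P A : Poly}
    (hP : Irreducible P) (hA : A ≠ 0) :
    ordAlong s t (Ideal.span {P}) (aeval ![s, t] A) = multiplicity P A := by
  obtain ⟨τ, rfl, rfl⟩ := h
  rw [aeval_algEquiv, ordAlong_algEquiv, aeval_xy, ordAlong_span_algebraMap hP hA]

theorem IsCoord.ordAlong_self {s t : FunField} (h : IsCoord s t) {P : Poly}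
    (hP : Irreducible P) : ordAlong s t (Ideal.span {P}) (aeval ![s, t] P) = 1 := by
  rw [h.ordAlong_aeval hP hP.ne_zero,
    multiplicity_self_eq_one hP, Nat.cast_one]

theorem IsCoord.aeval_ne_zero {s t : FunField} (h : IsCoord s t) {A : Poly} (hA : A ≠ 0) :
    aeval ![s, t] A ≠ 0 := by
  obtain ⟨τ, rfl, rfl⟩ := h
  rw [aeval_algEquiv, aeval_xy, Ne, EmbeddingLike.map_eq_zero_iff]
  exact algebraMap_poly_ne_zero hA

end

/-! ### Valuations whose center is a curve. -/

noncomputable section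

/-- A prime ideal of the polynomial ring that contains two elements without common factor is
maximal. -/
theorem isMaximal_of_not_dvd {p : Ideal Poly} [hp : p.IsPrime] {P B : Poly} (hP : Irreducible P)
    (hPp : P ∈ p) (hB : B ∈ p) (hPB : ¬ P ∣ B) : p.IsMaximal := by
  by_contra hmax
  obtain ⟨m, hm, hpm⟩ := p.exists_le_maximal hp.ne_top
  have h3 : p < m := lt_of_le_of_ne hpm (by rintro rfl; exact hmax hm)
  have hP' : (Ideal.span {P}).IsPrime := (Ideal.span_singleton_prime hP.ne_zero).2 hP.prime
  have h1 : (⊥ : Ideal Poly) < Ideal.span {P} := by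
    rw [bot_lt_iff_ne_bot, Ne, Ideal.span_singleton_eq_bot]; exact hP.ne_zero
  have h2 : Ideal.span {P} < p := by
    refine lt_of_le_of_ne (by rwa [Ideal.span_singleton_le_iff_mem]) ?_
    rintro rfl
    exact hPB (Ideal.mem_span_singleton.1 hB)
  have hm' := hm.isPrime
  -- If `p` were not maximal, `0 < (P) < p < m` would be a chain of length three in the spectrum of
  -- a ring of dimension two.
  let q : Fin 4 → PrimeSpectrum Poly := ![⟨⊥, Ideal.isPrime_bot⟩, ⟨_, hP'⟩, ⟨p, hp⟩, ⟨m, hm'⟩]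
  have hq : StrictMono q := by
    rw [Fin.strictMono_iff_lt_succ]
    intro i
    fin_cases i
    exacts [h1, h2, h3]
  have h := Order.LTSeries.length_le_krullDim (LTSeries.mk 3 q hq)
  have hd : Order.krullDim (PrimeSpectrum Poly) = 2 := by
    have := MvPolynomial.ringKrullDim_of_isNoetherianRing (R := ℂ) (ι := Fin 2)
    rw [ringKrullDim_eq_zero_of_field, zero_add, Nat.card_fin] at this
    exact this
  rw [hd] at h
  change ((3 : ℕ) : WithBot ℕ∞) ≤ ((2 : ℕ) : WithBot ℕ∞) at h
  exact absurd (Nat.cast_le.1 h) (by norm_num)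

theorem algebraMap_X_sub_C (i : Fin 2) (c : ℂ) :
    algebraMap Poly FunField (X i - C c) = ![x, y] i - con c := by
  rw [map_sub, algebraMap_C]; fin_cases i <;> rfl

theorem x_ne_zero : x ≠ 0 := algebraMap_poly_ne_zero (X_ne_zero 0)

theorem y_ne_zero : y ≠ 0 := algebraMap_poly_ne_zero (X_ne_zero 1)

theorem IsVal.nonneg_poly {v : FunField → ℤ} (hv : IsVal v) (hx : 0 ≤ v x) (hy : 0 ≤ v y)
    (A : Poly) : 0 ≤ v (algebraMap Poly FunField A) := by
  induction A using MvPolynomial.induction_on with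
  | C a => rw [algebraMap_C, hv.const]
  | add p q hp hq => rw [map_add]; exact hv.nonneg_add hp hq
  | mul_X p i hp =>
    rw [map_mul]
    refine hv.nonneg_mul hp ?_
    fin_cases i
    exacts [hx, hy]

/-- The center of a valuation on the affine plane. -/
def center (v : FunField → ℤ) (hv : IsVal v) (hx : 0 ≤ v x) (hy : 0 ≤ v y) : Ideal Poly where
  carrier := {A | Pos v (algebraMap Poly FunField A)}
  zero_mem' := Or.inl (map_zero _)
  add_mem' {A B} hA hB := by
    change Pos v _
    rw [map_add]; exact Pos.add hv hA hB
  smul_mem' A B hB := by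
    change Pos v _
    rw [smul_eq_mul, mul_comm, map_mul]
    exact Pos.mul_nonneg hv hB (hv.nonneg_poly hx hy A)

theorem mem_center {v : FunField → ℤ} {hv : IsVal v} {hx : 0 ≤ v x} {hy : 0 ≤ v y} {A : Poly} :
    A ∈ center v hv hx hy ↔ Pos v (algebraMap Poly FunField A) := Iff.rfl

theorem center_isPrime {v : FunField → ℤ} (hv : IsVal v) (hx : 0 ≤ v x) (hy : 0 ≤ v y) :
    (center v hv hx hy).IsPrime := by
  refine ⟨?_, ?_⟩
  · rw [Ne, Ideal.eq_top_iff_one, mem_center, map_one, Pos, hv.one]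
    simp
  · intro A B h
    rw [mem_center, map_mul] at h
    by_contra! hAB
    simp only [mem_center, Pos, not_or, not_lt] at hAB
    rcases h with h | h
    · rcases mul_eq_zero.1 h with h | h
      exacts [hAB.1.1 h, hAB.2.1 h]
    · rw [hv.mul hAB.1.1 hAB.2.1] at h
      omega

/-- A normalized valuation whose center on the affine plane is a curve is the order of vanishing
along this curve. -/
theorem exists_eq_ordAlong_xy {v : FunField → ℤ} (hv : IsVal v) (hx : 0 ≤ v x) (hy : 0 ≤ v y)
    (hRT : RT v x ∨ RT v y) (h1 : ∃ f, v f = 1) :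
    ∃ P : Poly, Irreducible P ∧ v = ordAlong x y (Ideal.span {P}) := by
  obtain ⟨f, hf⟩ := h1
  have hf0 : f ≠ 0 := by rintro rfl; simp [hv.zero] at hf
  have hprime := center_isPrime hv hx hy
  have hnn := hv.nonneg_poly hx hy
  -- By the Nullstellensatz a maximal ideal is a point, and at a point both coordinates have
  -- constant residue.
  have hmax : ¬ (center v hv hx hy).IsMaximal := by
    rw [MvPolynomial.isMaximal_iff_eq_vanishingIdeal_singleton]
    rintro ⟨a, ha⟩
    have key : ∀ i, Res v (![x, y] i) (a i) := by
      intro i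
      have : (X i - C (a i) : Poly) ∈ center v hv hx hy := by
        rw [ha, mem_vanishingIdeal_iff]
        simp
      rwa [mem_center, algebraMap_X_sub_C] at this
    rcases hRT with h | h
    · exact h.not_res (key 0)
    · exact h.not_res (key 1)
  -- Otherwise factorisation into irreducibles gives every nonzero polynomial the value zero, and `v
  -- f = 1` is impossible.
  have hP : ∃ P, Irreducible P ∧ 0 < v (algebraMap Poly FunField P) := by
    by_contra! hcon
    have h0 : ∀ A : Poly, A ≠ 0 → v (algebraMap Poly FunField A) = 0 := by
      intro A
      induction A using WfDvdMonoid.induction_on_irreducible with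
      | zero => simp
      | unit u hu =>
        intro _
        obtain ⟨c, hc, rfl⟩ := MvPolynomial.isUnit_iff_eq_C_of_isReduced.1 hu
        rw [algebraMap_C, hv.const]
      | mul a i ha hi ih =>
        intro _
        rw [map_mul, hv.mul (algebraMap_poly_ne_zero hi.ne_zero) (algebraMap_poly_ne_zero ha),
          ih ha]
        have := hcon i hi
        have := hnn i
        omega
    obtain ⟨A, B, hA, hB, rfl⟩ := exists_eq_div hf0
    rw [hv.div (algebraMap_poly_ne_zero hA) (algebraMap_poly_ne_zero hB), h0 A hA, h0 B hB] at hf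
    omega
  obtain ⟨P, hP, hvP⟩ := hP
  -- A polynomial prime to `P` with positive value would lie in the center together with `P` and
  -- make the center maximal. So `v` depends only on the multiplicity of `P`.
  have hB : ∀ B, ¬ P ∣ B → v (algebraMap Poly FunField B) = 0 := by
    intro B hPB
    by_contra h
    have := hnn B
    exact hmax (isMaximal_of_not_dvd hP (mem_center.2 (Or.inr hvP))
      (mem_center.2 (Or.inr (by omega))) hPB)
  have hA : ∀ A, A ≠ 0 → v (algebraMap Poly FunField A)
      = multiplicity P A * v (algebraMap Poly FunField P) := by
    intro A hA
    obtain ⟨c, hc, hc'⟩ := (finiteMultiplicity hP hA).exists_eq_pow_mul_and_not_dvd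
    have hc0 : c ≠ 0 := by rintro rfl; simp at hc'
    conv_lhs => rw [hc]
    rw [map_mul, map_pow, hv.mul (pow_ne_zero _ (algebraMap_poly_ne_zero hP.ne_zero))
      (algebraMap_poly_ne_zero hc0), hv.pow (algebraMap_poly_ne_zero hP.ne_zero), hB c hc', add_zero]
  have hall : ∀ g, v g = ordAlong x y (Ideal.span {P}) g * v (algebraMap Poly FunField P) := by
    intro g
    rcases eq_or_ne g 0 with rfl | hg
    · rw [hv.zero, ordAlong_zero, zero_mul]
    obtain ⟨A, B, hA0, hB0, rfl⟩ := exists_eq_div hg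
    rw [hv.div (algebraMap_poly_ne_zero hA0) (algebraMap_poly_ne_zero hB0), hA A hA0, hA B hB0,
      ordAlong_span_div hP hA0 hB0]
    ring
  have h1 : v (algebraMap Poly FunField P) = 1 := by
    have := hall f
    rw [hf, mul_comm] at this
    exact Int.eq_one_of_mul_eq_one_right hvP.le this.symm
  exact ⟨P, hP, funext fun g => by rw [hall g, h1, mul_one]⟩

section

variable {s t : FunField} {v : FunField → ℤ}

theorem exists_eq_ordAlong (hst : IsCoord s t) (hv : IsVal v) (hs : 0 ≤ v s)
    (ht : 0 ≤ v t) (hRT : RT v s ∨ RT v t) (h1 : ∃ f, v f = 1) :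
    ∃ P : Poly, Irreducible P ∧ v = ordAlong s t (Ideal.span {P}) := by
  obtain ⟨τ, rfl, rfl⟩ := hst
  obtain ⟨f, hf⟩ := h1
  obtain ⟨P, hP, h⟩ := exists_eq_ordAlong_xy (hv.comp τ) hs ht
    (by rwa [RT.comp_iff, RT.comp_iff]) ⟨τ.symm f, by simp [hf]⟩
  refine ⟨P, hP, funext fun g => ?_⟩
  have := congrFun h (τ.symm g)
  rw [Function.comp, AlgEquiv.apply_symm_apply] at this
  rw [this, ← ordAlong_algEquiv τ, AlgEquiv.apply_symm_apply]

/-- The valuation `v` is the order of vanishing along the curve `t = 0`, in coordinates `s, t`. -/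
structure IsGauss (v : FunField → ℤ) (s t : FunField) : Prop where
  isVal : IsVal v
  val : v t = 1
  rt : RT v s

/-- The valuation is the order along some irreducible `P`, and the positive value of `t` makes `P`
divide `X 1`, so the two are associated. -/
theorem eq_ordAlong_X (hst : IsCoord s t) (hv : IsVal v) (hs : RT v s) (ht : 0 < v t)
    (h1 : ∃ f, v f = 1) : v = ordAlong s t (Ideal.span {X 1}) := by
  obtain ⟨P, hP, h⟩ := exists_eq_ordAlong hst hv hs.val.ge ht.le (Or.inl hs) h1
  rw [h]
  have h2 : aeval ![s, t] (X 1 : Poly) = t := by simp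
  have h5 := hst.ordAlong_aeval hP (X_ne_zero 1)
  rw [h2] at h5
  rw [h, h5] at ht
  have h3 : P ∣ X 1 := multiplicity_ne_zero.1 (by omega)
  have h4 : Associated P (X 1) := hP.associated_of_dvd X_prime.irreducible h3
  rw [Ideal.span_singleton_eq_span_singleton.2 h4]

theorem IsGauss.eq (h : IsGauss v s t) (hst : IsCoord s t) : v = ordAlong s t (Ideal.span {X 1}) :=
  eq_ordAlong_X hst h.isVal h.rt (by rw [h.val]; norm_num) ⟨t, h.val⟩

/-- The main tool for identifying images of curves: one value and one transcendental residue
determine the valuation. -/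
theorem IsGauss.unique {v' : FunField → ℤ} (h : IsGauss v s t) (h' : IsGauss v' s t)
    (hst : IsCoord s t) : v = v' := (h.eq hst).trans (h'.eq hst).symm

theorem not_X_dvd_X_add_C {i j : Fin 2} (hij : i ≠ j) (c : ℂ) : ¬ (X j : Poly) ∣ X i + C c := by
  intro h
  obtain ⟨B, hB⟩ := h
  -- At this point `X j` vanishes while `X i + c` equals `1`.
  have h1 := congrArg (eval (Function.update (fun _ => 0) i (1 - c))) hB
  simp [Function.update_of_ne hij.symm] at h1

theorem IsCoord.isGauss (hst : IsCoord s t) : IsGauss (ordAlong s t (Ideal.span {X 1})) s t where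
  isVal := hst.isVal X_prime.irreducible
  val := by simpa using hst.ordAlong_self (X_prime (i := (1 : Fin 2))).irreducible
  rt c := by
    have h := not_X_dvd_X_add_C (i := 0) (j := 1) (by decide) c
    have h0 : (X 0 + C c : Poly) ≠ 0 := fun h' => h (h' ▸ dvd_zero _)
    have e : aeval ![s, t] (X 0 + C c : Poly) = s + con c := by simp [con]
    rw [← e]
    refine ⟨hst.aeval_ne_zero h0, ?_⟩
    rw [hst.ordAlong_aeval X_prime.irreducible h0, multiplicity_eq_zero.2 h, Nat.cast_zero]

theorem isGauss_iff (hst : IsCoord s t) : IsGauss v s t ↔ v = ordAlong s t (Ideal.span {X 1}) :=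
  ⟨fun h => h.eq hst, fun h => h ▸ hst.isGauss⟩

/-- The order along a curve has a coordinate with transcendental residue. -/
theorem IsCoord.rt_or_rt (hst : IsCoord s t) {P : Poly} (hP : Irreducible P) :
    RT (ordAlong s t (Ideal.span {P})) s ∨ RT (ordAlong s t (Ideal.span {P})) t := by
  have hlin : ∀ (i : Fin 2) (c : ℂ), ¬ P ∣ X i + C c → ![s, t] i + con c ≠ 0 ∧
      ordAlong s t (Ideal.span {P}) (![s, t] i + con c) = 0 := by
    intro i c h
    have h0 : (X i + C c : Poly) ≠ 0 := fun h' => h (h' ▸ dvd_zero _)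
    have e : aeval ![s, t] (X i + C c : Poly) = ![s, t] i + con c := by simp [con]
    rw [← e]
    refine ⟨hst.aeval_ne_zero h0, ?_⟩
    rw [hst.ordAlong_aeval hP h0, multiplicity_eq_zero.2 h, Nat.cast_zero]
  by_contra! h
  simp only [RT, not_forall] at h
  obtain ⟨⟨a, ha⟩, b, hb⟩ := h
  have ha : P ∣ X 0 + C a := by
    by_contra h
    exact ha (hlin 0 a h)
  have hb : P ∣ X 1 + C b := by
    by_contra h
    exact hb (hlin 1 b h)
  have hdeg : ∀ (i : Fin 2) (c : ℂ), Irreducible (X i + C c : Poly) := by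
    intro i c
    refine irreducible_of_totalDegree_eq_one ?_ fun u hu => ?_
    · rw [totalDegree_add_eq_left_of_totalDegree_lt] <;> simp
    · have := hu (Finsupp.single i 1)
      rw [coeff_add, coeff_X, if_pos rfl, coeff_C, if_neg (by simp [eq_comm]), add_zero] at this
      exact isUnit_of_dvd_one this
  -- With two constant residues `P` would divide `X 0 + a` and `X 1 + b`. The first is irreducible,
  -- hence it would divide the second, which is refuted at the point `(-a, 1 - b)`.
  have := ((hP.associated_of_dvd (hdeg 0 a) ha).symm.dvd.trans hb)
  obtain ⟨Q, hQ⟩ := this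
  have h1 := congrArg (eval ![-a, 1 - b]) hQ
  simp at h1

end

end

/-! ### Changes of coordinates, blow-ups, and curves on the product. -/

noncomputable section

theorem con_mem (F : IntermediateField ℂ FunField) (c : ℂ) : con c ∈ F := F.algebraMap_mem c

theorem isCoord_xy : IsCoord x y := ⟨AlgEquiv.refl, rfl, rfl⟩

namespace IsCoord

variable {s t : FunField}

theorem left_ne_zero (h : IsCoord s t) : s ≠ 0 := by
  obtain ⟨τ, rfl, rfl⟩ := h
  rw [Ne, EmbeddingLike.map_eq_zero_iff]; exact x_ne_zero

theorem right_ne_zero (h : IsCoord s t) : t ≠ 0 := by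
  obtain ⟨τ, rfl, rfl⟩ := h
  rw [Ne, EmbeddingLike.map_eq_zero_iff]; exact y_ne_zero

/-- A second pair of generators. -/
theorem of_mem {s' t' : FunField} (h : IsCoord s t)
    (hs : s ∈ IntermediateField.adjoin ℂ {s', t'}) (ht : t ∈ IntermediateField.adjoin ℂ {s', t'}) :
    IsCoord s' t' := by
  have key : ∀ A : Poly, aeval ![s, t] A ∈ IntermediateField.adjoin ℂ {s', t'} := by
    intro A
    induction A using MvPolynomial.induction_on with
    | C a => simp
    | add p q hp hq => rw [map_add]; exact add_mem hp hq
    | mul_X p i hp =>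
      rw [map_mul, aeval_X]
      refine mul_mem hp ?_
      fin_cases i
      exacts [hs, ht]
  have htop : ∀ f, f ∈ IntermediateField.adjoin ℂ {s', t'} := by
    intro f
    obtain ⟨τ, rfl, rfl⟩ := h
    obtain ⟨A, B, -, hAB⟩ := IsFractionRing.div_surjective (A := Poly) (τ.symm f)
    have : f = aeval ![τ x, τ y] A / aeval ![τ x, τ y] B := by
      rw [aeval_algEquiv, aeval_algEquiv, aeval_xy, aeval_xy, ← map_div₀, hAB,
        AlgEquiv.apply_symm_apply]
    rw [this]
    exact div_mem (key A) (key B)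
  exact isCoord_of_mem_adjoin (htop x) (htop y)

theorem swap (h : IsCoord s t) : IsCoord t s :=
  h.of_mem (IntermediateField.subset_adjoin _ _ (by simp))
    (IntermediateField.subset_adjoin _ _ (by simp))

theorem inv_left (h : IsCoord s t) : IsCoord s⁻¹ t :=
  h.of_mem (inv_mem_iff.1 (IntermediateField.subset_adjoin _ _ (by simp)))
    (IntermediateField.subset_adjoin _ _ (by simp))

theorem inv_right (h : IsCoord s t) : IsCoord s t⁻¹ := h.swap.inv_left.swap

theorem add_con_left (h : IsCoord s t) (c : ℂ) : IsCoord (s + con c) t := by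
  refine h.of_mem ?_ (IntermediateField.subset_adjoin _ _ (by simp))
  have := sub_mem (IntermediateField.subset_adjoin ℂ {s + con c, t} (by simp : s + con c ∈ _))
    (con_mem _ c)
  rwa [add_sub_cancel_right] at this

theorem add_con_right (h : IsCoord s t) (c : ℂ) : IsCoord s (t + con c) :=
  (h.swap.add_con_left c).swap

theorem mul_left (h : IsCoord s t) {u : FunField}
    (hu : u ∈ IntermediateField.adjoin ℂ {t}) (hu0 : u ≠ 0) : IsCoord (s * u) t := by
  refine h.of_mem ?_ (IntermediateField.subset_adjoin _ _ (by simp))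
  have h1 : u ∈ IntermediateField.adjoin ℂ {s * u, t} :=
    IntermediateField.adjoin.mono _ _ _ (by simp) hu
  have := div_mem (IntermediateField.subset_adjoin ℂ {s * u, t} (by simp : s * u ∈ _)) h1
  rwa [mul_div_cancel_right₀ _ hu0] at this

theorem blowup (h : IsCoord s t) : IsCoord (t / s) s := by
  rw [div_eq_mul_inv]
  exact h.swap.mul_left (inv_mem (IntermediateField.mem_adjoin_simple_self _ _))
    (inv_ne_zero h.left_ne_zero)

theorem add_con_ne_zero (h : IsCoord s t) (c : ℂ) : s + con c ≠ 0 :=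
  (h.add_con_left c).left_ne_zero

end IsCoord

/-! The order of vanishing at a point is the order along the exceptional curve of the blow-up. -/

/-- The substitution `X 0 ↦ X 1`, `X 1 ↦ X 0 * X 1`. -/
def blowPoly : Poly →ₐ[ℂ] Poly := aeval ![X 1, X 0 * X 1]

/-- The exponents of the images of monomials under `blowPoly`. -/
def blowExp (m : Fin 2 →₀ ℕ) : Fin 2 →₀ ℕ :=
  Finsupp.single 0 (m 1) + Finsupp.single 1 (m 0 + m 1)

theorem blowExp_injective : Function.Injective blowExp := by
  intro m n h
  have h0 := DFunLike.congr_fun h 0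
  have h1 := DFunLike.congr_fun h 1
  simp [blowExp] at h0 h1
  ext i
  fin_cases i
  · simp; omega
  · exact h0

theorem blowPoly_monomial (m : Fin 2 →₀ ℕ) (a : ℂ) :
    blowPoly (monomial m a) = monomial (blowExp m) a := by
  rw [blowPoly, aeval_monomial, Finsupp.prod_fintype _ _ (by simp), Fin.prod_univ_two,
    monomial_eq, blowExp, Finsupp.prod_add_index' (by simp) (by intros; rw [pow_add]),
    Finsupp.prod_single_index (by simp), Finsupp.prod_single_index (by simp)]
  simp only [Matrix.cons_val_zero, Matrix.cons_val_one]
  rw [MvPolynomial.algebraMap_eq]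
  ring

/-- The substitution sends distinct monomials to distinct monomials, so nothing cancels and the
support of `A` can be read off after the blow-up. -/
theorem coeff_blowPoly (A : Poly) (m : Fin 2 →₀ ℕ) :
    coeff (blowExp m) (blowPoly A) = coeff m A := by
  induction A using MvPolynomial.induction_on' with
  | monomial n a =>
    rw [blowPoly_monomial, coeff_monomial, coeff_monomial]
    simp only [blowExp_injective.eq_iff]
  | add p q hp hq => rw [map_add, coeff_add, coeff_add, hp, hq]

theorem span_X_eq : (Ideal.span {X 0, X 1} : Ideal Poly) = idealOfVars (Fin 2) ℂ := by
  rw [idealOfVars]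
  congr 1
  ext p
  simp [Fin.exists_fin_two, eq_comm]

/-- Membership in the `n`-th power means that all monomials have degree at least `n`, and the total
degree of a monomial is the exponent of `X 1` in its image. This reduces multiplicity at a point to
order along a curve. -/
theorem mem_pow_iff_dvd_blowPoly (A : Poly) (n : ℕ) :
    A ∈ (Ideal.span {X 0, X 1} : Ideal Poly) ^ n ↔ X 1 ^ n ∣ blowPoly A := by
  rw [span_X_eq]
  constructor
  · intro h
    rw [mem_pow_idealOfVars_iff] at h
    rw [A.as_sum, map_sum]
    refine Finset.dvd_sum fun m hm => ?_
    rw [blowPoly_monomial, X_pow_eq_monomial, monomial_dvd_monomial]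
    refine ⟨Or.inr ?_, one_dvd _⟩
    have := h m hm
    rw [Finsupp.degree_eq_sum, Fin.sum_univ_two] at this
    rw [Finsupp.single_le_iff]
    simpa [blowExp] using this
  · rintro ⟨B, hB⟩
    rw [mem_pow_idealOfVars_iff]
    intro m hm
    rw [mem_support_iff, ← coeff_blowPoly, hB, X_pow_eq_monomial, coeff_monomial_mul'] at hm
    have h1 : Finsupp.single 1 n ≤ blowExp m := by
      by_contra h
      exact hm (if_neg h)
    rw [Finsupp.single_le_iff] at h1
    rw [Finsupp.degree_eq_sum, Fin.sum_univ_two]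
    simpa [blowExp] using h1

theorem polyOrd_point (A : Poly) :
    polyOrd (Ideal.span {X 0, X 1}) A = polyOrd (Ideal.span {X 1}) (blowPoly A) := by
  simp only [polyOrd, mem_pow_iff_dvd_blowPoly, Ideal.span_singleton_pow,
    Ideal.mem_span_singleton]

theorem blowPoly_injective : Function.Injective blowPoly := by
  intro A B h
  ext m
  rw [← coeff_blowPoly, h, coeff_blowPoly]

theorem additive_point : Additive (Ideal.span {X 0, X 1}) := by
  intro A B hA hB
  rw [polyOrd_point, polyOrd_point, polyOrd_point, map_mul]
  exact additive_span X_prime.irreducible _ _ (by rwa [Ne, map_eq_zero_iff _ blowPoly_injective])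
    (by rwa [Ne, map_eq_zero_iff _ blowPoly_injective])

theorem ordAlong_point_xy :
    ordAlong x y (Ideal.span {X 0, X 1}) = ordAlong (y / x) x (Ideal.span {X 1}) := by
  -- The automorphism `x ↦ y / x`, `y ↦ x` undoes `blowPoly`: `X 0` goes to `X 1` and then to `x`,
  -- while `X 1` goes to `X 0 * X 1` and then to `(y / x) * x = y`.
  obtain ⟨τ, h1, h2⟩ := isCoord_xy.blowup
  have h3 : ∀ A, algebraMap Poly FunField A = τ (algebraMap Poly FunField (blowPoly A)) := by
    intro A
    rw [← aeval_xy, ← aeval_xy, ← aeval_algEquiv, h1, h2, blowPoly, ← AlgHom.comp_apply]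
    congr 1
    ext i
    fin_cases i
    · simp
    · simp [div_mul_cancel₀ _ x_ne_zero]
  funext f
  rcases eq_or_ne f 0 with rfl | hf
  · rw [(isCoord_xy.blowup.isGauss).isVal.zero, ordAlong_zero]
  obtain ⟨A, B, hA, hB, rfl⟩ := exists_eq_div hf
  have hA' : blowPoly A ≠ 0 := by rwa [Ne, map_eq_zero_iff _ blowPoly_injective]
  have hB' : blowPoly B ≠ 0 := by rwa [Ne, map_eq_zero_iff _ blowPoly_injective]
  rw [ordAlong_div additive_point hA hB, h3 A, h3 B, ← map_div₀]
  conv_rhs => rw [← h1]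
  conv_rhs => enter [2]; rw [← h2]
  rw [ordAlong_algEquiv, ordAlong_div (additive_span X_prime.irreducible) hA' hB', polyOrd_point,
    polyOrd_point]

theorem IsCoord.ordAlong_point {s t : FunField} (h : IsCoord s t) :
    ordAlong s t (Ideal.span {X 0, X 1}) = ordAlong (t / s) s (Ideal.span {X 1}) := by
  obtain ⟨τ, rfl, rfl⟩ := h
  funext f
  rw [← AlgEquiv.apply_symm_apply τ f, ← map_div₀, ordAlong_algEquiv, ordAlong_algEquiv,
    ordAlong_point_xy]

/-- The exceptional curve over the point `s = t = 0` is characterised by `s` being a local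
equation at its generic point and `t / s` having transcendental residue. -/
theorem isGauss_point_iff {s t : FunField} (h : IsCoord s t) {v : FunField → ℤ} :
    IsGauss v (t / s) s ↔ v = ordAlong s t (Ideal.span {X 0, X 1}) := by
  rw [h.ordAlong_point, isGauss_iff h.blowup]

/-! The curves on `ℙ¹ × ℙ¹`. -/

/-- The normalized valuations whose center on `ℙ¹ × ℙ¹` is a curve. -/
structure IsCurve (v : FunField → ℤ) : Prop where
  isVal : IsVal v
  exists_eq_one : ∃ f, v f = 1
  rt : RT v x ∨ RT v y

theorem isCoord_chart {s t : FunField} (hs : s ∈ ({x, x⁻¹} : Set FunField))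
    (ht : t ∈ ({y, y⁻¹} : Set FunField)) : IsCoord s t := by
  rcases hs with rfl | rfl <;> rcases ht with rfl | rfl
  exacts [isCoord_xy, isCoord_xy.inv_right, isCoord_xy.inv_left, isCoord_xy.inv_left.inv_right]

theorem isCurve_ordAlong {s t : FunField} (hs : s ∈ ({x, x⁻¹} : Set FunField))
    (ht : t ∈ ({y, y⁻¹} : Set FunField)) {P : Poly} (hP : Irreducible P) :
    IsCurve (ordAlong s t (Ideal.span {P})) := by
  have hst := isCoord_chart hs ht
  have hv := hst.isVal hP
  refine ⟨hv, ⟨_, hst.ordAlong_self hP⟩, ?_⟩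
  rcases hst.rt_or_rt hP with h | h
  · left
    rcases hs with rfl | rfl
    exacts [h, (RT.inv_iff hv).1 h]
  · right
    rcases ht with rfl | rfl
    exacts [h, (RT.inv_iff hv).1 h]

theorem IsCurve.exists_chart {v : FunField → ℤ} (h : IsCurve v) :
    ∃ s ∈ ({x, x⁻¹} : Set FunField), ∃ t ∈ ({y, y⁻¹} : Set FunField), ∃ A : Poly,
      Irreducible A ∧ v = ordAlong s t (Ideal.span {A}) := by
  have key : ∀ f : FunField, ∃ s ∈ ({f, f⁻¹} : Set FunField), 0 ≤ v s := by
    intro f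
    rcases le_total 0 (v f) with h0 | h0
    · exact ⟨f, Or.inl rfl, h0⟩
    · exact ⟨f⁻¹, Or.inr rfl, by rw [h.isVal.inv]; omega⟩
  obtain ⟨s, hs, hs0⟩ := key x
  obtain ⟨t, ht, ht0⟩ := key y
  refine ⟨s, hs, t, ht, exists_eq_ordAlong (isCoord_chart hs ht) h.isVal hs0 ht0 ?_
    h.exists_eq_one⟩
  rcases h.rt with h1 | h1
  · left
    rcases hs with rfl | rfl
    exacts [h1, h1.inv h.isVal]
  · right
    rcases ht with rfl | rfl
    exacts [h1, h1.inv h.isVal]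

/-- Of `x` and `x⁻¹` one has nonnegative value, likewise for `y`, so every such valuation has a
center in one of the four charts. The intrinsic form on the left is the one that can be tested after
a birational mapping. -/
theorem isCurve_iff {v : FunField → ℤ} : IsCurve v ↔ ∃ s ∈ ({x, x⁻¹} : Set FunField),
    ∃ t ∈ ({y, y⁻¹} : Set FunField), ∃ A : Poly,
      Irreducible A ∧ v = ordAlong s t (Ideal.span {A}) := by
  refine ⟨IsCurve.exists_chart, ?_⟩
  rintro ⟨s, hs, t, ht, A, hA, rfl⟩
  exact isCurve_ordAlong hs ht hA

end

noncomputable section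

/-! Divisors and divisor classes for a set of prime divisors. -/

/-- Divisors supported on a set of prime divisors. -/
abbrev DivOn (V : Set (FunField → ℤ)) : Type := V →₀ ℤ

/-- The divisors of nonzero rational functions. -/
def principalOn (V : Set (FunField → ℤ)) : AddSubgroup (DivOn V) :=
  AddSubgroup.closure {D | ∃ f : FunField, f ≠ 0 ∧ ∀ v : V, D v = v.1 f}

/-- The divisor class group. -/
abbrev PicOn (V : Set (FunField → ℤ)) : Type := DivOn V ⧸ principalOn V

open Classical in
/-- The class of a prime divisor, or `0` if the valuation does not belong to `V`. -/
def cls (V : Set (FunField → ℤ)) (v : FunField → ℤ) : PicOn V :=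
  if h : v ∈ V then QuotientAddGroup.mk (Finsupp.single ⟨v, h⟩ 1) else 0

variable {V V' V'' : Set (FunField → ℤ)}

theorem cls_of_mem {v : FunField → ℤ} (h : v ∈ V) :
    cls V v = QuotientAddGroup.mk (Finsupp.single ⟨v, h⟩ 1) := dif_pos h

theorem mem_principalOn (hV : ∀ v ∈ V, IsVal v) {D : DivOn V} (hD : D ∈ principalOn V) :
    ∃ f : FunField, f ≠ 0 ∧ ∀ v : V, D v = v.1 f := by
  induction hD using AddSubgroup.closure_induction with
  | mem D h => exact h
  | zero => exact ⟨1, one_ne_zero, fun v => by rw [(hV v.1 v.2).one]; rfl⟩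
  | add D D' _ _ h h' =>
    obtain ⟨f, hf, h⟩ := h
    obtain ⟨f', hf', h'⟩ := h'
    exact ⟨f * f', mul_ne_zero hf hf', fun v => by
      rw [(hV v.1 v.2).mul hf hf', ← h, ← h']; rfl⟩
  | neg D _ h =>
    obtain ⟨f, hf, h⟩ := h
    exact ⟨f⁻¹, inv_ne_zero hf, fun v => by rw [(hV v.1 v.2).inv, ← h]; rfl⟩

section

variable {ι : Type*} [Fintype ι] {u : ι → FunField → ℤ}

theorem sum_single_apply (hu : Function.Injective u) (huV : ∀ i, u i ∈ V) (n : ι → ℤ) (j : ι) :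
    (∑ i, n i • (Finsupp.single ⟨u i, huV i⟩ 1 : DivOn V)) ⟨u j, huV j⟩ = n j := by
  classical
  rw [Finsupp.finsetSum_apply, Finset.sum_eq_single j]
  · simp
  · intro i _ hij
    simp only [Finsupp.smul_apply]
    rw [Finsupp.single_eq_of_ne, smul_zero]
    intro h
    exact hij (hu (congrArg Subtype.val h)).symm
  · simp

theorem sum_single_apply_of_notMem (huV : ∀ i, u i ∈ V) (n : ι → ℤ) (v : V)
    (hv : v.1 ∉ Set.range u) :
    (∑ i, n i • (Finsupp.single ⟨u i, huV i⟩ 1 : DivOn V)) v = 0 := by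
  classical
  rw [Finsupp.finsetSum_apply]
  refine Finset.sum_eq_zero fun i _ => ?_
  rw [Finsupp.smul_apply, Finsupp.single_eq_of_ne, smul_zero]
  rintro rfl
  exact hv ⟨i, rfl⟩

theorem sum_cls (huV : ∀ i, u i ∈ V) (n : ι → ℤ) :
    ∑ i, n i • cls V (u i)
      = QuotientAddGroup.mk (∑ i, n i • (Finsupp.single ⟨u i, huV i⟩ 1 : DivOn V)) := by
  rw [← QuotientAddGroup.mk'_apply (principalOn V), map_sum]
  refine Finset.sum_congr rfl fun i _ => ?_
  rw [map_zsmul, cls_of_mem (huV i)]; rfl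

/-- The relation between divisor classes that comes from a rational function. -/
theorem sum_cls_eq_zero (hu : Function.Injective u) (huV : ∀ i, u i ∈ V) {f : FunField}
    (hf : f ≠ 0) (h : ∀ v ∈ V, v ∉ Set.range u → v f = 0) : ∑ i, u i f • cls V (u i) = 0 := by
  rw [sum_cls huV, QuotientAddGroup.eq_zero_iff]
  refine AddSubgroup.subset_closure ⟨f, hf, ?_⟩
  rintro ⟨v, hv⟩
  by_cases hvu : v ∈ Set.range u
  · obtain ⟨j, rfl⟩ := hvu
    exact sum_single_apply hu huV _ j
  · exact (sum_single_apply_of_notMem huV _ ⟨v, hv⟩ hvu).trans (h v hv hvu).symm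

/-- Every relation between divisor classes comes from a rational function. -/
theorem exists_of_sum_cls_eq_zero (hV : ∀ v ∈ V, IsVal v) (hu : Function.Injective u)
    (huV : ∀ i, u i ∈ V) {n : ι → ℤ} (h : ∑ i, n i • cls V (u i) = 0) :
    ∃ f : FunField, f ≠ 0 ∧ (∀ i, u i f = n i) ∧ ∀ v ∈ V, v ∉ Set.range u → v f = 0 := by
  rw [sum_cls huV, QuotientAddGroup.eq_zero_iff] at h
  obtain ⟨f, hf, hD⟩ := mem_principalOn hV h
  refine ⟨f, hf, fun i => ?_, fun v hv hvu => ?_⟩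
  · rw [← sum_single_apply hu huV n i, hD]
  · rw [← sum_single_apply_of_notMem huV n ⟨v, hv⟩ hvu, hD]

end

theorem PicOn.induction {q : PicOn V → Prop} (h0 : q 0) (hadd : ∀ a b, q a → q b → q (a + b))
    (hneg : ∀ a, q a → q (-a)) (hcls : ∀ v ∈ V, q (cls V v)) (a : PicOn V) : q a := by
  induction a using QuotientAddGroup.induction_on with
  | H D =>
    induction D using Finsupp.induction_linear with
    | zero => exact h0
    | add D D' h h' => exact hadd _ _ h h'
    | single v n =>
      have hn : ∀ n : ℕ, q ((n : ℤ) • cls V v.1) := by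
        intro n
        induction n with
        | zero => simpa
        | succ n ih =>
          have e : ((n + 1 : ℕ) : ℤ) • cls V v.1 = (n : ℤ) • cls V v.1 + cls V v.1 := by
            push_cast; rw [add_zsmul, one_zsmul]
          rw [e]
          exact hadd _ _ ih (hcls v.1 v.2)
      have e : (QuotientAddGroup.mk (Finsupp.single v n) : PicOn V) = n • cls V v.1 := by
        rw [cls_of_mem v.2, ← QuotientAddGroup.mk_zsmul, Finsupp.smul_single, smul_eq_mul, mul_one]
      rw [e]
      obtain ⟨m, rfl | rfl⟩ := n.eq_nat_or_neg
      · exact hn m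
      · rw [neg_smul]; exact hneg _ (hn m)

/-- The prime divisors correspond under the birational mapping that belongs to `Φ`. -/
def Lifts (Φ : FunField ≃ₐ[ℂ] FunField) (V V' : Set (FunField → ℤ)) : Prop :=
  ∀ v : FunField → ℤ, v ∈ V ↔ v ∘ Φ ∈ V'

theorem comp_symm (Φ : FunField ≃ₐ[ℂ] FunField) (v : FunField → ℤ) : (v ∘ Φ) ∘ Φ.symm = v :=
  funext fun f => congrArg v (Φ.apply_symm_apply f)

theorem symm_comp (Φ : FunField ≃ₐ[ℂ] FunField) (v : FunField → ℤ) : (v ∘ Φ.symm) ∘ Φ = v :=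
  funext fun f => congrArg v (Φ.symm_apply_apply f)

theorem Lifts.of_maps {Φ : FunField ≃ₐ[ℂ] FunField} (h : ∀ v ∈ V, v ∘ Φ ∈ V')
    (h' : ∀ v ∈ V', v ∘ Φ.symm ∈ V) : Lifts Φ V V' :=
  fun v => ⟨h v, fun hv => by simpa [comp_symm] using h' _ hv⟩

theorem Lifts.trans {Φ Φ' : FunField ≃ₐ[ℂ] FunField} (h : Lifts Φ V V') (h' : Lifts Φ' V' V'') :
    Lifts (Φ'.trans Φ) V V'' := fun v => (h v).trans (h' _)

namespace Lifts

variable {Φ : FunField ≃ₐ[ℂ] FunField} (h : Lifts Φ V V')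

/-- The bijection of prime divisors. -/
def primeEquiv : V ≃ V' where
  toFun v := ⟨v.1 ∘ Φ, (h v.1).1 v.2⟩
  invFun v := ⟨v.1 ∘ Φ.symm, (h _).2 (by rw [symm_comp]; exact v.2)⟩
  left_inv v := Subtype.ext (comp_symm Φ v.1)
  right_inv v := Subtype.ext (symm_comp Φ v.1)

/-- The push-forward of divisors. -/
def divEquiv : DivOn V ≃+ DivOn V' := Finsupp.domCongr h.primeEquiv

/-- The divisor of `f` is carried to the divisor of `Φ.symm f`, because `(v ∘ Φ) (Φ.symm f) = v f`.
-/
theorem map_principalOn : (principalOn V).map (h.divEquiv : DivOn V →+ DivOn V') = principalOn V' := by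
  rw [principalOn, principalOn, AddMonoidHom.map_closure]
  congr 1
  ext D
  constructor
  · rintro ⟨D, ⟨f, hf, hD⟩, rfl⟩
    refine ⟨Φ.symm f, by simpa using hf, fun v => ?_⟩
    change D (h.primeEquiv.symm v) = _
    rw [hD]; rfl
  · rintro ⟨f, hf, hD⟩
    refine ⟨h.divEquiv.symm D, ⟨Φ f, by simpa using hf, fun v => ?_⟩,
      h.divEquiv.apply_symm_apply D⟩
    change D (h.primeEquiv v) = _
    rw [hD]; rfl

/-- The push-forward of divisor classes. -/
def picEquiv : PicOn V ≃+ PicOn V' :=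
  QuotientAddGroup.congr _ _ h.divEquiv h.map_principalOn

theorem picEquiv_cls (v : FunField → ℤ) : h.picEquiv (cls V v) = cls V' (v ∘ Φ) := by
  by_cases hv : v ∈ V
  · rw [cls_of_mem hv, cls_of_mem ((h v).1 hv)]
    change QuotientAddGroup.mk (h.divEquiv _) = _
    congr 1
    exact Finsupp.domCongr_apply _ _ |>.trans (Finsupp.equivMapDomain_single _ _ _)
  -- Outside `V` both classes are the default `0`, since `v ∘ Φ` is then outside `V'`.
  · rw [cls, dif_neg hv, map_zero, cls, dif_neg (fun h' => hv ((h v).2 h'))]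

end Lifts

/-! The marking. -/

/-- The order along the line `x = 0` or `y = 0`. -/
def lineOrd (i : Fin 2) : FunField → ℤ := ordAlong x y (Ideal.span {X i})

/-- The classes of the fibres `x = 0`, `y = 0`. -/
def fibreCls (V : Set (FunField → ℤ)) (e : Fin 8 → FunField → ℤ) : Fin 2 → PicOn V :=
  ![cls V (lineOrd 0) + cls V (e 0) + cls V (e 1), cls V (lineOrd 1) + cls V (e 2) + cls V (e 3)]

/-- The homomorphism from the lattice to the class group, for given exceptional valuations. -/
def mark (V : Set (FunField → ℤ)) (e : Fin 8 → FunField → ℤ) : Lat →+ PicOn V where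
  toFun D := ∑ i, D.1 i • fibreCls V e i + ∑ k, D.2 k • cls V (e k)
  map_zero' := by simp
  map_add' D D' := by
    simp only [Prod.fst_add, Prod.snd_add, Pi.add_apply, add_zsmul, Finset.sum_add_distrib]
    abel

theorem mark_apply (V : Set (FunField → ℤ)) (e : Fin 8 → FunField → ℤ) (D : Lat) :
    mark V e D = ∑ i, D.1 i • fibreCls V e i + ∑ k, D.2 k • cls V (e k) := rfl

theorem mark_H (V : Set (FunField → ℤ)) (e : Fin 8 → FunField → ℤ) (i : Fin 2) :
    mark V e (H i) = fibreCls V e i := by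
  simp [mark_apply, H, Pi.single_apply, ite_smul]

theorem mark_E (V : Set (FunField → ℤ)) (e : Fin 8 → FunField → ℤ) (k : Fin 8) :
    mark V e (E k) = cls V (e k) := by
  simp [mark_apply, E, Pi.single_apply, ite_smul]

theorem lat_induction {q : Lat → Prop} (h0 : q 0) (hadd : ∀ a b, q a → q b → q (a + b))
    (hsmul : ∀ (n : ℤ) a, q a → q (n • a)) (hH : ∀ i, q (H i)) (hE : ∀ k, q (E k)) (D : Lat) :
    q D := by
  have hsum : ∀ {ι : Type} (s : Finset ι) (f : ι → Lat), (∀ i, q (f i)) → q (∑ i ∈ s, f i) :=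
    fun s f h => Finset.sum_induction f q hadd h0 fun i _ => h i
  have e : D = ∑ i, D.1 i • H i + ∑ k, D.2 k • E k := by
    ext j
    · fin_cases j <;> simp [H, E, Prod.fst_sum]
    · simp [H, E, Prod.snd_sum, Finset.sum_apply, Pi.single_apply]
  rw [e]
  exact hadd _ _ (hsum _ _ fun i => hsmul _ _ (hH i)) (hsum _ _ fun k => hsmul _ _ (hE k))

theorem lat_equiv_ext {L L' : Lat ≃ₗ[ℤ] Lat} (hH : ∀ i, L (H i) = L' (H i))
    (hE : ∀ k, L (E k) = L' (E k)) : L = L' := by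
  refine LinearEquiv.ext fun D => ?_
  induction D using lat_induction with
  | h0 => simp
  | hadd a b ha hb => rw [map_add, map_add, ha, hb]
  | hsmul n a ha => rw [map_smul, map_smul, ha]
  | hH i => exact hH i
  | hE k => exact hE k

/-- The prime divisors correspond under `Φ`, and the push-forward of divisor classes
is `L` on the lattice. -/
def ActsOn (Φ : FunField ≃ₐ[ℂ] FunField) (V V' : Set (FunField → ℤ)) (e e' : Fin 8 → FunField → ℤ)
    (L : Lat ≃ₗ[ℤ] Lat) : Prop :=
  Lifts Φ V V' ∧ ∃ F : PicOn V ≃+ PicOn V', (∀ v, F (cls V v) = cls V' (v ∘ Φ)) ∧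
    ∀ D, F (mark V e D) = mark V' e' (L D)

variable {e e' e'' : Fin 8 → FunField → ℤ}

theorem ActsOn.trans {Φ Φ' : FunField ≃ₐ[ℂ] FunField} {L L' : Lat ≃ₗ[ℤ] Lat}
    (h : ActsOn Φ V V' e e' L) (h' : ActsOn Φ' V' V'' e' e'' L') :
    ActsOn (Φ'.trans Φ) V V'' e e'' (L' * L) := by
  obtain ⟨h1, F, h2, h3⟩ := h
  obtain ⟨h1', F', h2', h3'⟩ := h'
  refine ⟨h1.trans h1', F.trans F', fun v => ?_, fun D => ?_⟩
  · rw [AddEquiv.trans_apply, h2, h2']; rfl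
  · rw [AddEquiv.trans_apply, h3, h3']; rfl

/-- Both sides are additive, so ten checks suffice. The hypotheses for `H 0` and `H 1` follow the
three components of the total transforms of `x = 0` and `y = 0`. -/
theorem ActsOn.of_basis {Φ : FunField ≃ₐ[ℂ] FunField} {L : Lat ≃ₗ[ℤ] Lat} (h : Lifts Φ V V')
    (h0 : cls V' (lineOrd 0 ∘ Φ) + cls V' (e 0 ∘ Φ) + cls V' (e 1 ∘ Φ) = mark V' e' (L (H 0)))
    (h1 : cls V' (lineOrd 1 ∘ Φ) + cls V' (e 2 ∘ Φ) + cls V' (e 3 ∘ Φ) = mark V' e' (L (H 1)))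
    (hE : ∀ k, cls V' (e k ∘ Φ) = mark V' e' (L (E k))) : ActsOn Φ V V' e e' L := by
  refine ⟨h, h.picEquiv, h.picEquiv_cls, fun D => ?_⟩
  induction D using lat_induction with
  | h0 => simp
  | hadd a b ha hb => rw [map_add, map_add, map_add, map_add, ha, hb]
  | hsmul n a ha => rw [map_zsmul, map_zsmul, map_zsmul, map_zsmul, ha]
  | hH i =>
    rw [mark_H]
    fin_cases i
    · refine Eq.trans ?_ h0
      rw [← h.picEquiv_cls, ← h.picEquiv_cls, ← h.picEquiv_cls, ← map_add, ← map_add]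
      rfl
    · refine Eq.trans ?_ h1
      rw [← h.picEquiv_cls, ← h.picEquiv_cls, ← h.picEquiv_cls, ← map_add, ← map_add]
      rfl
  | hE k => rw [mark_E, h.picEquiv_cls, hE]

/-! Comparison with the surfaces. -/

theorem marking_eq_mark (p : Params) :
    marking p = mark (primeDivisors p) (excOrd p) := by
  have hE : ∀ k, cls (primeDivisors p) (excOrd p k) = QuotientAddGroup.mk (excDiv p k) :=
    fun k => cls_of_mem (Or.inr ⟨k, rfl⟩)
  have hl : ∀ i, cls (primeDivisors p) (lineOrd i) = QuotientAddGroup.mk (lineDiv p i) :=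
    fun i => cls_of_mem
      (Or.inl ⟨x, Or.inl rfl, y, Or.inl rfl, X i, (X_prime).irreducible, rfl⟩)
  have hf : ∀ i, fibreCls (primeDivisors p) (excOrd p) i = QuotientAddGroup.mk (fibreDiv p i) := by
    intro i
    fin_cases i
    · simp only [fibreCls, hE, hl]; rfl
    · simp only [fibreCls, hE, hl]; rfl
  funext D
  rw [mark_apply]
  simp only [hE, hf]
  change QuotientAddGroup.mk' (principal p) _ = ∑ i, D.1 i • QuotientAddGroup.mk' (principal p) _
    + ∑ k, D.2 k • QuotientAddGroup.mk' (principal p) _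
  simp only [map_add, map_sum, map_zsmul]

theorem actsBy_of_actsOn {Φ : FunField ≃ₐ[ℂ] FunField} {p p' : Params} {L : Lat ≃ₗ[ℤ] Lat}
    (h : Function.Bijective (marking p)) (h' : Function.Bijective (marking p'))
    (hL : ActsOn Φ (primeDivisors p) (primeDivisors p') (excOrd p) (excOrd p') L) :
    ActsBy Φ p p' L := by
  obtain ⟨h1, F, h2, h3⟩ := hL
  let push : DivOn (primeDivisors p) →+ DivOn (primeDivisors p') := pushDiv Φ p p'
  have key : ∀ D, F (QuotientAddGroup.mk D) = (QuotientAddGroup.mk (push D) : PicOn _) := by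
    intro D
    induction D using Finsupp.induction_linear with
    | zero => rw [map_zero]; exact map_zero F
    | add D D' hD hD' =>
      rw [map_add, QuotientAddGroup.mk_add, QuotientAddGroup.mk_add, ← hD, ← hD', ← map_add]
    | single v n =>
      have e1 : Finsupp.single v n = n • Finsupp.single v 1 := by
        rw [Finsupp.smul_single, smul_eq_mul, mul_one]
      have e2 : push (Finsupp.single v 1) = Finsupp.single ⟨v.1 ∘ Φ, (h1 v.1).1 v.2⟩ 1 := by
        simp only [push]
        rw [pushDiv, Finsupp.liftAddHom_apply_single, dif_pos ((h1 v.1).1 v.2)]; rfl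
      rw [e1, map_zsmul, e2, QuotientAddGroup.mk_zsmul, QuotientAddGroup.mk_zsmul, map_zsmul]
      congr 1
      have := h2 v.1
      rwa [cls_of_mem v.2, cls_of_mem ((h1 v.1).1 v.2)] at this
  refine ⟨h, h', h1, F, key, fun D => ?_⟩
  rw [marking_eq_mark, marking_eq_mark]; exact h3 D

end

noncomputable section

/-! Special curves on `ℙ¹ × ℙ¹`. -/

variable {v : FunField → ℤ} {s t : FunField}

/-- The order along the line `y = -c`. -/
def horOrd (c : ℂ) : FunField → ℤ := ordAlong x (y + con c) (Ideal.span {X 1})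

/-- The order along the line `y = ∞`. -/
def horInf : FunField → ℤ := ordAlong x y⁻¹ (Ideal.span {X 1})

/-- The order along the line `x = ∞`. -/
def verInf : FunField → ℤ := ordAlong y x⁻¹ (Ideal.span {X 1})

theorem isCoord_hor (c : ℂ) : IsCoord x (y + con c) := isCoord_xy.add_con_right c

theorem isGauss_horOrd (c : ℂ) : IsGauss (horOrd c) x (y + con c) := (isCoord_hor c).isGauss

theorem isGauss_horInf : IsGauss horInf x y⁻¹ := isCoord_xy.inv_right.isGauss

theorem isGauss_verInf : IsGauss verInf y x⁻¹ := isCoord_xy.swap.inv_right.isGauss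

theorem isGauss_line_one : IsGauss (lineOrd 1) x y := isCoord_xy.isGauss

theorem isGauss_line_zero : IsGauss (lineOrd 0) y x where
  isVal := isCoord_xy.isVal X_prime.irreducible
  val := by simpa [lineOrd] using isCoord_xy.ordAlong_self (X_prime (i := (0 : Fin 2))).irreducible
  rt c := by
    have h := not_X_dvd_X_add_C (i := 1) (j := 0) (by decide) c
    have h0 : (X 1 + C c : Poly) ≠ 0 := fun h' => h (h' ▸ dvd_zero _)
    have e : aeval ![x, y] (X 1 + C c : Poly) = y + con c := by simp [con]
    rw [← e, lineOrd]
    refine ⟨isCoord_xy.aeval_ne_zero h0, ?_⟩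
    rw [isCoord_xy.ordAlong_aeval X_prime.irreducible h0, multiplicity_eq_zero.2 h, Nat.cast_zero]

theorem IsGauss.isCurve_x (h : IsGauss v x t) : IsCurve v := ⟨h.isVal, ⟨t, h.val⟩, Or.inl h.rt⟩

theorem IsGauss.isCurve_y (h : IsGauss v y t) : IsCurve v := ⟨h.isVal, ⟨t, h.val⟩, Or.inr h.rt⟩

/-- Here `y` has constant residue, so `x` must be the coordinate with transcendental residue, and
the valuation is determined. The same argument serves for the other lines below. -/
theorem IsCurve.eq_horOrd (h : IsCurve v) {c : ℂ} (hc : 0 < v (y + con c)) : v = horOrd c := by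
  have hx : RT v x := h.rt.resolve_right fun hy => by rw [(hy c).2] at hc; omega
  exact eq_ordAlong_X (isCoord_hor c) h.isVal hx hc h.exists_eq_one

theorem IsCurve.eq_horInf (h : IsCurve v) (hc : v y < 0) : v = horInf := by
  have hx : RT v x := h.rt.resolve_right fun hy => by rw [hy.val] at hc; omega
  exact eq_ordAlong_X isCoord_xy.inv_right h.isVal hx (by rw [h.isVal.inv]; omega) h.exists_eq_one

theorem IsCurve.eq_verInf (h : IsCurve v) (hc : v x < 0) : v = verInf := by
  have hy : RT v y := h.rt.resolve_left fun hx => by rw [hx.val] at hc; omega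
  exact eq_ordAlong_X isCoord_xy.swap.inv_right h.isVal hy (by rw [h.isVal.inv]; omega)
    h.exists_eq_one

theorem IsCurve.eq_line_zero (h : IsCurve v) (hc : 0 < v x) : v = lineOrd 0 := by
  have hy : RT v y := h.rt.resolve_left fun hx => by rw [hx.val] at hc; omega
  rw [isGauss_line_zero.eq isCoord_xy.swap]
  exact eq_ordAlong_X isCoord_xy.swap h.isVal hy hc h.exists_eq_one

theorem horOrd_zero : horOrd 0 = lineOrd 1 := by
  rw [horOrd, con_zero, add_zero, lineOrd]

theorem IsCurve.eq_line_one (h : IsCurve v) (hc : 0 < v y) : v = lineOrd 1 := by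
  rw [← horOrd_zero]
  exact h.eq_horOrd (by rwa [con_zero, add_zero])

/-! The exceptional curves. -/

/-- `v` is the order of vanishing at the point `s = t = 0`. -/
structure IsPt (v : FunField → ℤ) (s t : FunField) : Prop where
  isVal : IsVal v
  left : v s = 1
  right : v t = 1
  rt : RT v (t / s)

namespace IsPt

theorem eq (h : IsPt v s t) (hst : IsCoord s t) : v = ordAlong s t (Ideal.span {X 0, X 1}) :=
  (isGauss_point_iff hst).1 ⟨h.isVal, h.left, h.rt⟩

theorem symm (h : IsPt v s t) : IsPt v t s :=
  ⟨h.isVal, h.right, h.left, by simpa using h.rt.inv h.isVal⟩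

theorem of_rt (hv : IsVal v) (hs : v s = 1) (h : RT v (t / s)) : IsPt v s t := by
  refine ⟨hv, hs, ?_, h⟩
  have hs0 : s ≠ 0 := by rintro rfl; simp [hv.zero] at hs
  rw [← div_mul_cancel₀ t hs0, hv.mul h.ne_zero hs0, h.val, hs, zero_add]

end IsPt

theorem IsCoord.isPt (hst : IsCoord s t) : IsPt (ordAlong s t (Ideal.span {X 0, X 1})) s t := by
  have h := (isGauss_point_iff hst).2 rfl
  exact IsPt.of_rt h.isVal h.val h.rt

/-- Local coordinates at the points `(0, -b 0)`, `(0, -b 1)`, `(-b 2, 0)`, `(-b 3, 0)`,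
`(∞, -b 4)`, `(∞, -b 5)`, `(-b 6, ∞)`, `(-b 7, ∞)`. -/
def ptCoord (b : Fin 8 → ℂ) : Fin 8 → FunField × FunField :=
  ![(x, y + con (b 0)), (x, y + con (b 1)), (x + con (b 2), y), (x + con (b 3), y),
    (x⁻¹, y + con (b 4)), (x⁻¹, y + con (b 5)), (x + con (b 6), y⁻¹), (x + con (b 7), y⁻¹)]

/-- The order of vanishing at the points. -/
def exc (b : Fin 8 → ℂ) (k : Fin 8) : FunField → ℤ :=
  ordAlong (ptCoord b k).1 (ptCoord b k).2 (Ideal.span {X 0, X 1})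

/-- The prime divisors of the blow-up. -/
def primes (b : Fin 8 → ℂ) : Set (FunField → ℤ) := {v | IsCurve v} ∪ Set.range (exc b)

theorem isCoord_ptCoord (b : Fin 8 → ℂ) (k : Fin 8) :
    IsCoord (ptCoord b k).1 (ptCoord b k).2 := by
  have h := isCoord_xy
  fin_cases k
  exacts [h.add_con_right _, h.add_con_right _, h.add_con_left _, h.add_con_left _,
    h.inv_left.add_con_right _, h.inv_left.add_con_right _, h.inv_right.add_con_left _,
    h.inv_right.add_con_left _]

theorem isPt_exc (b : Fin 8 → ℂ) (k : Fin 8) : IsPt (exc b k) (ptCoord b k).1 (ptCoord b k).2 :=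
  (isCoord_ptCoord b k).isPt

theorem eq_exc {b : Fin 8 → ℂ} {k : Fin 8} (h : IsPt v (ptCoord b k).1 (ptCoord b k).2) :
    v = exc b k := h.eq (isCoord_ptCoord b k)

theorem exc_mem (b : Fin 8 → ℂ) (k : Fin 8) : exc b k ∈ primes b := Or.inr ⟨k, rfl⟩

theorem isVal_of_mem_primes {b : Fin 8 → ℂ} (h : v ∈ primes b) : IsVal v := by
  rcases h with h | ⟨k, rfl⟩
  exacts [h.isVal, (isPt_exc b k).isVal]

open Classical in
theorem val_add_con_of_pos (hv : IsVal v) {f : FunField} {b : ℂ} (h : v (f + con b) = 1) (c : ℂ) :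
    v (f + con c) = if c = b then 1 else 0 := by
  split_ifs with hc
  · rw [hc, h]
  · refine (Res.of_add_pos (by rw [h]; norm_num) : Res v f (-b)).val_add_con hv ?_
    rw [neg_add_eq_sub]
    exact sub_ne_zero.2 hc

open Classical in
theorem val_add_con_of_zero (hv : IsVal v) {f : FunField} (h : v f = 1) (c : ℂ) :
    v (f + con c) = if c = 0 then 1 else 0 :=
  val_add_con_of_pos hv (by rwa [con_zero, add_zero]) c

theorem val_add_con_of_inv (hv : IsVal v) {f : FunField} (h : v f⁻¹ = 1) (c : ℂ) :
    v (f + con c) = -1 := by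
  rw [hv.inv] at h
  rw [hv.val_add_con_of_neg (by omega)]; omega

open Classical in
/-- The orders of vanishing of `x + c` at the points. -/
def xTable (b : Fin 8 → ℂ) (c : ℂ) : Fin 8 → ℤ :=
  ![if c = 0 then 1 else 0, if c = 0 then 1 else 0, if c = b 2 then 1 else 0,
    if c = b 3 then 1 else 0, -1, -1, if c = b 6 then 1 else 0, if c = b 7 then 1 else 0]

open Classical in
/-- The orders of vanishing of `y + c` at the points. -/
def yTable (b : Fin 8 → ℂ) (c : ℂ) : Fin 8 → ℤ :=
  ![if c = b 0 then 1 else 0, if c = b 1 then 1 else 0, if c = 0 then 1 else 0,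
    if c = 0 then 1 else 0, if c = b 4 then 1 else 0, if c = b 5 then 1 else 0, -1, -1]

theorem exc_x (b : Fin 8 → ℂ) (c : ℂ) (k : Fin 8) : exc b k (x + con c) = xTable b c k := by
  have h := isPt_exc b k
  have hv := h.isVal
  have hl := h.left
  fin_cases k
  exacts [val_add_con_of_zero hv hl c, val_add_con_of_zero hv hl c, val_add_con_of_pos hv hl c,
    val_add_con_of_pos hv hl c, val_add_con_of_inv hv hl c, val_add_con_of_inv hv hl c,
    val_add_con_of_pos hv hl c, val_add_con_of_pos hv hl c]

theorem exc_y (b : Fin 8 → ℂ) (c : ℂ) (k : Fin 8) : exc b k (y + con c) = yTable b c k := by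
  have h := isPt_exc b k
  have hv := h.isVal
  have hl := h.right
  fin_cases k
  exacts [val_add_con_of_pos hv hl c, val_add_con_of_pos hv hl c, val_add_con_of_zero hv hl c,
    val_add_con_of_zero hv hl c, val_add_con_of_pos hv hl c, val_add_con_of_pos hv hl c,
    val_add_con_of_inv hv hl c, val_add_con_of_inv hv hl c]

/-- Distinct points, no two of which lie on a line `x = constant` or `y = constant` other than the
four coordinate lines. -/
structure Good (b : Fin 8 → ℂ) : Prop where
  ne : ∀ k, b k ≠ 0
  h01 : b 0 ≠ b 1
  h04 : b 0 ≠ b 4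
  h05 : b 0 ≠ b 5
  h14 : b 1 ≠ b 4
  h15 : b 1 ≠ b 5
  h45 : b 4 ≠ b 5
  h23 : b 2 ≠ b 3
  h26 : b 2 ≠ b 6
  h27 : b 2 ≠ b 7
  h36 : b 3 ≠ b 6
  h37 : b 3 ≠ b 7
  h67 : b 6 ≠ b 7

variable {b : Fin 8 → ℂ}

theorem exc_injective (hb : Good b) : Function.Injective (exc b) := by
  intro j k h
  have hx : ∀ c, xTable b c j = xTable b c k := fun c => by rw [← exc_x, ← exc_x, h]
  have hy : ∀ c, yTable b c j = yTable b c k := fun c => by rw [← exc_y, ← exc_y, h]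
  clear h
  wlog hjk : j < k generalizing j k
  · rcases lt_or_eq_of_le (not_lt.1 hjk) with h | h
    · exact (this (fun c => (hx c).symm) (fun c => (hy c).symm) h).symm
    · exact h.symm
  exfalso
  -- The orders of `x` and `y` tell which of the four coordinate lines contains the point; the
  -- translates by `b 0`, `b 4`, `b 2`, `b 6` separate the two points on each line.
  have hx0 := hx 0
  have hy0 := hy 0
  have h0 := hy (b 0)
  have h4 := hy (b 4)
  have h2 := hx (b 2)
  have h6 := hx (b 6)
  clear hx hy
  have n := hb.ne
  have n' := fun k => (hb.ne k).symm
  fin_cases j <;> fin_cases k <;>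
    first
    | exact absurd hjk (by decide)
    | simp [xTable, yTable, n, n', hb.h01, hb.h45, hb.h23, hb.h67] at hx0 hy0 h0 h4 h2 h6

/-- Over a point each coordinate has a constant residue or a pole, so a suitable translate has
nonzero order. -/
theorem not_isCurve_exc (b : Fin 8 → ℂ) (k : Fin 8) : ¬ IsCurve (exc b k) := by
  intro h
  have hx : (∀ c, xTable b c k = 0) ∨ ∀ c, yTable b c k = 0 := by
    rcases h.rt with h | h
    · left; intro c; rw [← exc_x]; exact (h c).2
    · right; intro c; rw [← exc_y]; exact (h c).2
  rcases hx with h | h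
  · have h0 := h 0
    have h1 := h (b k)
    fin_cases k <;> simp [xTable] at h0 h1
  · have h0 := h 0
    have h1 := h (b k)
    fin_cases k <;> simp [yTable] at h0 h1

theorem injective_sumElim (hb : Good b) {ι : Type*} {u : ι → FunField → ℤ}
    (hu : Function.Injective u) (huc : ∀ i, IsCurve (u i)) :
    Function.Injective (Sum.elim (exc b) u) :=
  (exc_injective hb).sumElim hu fun k i h => not_isCurve_exc b k (h ▸ huc i)

theorem sumElim_mem {ι : Type*} {u : ι → FunField → ℤ} (huc : ∀ i, IsCurve (u i))
    (i : Fin 8 ⊕ ι) : Sum.elim (exc b) u i ∈ primes b := by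
  rcases i with k | i
  exacts [exc_mem b k, Or.inl (huc i)]

theorem horInf_y (c : ℂ) : horInf (y + con c) = -1 :=
  val_add_con_of_inv isGauss_horInf.isVal isGauss_horInf.val c

/-- The linear equivalence between the lines `y = -c` and `y = ∞`. -/
theorem sum_yTable (hb : Good b) (c : ℂ) : ∑ k, yTable b c k • cls (primes b) (exc b k)
    + cls (primes b) (horOrd c) - cls (primes b) horInf = 0 := by
  have huc : ∀ i, IsCurve ((![horOrd c, horInf] : Fin 2 → FunField → ℤ) i) := by
    intro i
    fin_cases i
    exacts [(isGauss_horOrd c).isCurve_x, isGauss_horInf.isCurve_x]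
  have hu : Function.Injective (![horOrd c, horInf] : Fin 2 → FunField → ℤ) := by
    have hne : horOrd c ≠ horInf := by
      intro h
      have h1 := (isGauss_horOrd c).val
      rw [h, horInf_y] at h1
      omega
    intro i j hij
    fin_cases i <;> fin_cases j
    exacts [rfl, (hne hij).elim, (hne hij.symm).elim, rfl]
  have h := sum_cls_eq_zero (injective_sumElim hb hu huc) (sumElim_mem huc)
    (isCoord_hor c).right_ne_zero ?_
  · rw [Fintype.sum_sum_type, Fin.sum_univ_two] at h
    simp only [Sum.elim_inl, Sum.elim_inr, exc_y, Matrix.cons_val_zero, Matrix.cons_val_one,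
      (isGauss_horOrd c).val, horInf_y, one_smul, neg_smul] at h
    rw [← h]; abel
  · rintro v (hv | ⟨k, rfl⟩) hvu
    · by_contra hne
      rcases lt_or_ge (v y) 0 with h0 | h0
      · exact hvu ⟨Sum.inr 1, (hv.eq_horInf h0).symm⟩
      · have h1 := hv.isVal.nonneg_add h0 (hv.isVal.const c).ge
        exact hvu ⟨Sum.inr 0, (hv.eq_horOrd (lt_of_le_of_ne h1 (Ne.symm hne))).symm⟩
    · exact (hvu ⟨Sum.inl k, rfl⟩).elim

/-- The case `c = 0` of `sum_yTable`: the total transforms of `y = 0` and `y = ∞` are equivalent,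
and each line carries two of the points. -/
theorem cls_horInf (hb : Good b) :
    cls (primes b) horInf = mark (primes b) (exc b) (H 1 - E 6 - E 7) := by
  have h := sum_yTable hb 0
  have n := fun k => (hb.ne k).symm
  simp only [Fin.sum_univ_eight, yTable, Matrix.cons_val, n, if_false, if_true, zero_zsmul,
    one_smul, neg_smul, horOrd_zero] at h
  rw [map_sub, map_sub, mark_H, mark_E, mark_E, fibreCls, Matrix.cons_val_one,
    Matrix.cons_val_zero, eq_comm, ← sub_eq_zero, ← h]
  abel

/-- By `Good` the line `y = -b 0` contains only one of the eight points. -/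
theorem cls_horOrd_left (hb : Good b) :
    cls (primes b) (horOrd (b 0)) = mark (primes b) (exc b) (H 1 - E 0) := by
  have h := sum_yTable hb (b 0)
  have h' := cls_horInf hb
  simp only [Fin.sum_univ_eight, yTable, Matrix.cons_val, hb.ne, hb.h01, hb.h04, hb.h05, if_false,
    if_true, zero_zsmul, one_smul, neg_smul] at h
  rw [map_sub, map_sub, mark_E, mark_E] at h'
  rw [map_sub, mark_E, ← sub_eq_zero, ← h, h']
  abel

theorem cls_horOrd_right (hb : Good b) :
    cls (primes b) (horOrd (b 4)) = mark (primes b) (exc b) (H 1 - E 4) := by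
  have h := sum_yTable hb (b 4)
  have h' := cls_horInf hb
  simp only [Fin.sum_univ_eight, yTable, Matrix.cons_val, hb.ne, hb.h04.symm, hb.h14.symm, hb.h45,
    if_false, if_true, zero_zsmul, one_smul, neg_smul] at h
  rw [map_sub, map_sub, mark_E, mark_E] at h'
  rw [map_sub, mark_E, ← sub_eq_zero, ← h, h']
  abel

end

noncomputable section

variable {v : FunField → ℤ} {b b' : Fin 8 → ℂ}

/-! Birational mappings between the surfaces: the exchange of the two factors. -/

theorem IsPt.comp {s t : FunField} (h : IsPt v s t) (Φ : FunField ≃ₐ[ℂ] FunField) {s' t' : FunField}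
    (hs : v (Φ s') = 1) (ht : RT v (Φ t' / Φ s')) : IsPt (v ∘ Φ) s' t' :=
  IsPt.of_rt (h.isVal.comp Φ) hs (by rwa [RT.comp_iff, map_div₀])

theorem IsGauss.comp {s t : FunField} (hv : IsVal v) (Φ : FunField ≃ₐ[ℂ] FunField)
    (hs : RT v (Φ s)) (ht : v (Φ t) = 1) : IsGauss (v ∘ Φ) s t :=
  ⟨hv.comp Φ, ht, by rwa [RT.comp_iff]⟩

theorem IsCurve.comp (h : IsCurve v) (Φ : FunField ≃ₐ[ℂ] FunField)
    (hRT : RT v (Φ x) ∨ RT v (Φ y)) : IsCurve (v ∘ Φ) := by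
  obtain ⟨f, hf⟩ := h.exists_eq_one
  exact ⟨h.isVal.comp Φ, ⟨Φ.symm f, by simp [hf]⟩, by rwa [RT.comp_iff, RT.comp_iff]⟩

/-- The points after the exchange of the two factors. -/
def swapPts (b : Fin 8 → ℂ) : Fin 8 → ℂ := ![b 2, b 3, b 0, b 1, b 6, b 7, b 4, b 5]

theorem swapPts_swapPts (b : Fin 8 → ℂ) : swapPts (swapPts b) = b := by
  funext k; fin_cases k <;> rfl

theorem Good.swapPts (hb : Good b) : Good (swapPts b) where
  ne k := by fin_cases k <;> exact hb.ne _
  h01 := hb.h23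
  h04 := hb.h26
  h05 := hb.h27
  h14 := hb.h36
  h15 := hb.h37
  h45 := hb.h67
  h23 := hb.h01
  h26 := hb.h04
  h27 := hb.h05
  h36 := hb.h14
  h37 := hb.h15
  h67 := hb.h45

/-- `Φ` exchanges the coordinates. -/
structure IsSwap (Φ : FunField ≃ₐ[ℂ] FunField) : Prop where
  map_x : Φ x = y
  map_y : Φ y = x

theorem exists_isSwap : ∃ Φ, IsSwap Φ := by
  obtain ⟨τ, h1, h2⟩ := isCoord_xy.swap
  exact ⟨τ, h1, h2⟩

namespace IsSwap

variable {Φ : FunField ≃ₐ[ℂ] FunField}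

theorem symm (h : IsSwap Φ) : IsSwap Φ.symm :=
  ⟨by rw [AlgEquiv.symm_apply_eq, h.map_y], by rw [AlgEquiv.symm_apply_eq, h.map_x]⟩

theorem exc_comp (h : IsSwap Φ) (b : Fin 8 → ℂ) (k : Fin 8) :
    exc b k ∘ Φ = exc (swapPts b) (![2, 3, 0, 1, 6, 7, 4, 5] k) := by
  apply eq_exc
  have h0 := (isPt_exc b k).symm
  fin_cases k
  all_goals
    refine h0.comp Φ ?_ ?_
    · have := h0.left
      simpa [swapPts, ptCoord, h.map_x, h.map_y, algEquiv_con] using this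
    · have := h0.rt
      simpa [swapPts, ptCoord, h.map_x, h.map_y, algEquiv_con] using this

theorem maps (h : IsSwap Φ) (hv : v ∈ primes b) : v ∘ Φ ∈ primes (swapPts b) := by
  rcases hv with hv | ⟨k, rfl⟩
  · exact Or.inl (hv.comp Φ (by rw [h.map_x, h.map_y]; exact hv.rt.symm))
  · rw [h.exc_comp]; exact exc_mem _ _

theorem lifts (h : IsSwap Φ) (b : Fin 8 → ℂ) : Lifts Φ (primes b) (primes (swapPts b)) :=
  Lifts.of_maps (fun _ hv => h.maps hv) fun v hv => by
    have := h.symm.maps hv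
    rwa [swapPts_swapPts] at this

theorem line_zero (h : IsSwap Φ) : lineOrd 0 ∘ Φ = lineOrd 1 := by
  have h0 := isGauss_line_zero
  exact (IsGauss.comp h0.isVal Φ (by rw [h.map_x]; exact h0.rt) (by rw [h.map_y]; exact h0.val)).unique
    isGauss_line_one isCoord_xy

theorem line_one (h : IsSwap Φ) : lineOrd 1 ∘ Φ = lineOrd 0 := by
  have h0 := isGauss_line_one
  exact (IsGauss.comp h0.isVal Φ (by rw [h.map_y]; exact h0.rt) (by rw [h.map_x]; exact h0.val)).unique
    isGauss_line_zero isCoord_xy.swap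

theorem verInf (h : IsSwap Φ) : verInf ∘ Φ = horInf := by
  have h0 := isGauss_verInf
  exact (IsGauss.comp h0.isVal Φ (by rw [h.map_x]; exact h0.rt)
    (by rw [map_inv₀, h.map_y]; exact h0.val)).unique isGauss_horInf isCoord_xy.inv_right

theorem actsOn (h : IsSwap Φ) (b : Fin 8 → ℂ) :
    ActsOn Φ (primes b) (primes (swapPts b)) (exc b) (exc (swapPts b)) σ₅₄₃₂₁₀ := by
  have hE : ∀ k, σ₅₄₃₂₁₀ (E k) = E (![2, 3, 0, 1, 6, 7, 4, 5] k) := by decide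
  have h0 : σ₅₄₃₂₁₀ (H 0) = H 1 := by decide
  have h1 : σ₅₄₃₂₁₀ (H 1) = H 0 := by decide
  refine ActsOn.of_basis (h.lifts b) ?_ ?_ fun k => ?_
  · rw [h0, mark_H, h.line_zero, h.exc_comp, h.exc_comp]; rfl
  · rw [h1, mark_H, h.line_one, h.exc_comp, h.exc_comp]; rfl
  · rw [hE, mark_E, h.exc_comp]

end IsSwap

/-- The exchange of the factors transports the result for `y = ∞`, which avoids a second computation
with tables. -/
theorem cls_verInf (hb : Good b) :
    cls (primes b) verInf = mark (primes b) (exc b) (H 0 - E 4 - E 5) := by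
  obtain ⟨Φ, hΦ⟩ := exists_isSwap
  obtain ⟨-, F, h1, h2⟩ := hΦ.actsOn b
  apply F.injective
  rw [h1, h2, hΦ.verInf, cls_horInf hb.swapPts]
  congr 1
  decide

/-! The inversion of both coordinates. -/

/-- The points after `(x, y) ↦ (1 / x, ρ / y)`. -/
def invPts (ρ : ℂ) (b : Fin 8 → ℂ) : Fin 8 → ℂ :=
  ![ρ / b 5, ρ / b 4, 1 / b 7, 1 / b 6, ρ / b 1, ρ / b 0, 1 / b 3, 1 / b 2]

theorem invPts_invPts {ρ : ℂ} (hρ : ρ ≠ 0) (b : Fin 8 → ℂ) : invPts ρ (invPts ρ b) = b := by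
  funext k
  fin_cases k <;> simp [invPts, div_div_cancel₀ hρ]

/-- `Φ` belongs to the mapping `(x, y) ↦ (1 / x, ρ / y)`. -/
structure IsInv (ρ : ℂ) (Φ : FunField ≃ₐ[ℂ] FunField) : Prop where
  map_x : Φ x = x⁻¹
  map_y : Φ y = con ρ * y⁻¹

theorem exists_isInv {ρ : ℂ} (hρ : ρ ≠ 0) : ∃ Φ, IsInv ρ Φ := by
  have h := (isCoord_xy.inv_left.inv_right.swap.mul_left (con_mem _ ρ) (con_ne_zero hρ)).swap
  obtain ⟨τ, h1, h2⟩ := h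
  exact ⟨τ, h1, by rw [h2, mul_comm]⟩

/-- Since `r / z + r / c = r (z + c) / (c z)`, the slope is multiplied by a function with nonzero
constant residue, which preserves transcendence. Applied to either coordinate it covers all eight
points. -/
theorem IsPt.inv {ξ ξ' z : FunField} {c r m : ℂ} (h : IsPt v ξ (z + con c)) (hc : c ≠ 0) (hr : r ≠ 0)
    (hm : m ≠ 0) {Φ : FunField ≃ₐ[ℂ] FunField} (hz : Φ z = con r * z⁻¹) (hξ : Φ ξ' = con m * ξ) :
    IsPt (v ∘ Φ) ξ' (z + con (r / c)) := by
  have hv := h.isVal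
  have hξ0 : ξ ≠ 0 := by
    rintro rfl
    have := h.left
    rw [hv.zero] at this
    omega
  have hz' : Res v z (-c) := Res.of_add_pos (by rw [h.right]; norm_num)
  have hz0 := (hz'.unit hv (neg_ne_zero.2 hc)).1
  have hc' := con_ne_zero hc
  have hm' := con_ne_zero hm
  refine h.comp Φ ?_ ?_
  · rw [hξ, hv.mul hm' hξ0, hv.const, h.left, zero_add]
  · have h1 := h.rt.mul_res hv (((Res.const v (r / (c * m))).mul hv
      (hz'.inv hv (neg_ne_zero.2 hc)))) (mul_ne_zero (div_ne_zero hr (mul_ne_zero hc hm))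
        (inv_ne_zero (neg_ne_zero.2 hc)))
    have e : Φ (z + con (r / c)) / Φ ξ' = (z + con c) / ξ * (con (r / (c * m)) * z⁻¹) := by
      rw [hξ, map_add, hz, algEquiv_con, con_div, con_div, con_mul]
      field_simp
      ring
    rwa [e]

namespace IsInv

variable {Φ : FunField ≃ₐ[ℂ] FunField} {ρ : ℂ}

theorem symm (h : IsInv ρ Φ) (hρ : ρ ≠ 0) : IsInv ρ Φ.symm := by
  have := con_ne_zero hρ
  have := y_ne_zero
  constructor
  · rw [AlgEquiv.symm_apply_eq, map_inv₀, h.map_x, inv_inv]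
  · rw [AlgEquiv.symm_apply_eq, map_mul, map_inv₀, h.map_y, algEquiv_con]
    field_simp

theorem exc_comp (h : IsInv ρ Φ) (hρ : ρ ≠ 0) (hb : ∀ k, b k ≠ 0) (k : Fin 8) :
    exc b k ∘ Φ = exc (invPts ρ b) (![5, 4, 7, 6, 1, 0, 3, 2] k) := by
  apply eq_exc
  have hx : Φ x = con 1 * x⁻¹ := by rw [h.map_x, con_one, one_mul]
  have hxi : Φ x⁻¹ = con 1 * x := by rw [map_inv₀, h.map_x, con_one, one_mul, inv_inv]
  have hyi : Φ y⁻¹ = con ρ⁻¹ * y := by rw [map_inv₀, h.map_y, mul_inv, con_inv, inv_inv]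
  have h0 := isPt_exc b k
  have hr := inv_ne_zero hρ
  have h1 : (1 : ℂ) ≠ 0 := one_ne_zero
  fin_cases k
  · exact h0.inv (hb 0) hρ h1 h.map_y hxi
  · exact h0.inv (hb 1) hρ h1 h.map_y hxi
  · exact (h0.symm.inv (hb 2) h1 hr hx hyi).symm
  · exact (h0.symm.inv (hb 3) h1 hr hx hyi).symm
  · exact h0.inv (hb 4) hρ h1 h.map_y hx
  · exact h0.inv (hb 5) hρ h1 h.map_y hx
  · exact (h0.symm.inv (hb 6) h1 hρ hx h.map_y).symm
  · exact (h0.symm.inv (hb 7) h1 hρ hx h.map_y).symm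

theorem maps (h : IsInv ρ Φ) (hρ : ρ ≠ 0) (hb : ∀ k, b k ≠ 0) (hv : v ∈ primes b) :
    v ∘ Φ ∈ primes (invPts ρ b) := by
  rcases hv with hv | ⟨k, rfl⟩
  · refine Or.inl (hv.comp Φ ?_)
    rcases hv.rt with h1 | h1
    · left; rw [h.map_x]; exact h1.inv hv.isVal
    · right
      rw [h.map_y, mul_comm]
      exact (h1.inv hv.isVal).mul_res hv.isVal (Res.const v ρ) hρ
  · rw [h.exc_comp hρ hb]; exact exc_mem _ _

theorem lifts (h : IsInv ρ Φ) (hρ : ρ ≠ 0) (hb : ∀ k, b k ≠ 0) :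
    Lifts Φ (primes b) (primes (invPts ρ b)) :=
  Lifts.of_maps (fun _ hv => h.maps hρ hb hv) fun v hv => by
    have := (h.symm hρ).maps hρ (fun k => by fin_cases k <;> simp [invPts, hb, hρ]) hv
    rwa [invPts_invPts hρ] at this

theorem line_zero (h : IsInv ρ Φ) (hρ : ρ ≠ 0) : lineOrd 0 ∘ Φ = verInf := by
  have h0 := isGauss_line_zero
  have hv := h0.isVal
  refine (IsGauss.comp hv Φ ?_ ?_).unique isGauss_verInf isCoord_xy.swap.inv_right
  · rw [h.map_y, mul_comm]
    exact (h0.rt.inv hv).mul_res hv (Res.const _ ρ) hρ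
  · rw [map_inv₀, h.map_x, inv_inv, h0.val]

theorem line_one (h : IsInv ρ Φ) (hρ : ρ ≠ 0) : lineOrd 1 ∘ Φ = horInf := by
  have h0 := isGauss_line_one
  have hv := h0.isVal
  refine (IsGauss.comp hv Φ ?_ ?_).unique isGauss_horInf isCoord_xy.inv_right
  · rw [h.map_x]
    exact h0.rt.inv hv
  · rw [map_inv₀, h.map_y, mul_inv, inv_inv, hv.mul (inv_ne_zero (con_ne_zero hρ)) y_ne_zero, hv.inv,
      hv.const, h0.val]; rfl

/-- The inversion exchanges opposite coordinate lines, which is `σ₅₄ * σ₁₀`. The four reflections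
exchange the labels of the two points on each line. The classes of the fibres are preserved, because
`x = 0` and `x = ∞` are equivalent, as are `y = 0` and `y = ∞`. -/
theorem actsOn (h : IsInv ρ Φ) (hρ : ρ ≠ 0) (hb : ∀ k, b k ≠ 0) (hb' : Good (invPts ρ b)) :
    ActsOn Φ (primes b) (primes (invPts ρ b)) (exc b) (exc (invPts ρ b))
      (σ₅₄ * σ₁₀ * w 5 * w 4 * w 1 * w 0) := by
  have hE : ∀ k, (σ₅₄ * σ₁₀ * w 5 * w 4 * w 1 * w 0) (E k)
      = E (![5, 4, 7, 6, 1, 0, 3, 2] k) := by decide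
  have h0 : (σ₅₄ * σ₁₀ * w 5 * w 4 * w 1 * w 0) (H 0) = H 0 := by decide
  have h1 : (σ₅₄ * σ₁₀ * w 5 * w 4 * w 1 * w 0) (H 1) = H 1 := by decide
  refine ActsOn.of_basis (h.lifts hρ hb) ?_ ?_ fun k => ?_
  · rw [h0, h.line_zero hρ, h.exc_comp hρ hb, h.exc_comp hρ hb, cls_verInf hb', map_sub, map_sub,
      mark_E, mark_E]
    simp only [Matrix.cons_val]
    abel
  · rw [h1, h.line_one hρ, h.exc_comp hρ hb, h.exc_comp hρ hb, cls_horInf hb', map_sub, map_sub,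
      mark_E, mark_E]
    simp only [Matrix.cons_val]
    abel
  · rw [hE, mark_E, h.exc_comp hρ hb]

end IsInv

end

noncomputable section

variable {v : FunField → ℤ} {b : Fin 8 → ℂ}

/-! The elementary transformation with centers at two points on `x = 0` and `x = ∞`. -/

/-- The points after `(x, y) ↦ (x (y + b 4) / (y + b 0), y)`. -/
def elemPts (b : Fin 8 → ℂ) : Fin 8 → ℂ :=
  ![b 4, b 1, b 2 * (b 4 / b 0), b 3 * (b 4 / b 0), b 0, b 5, b 6, b 7]

theorem elemPts_elemPts (h0 : b 0 ≠ 0) (h4 : b 4 ≠ 0) : elemPts (elemPts b) = b := by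
  funext k
  fin_cases k <;> simp [elemPts] <;> field_simp

/-- `Φ` belongs to the mapping `(x, y) ↦ (x (y + b 4) / (y + b 0), y)`. -/
structure IsElem (b : Fin 8 → ℂ) (Φ : FunField ≃ₐ[ℂ] FunField) : Prop where
  map_x : Φ x = x * ((y + con (b 4)) / (y + con (b 0)))
  map_y : Φ y = y

theorem y_add_con_ne_zero (c : ℂ) : y + con c ≠ 0 := isCoord_xy.swap.add_con_ne_zero c

theorem exists_isElem (b : Fin 8 → ℂ) : ∃ Φ, IsElem b Φ := by
  have key : ∀ c, y + con c ∈ IntermediateField.adjoin ℂ {y} := fun c =>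
    add_mem (IntermediateField.mem_adjoin_simple_self _ _) (con_mem _ c)
  obtain ⟨τ, h1, h2⟩ := isCoord_xy.mul_left (div_mem (key (b 4)) (key (b 0)))
    (div_ne_zero (y_add_con_ne_zero _) (y_add_con_ne_zero _))
  exact ⟨τ, h1, h2⟩

/-- At the remaining point on `x = 0` or `x = ∞` the multiplier of `x` has a nonzero constant
residue, so the slope is only rescaled. -/
theorem IsPt.mul_unit {ξ ξ' u : FunField} {c m : ℂ} (h : IsPt v ξ (y + con c)) (hu : Res v u m)
    (hm : m ≠ 0) {Φ : FunField ≃ₐ[ℂ] FunField} (hy : Φ y = y) (hξ : Φ ξ' = ξ * u) :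
    IsPt (v ∘ Φ) ξ' (y + con c) := by
  have hv := h.isVal
  have hξ0 : ξ ≠ 0 := by
    rintro rfl
    have := h.left
    rw [hv.zero] at this
    omega
  obtain ⟨hu0, hu1⟩ := hu.unit hv hm
  refine h.comp Φ ?_ ?_
  · rw [hξ, hv.mul hξ0 hu0, h.left, hu1, add_zero]
  · rw [hξ, map_add, hy, algEquiv_con, div_mul_eq_div_div, div_eq_mul_inv (_ / ξ)]
    exact h.rt.mul_res hv (hu.inv hv hm) (inv_ne_zero hm)

/-- On a line `η = 0` the multiplier expands as `g = m + η w`. Then `x g + c m = (x + c) g - c η w`,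
so the slope undergoes an affine transformation with leading coefficient of residue `m`. -/
theorem IsPt.shear {η g w : FunField} {c c' m n : ℂ} (h : IsPt v η (x + con c))
    (hg : g = con m + η * w) (hw : Res v w n) (hm : m ≠ 0) (hc : c' = c * m)
    {Φ : FunField ≃ₐ[ℂ] FunField} (hη : Φ η = η) (hx : Φ x = x * g) :
    IsPt (v ∘ Φ) η (x + con c') := by
  have hv := h.isVal
  have hη0 : η ≠ 0 := by
    rintro rfl
    have := h.left
    rw [hv.zero] at this
    omega
  have hη1 : Res v η 0 := Res.of_pos (Or.inr (by rw [h.left]; norm_num))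
  have hgr : Res v g (m + 0 * n) := by
    rw [hg]; exact (Res.const v m).add hv (hη1.mul hv hw)
  refine h.comp Φ (by rw [hη, h.left]) ?_
  have h1 := h.rt.affine hv hgr (by simpa using hm) ((Res.const v (-c)).mul hv hw)
  have e : Φ (x + con c') / Φ η = (x + con c) / η * g + con (-c) * w := by
    rw [map_add, hη, hx, algEquiv_con, hc, con_mul, con_neg, hg]
    field_simp
    ring
  rwa [e]

namespace IsElem

variable {Φ : FunField ≃ₐ[ℂ] FunField}

theorem symm (h : IsElem b Φ) : IsElem (elemPts b) Φ.symm := by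
  have h0 := y_add_con_ne_zero (b 0)
  have h4 := y_add_con_ne_zero (b 4)
  constructor
  · change _ = x * ((y + con (b 0)) / (y + con (b 4)))
    rw [AlgEquiv.symm_apply_eq, map_mul, map_div₀, map_add, map_add, h.map_x, h.map_y,
      algEquiv_con, algEquiv_con]
    field_simp
  · rw [AlgEquiv.symm_apply_eq, h.map_y]

theorem map_x_inv (h : IsElem b Φ) :
    Φ x⁻¹ = x⁻¹ * ((y + con (b 0)) / (y + con (b 4))) := by
  rw [map_inv₀, h.map_x, mul_inv, inv_div]

theorem map_add (h : IsElem b Φ) (c : ℂ) : Φ (y + con c) = y + con c := by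
  rw [_root_.map_add, h.map_y, algEquiv_con]

/-- The residue of the multiplier at a point with given `y`. -/
theorem res_div (hv : IsVal v) {c α β : ℂ} (hc : v (y + con c) = 1) (hα : α ≠ c) :
    Res v ((y + con β) / (y + con α)) ((-c + β) / (-c + α)) := by
  have hy : Res v y (-c) := Res.of_add_pos (by rw [hc]; norm_num)
  exact (hy.add hv (Res.const v β)).div hv (hy.add hv (Res.const v α))
    (by rw [neg_add_eq_sub]; exact sub_ne_zero.2 hα)

theorem res_ne {c α β : ℂ} (hα : α ≠ c) (hβ : β ≠ c) : (-c + β) / (-c + α) ≠ 0 := by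
  rw [neg_add_eq_sub, neg_add_eq_sub]
  exact div_ne_zero (sub_ne_zero.2 hβ) (sub_ne_zero.2 hα)

/-- At a blown-up center the slope `(y + b 0) / x` is, up to inversion and a unit, the pull-back of
`x`. So the new `x` has transcendental residue and the exceptional curve becomes a horizontal line.
-/
theorem exc_zero_comp (h : IsElem b Φ) (hb : Good b) : exc b 0 ∘ Φ = horOrd (b 0) := by
  have h0 : IsPt (exc b 0) x (y + con (b 0)) := isPt_exc b 0
  have hv := h0.isVal
  have hy : Res (exc b 0) y (-b 0) := Res.of_add_pos (by rw [h0.right]; norm_num)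
  refine (IsGauss.comp hv Φ ?_ ?_).unique (isGauss_horOrd _) (isCoord_hor _)
  · have e : Φ x = ((y + con (b 0)) / x)⁻¹ * (y + con (b 4)) := by rw [h.map_x]; field_simp
    rw [e]
    refine (h0.rt.inv hv).mul_res hv (hy.add hv (Res.const _ (b 4))) ?_
    rw [neg_add_eq_sub]
    exact sub_ne_zero.2 hb.h04.symm
  · rw [h.map_add, h0.right]

theorem exc_four_comp (h : IsElem b Φ) (hb : Good b) : exc b 4 ∘ Φ = horOrd (b 4) := by
  have h0 : IsPt (exc b 4) x⁻¹ (y + con (b 4)) := isPt_exc b 4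
  have hv := h0.isVal
  have hy : Res (exc b 4) y (-b 4) := Res.of_add_pos (by rw [h0.right]; norm_num)
  have hne : -b 4 + b 0 ≠ 0 := by
    rw [neg_add_eq_sub]
    exact sub_ne_zero.2 hb.h04
  refine (IsGauss.comp hv Φ ?_ ?_).unique (isGauss_horOrd _) (isCoord_hor _)
  · have e : Φ x = (y + con (b 4)) / x⁻¹ * (y + con (b 0))⁻¹ := by
      rw [h.map_x]; field_simp
    rw [e]
    exact h0.rt.mul_res hv ((hy.add hv (Res.const _ (b 0))).inv hv hne) (inv_ne_zero hne)
  · rw [h.map_add, h0.right]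

theorem exc_comp (h : IsElem b Φ) (hb : Good b) (k : Fin 8) (hk0 : k ≠ 0) (hk4 : k ≠ 4) :
    exc b k ∘ Φ = exc (elemPts b) k := by
  apply eq_exc
  have hp := isPt_exc b k
  have hv := hp.isVal
  have hα := con_ne_zero (hb.ne 0)
  have h0 := y_add_con_ne_zero (b 0)
  have hm : b 4 / b 0 ≠ 0 := div_ne_zero (hb.ne 4) (hb.ne 0)
  -- Near `y = 0` the multiplier is `b 4 / b 0` plus a multiple of `y`, so the `x`-coordinate is
  -- rescaled.
  have hzero : ∀ c, exc b k y = 1 → IsPt (exc b k) y (x + con c) →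
      IsPt (exc b k ∘ Φ) y (x + con (c * (b 4 / b 0))) := by
    intro c hy hp
    have hy' : Res (exc b k) y 0 := Res.of_pos (Or.inr (by rw [hy]; norm_num))
    refine hp.shear (w := con ((b 0 - b 4) / b 0) * (y + con (b 0))⁻¹) ?_
      ((Res.const _ _).mul hv ((hy'.add hv (Res.const _ (b 0))).inv hv
        (by rw [zero_add]; exact hb.ne 0))) hm rfl h.map_y h.map_x
    rw [con_div, con_div, con_sub]
    field_simp
    ring
  -- Near `y = ∞` the multiplier tends to `1`, so these points stay in place.
  have hinf : ∀ c, IsPt (exc b k) y⁻¹ (x + con c) → IsPt (exc b k ∘ Φ) y⁻¹ (x + con c) := by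
    intro c hp
    have hy' : Res (exc b k) y⁻¹ 0 := Res.of_pos (Or.inr (by rw [hp.left]; norm_num))
    have hr := (Res.const (exc b k) 1).add hv ((Res.const _ (b 0)).mul hv hy')
    rw [mul_zero, add_zero] at hr
    refine hp.shear (w := con (b 4 - b 0) * (con 1 + con (b 0) * y⁻¹)⁻¹) ?_
      ((Res.const _ _).mul hv (hr.inv hv one_ne_zero)) one_ne_zero (mul_one c).symm
      (by rw [map_inv₀, h.map_y]) h.map_x
    have hy := y_ne_zero
    have h1 : con 1 + con (b 0) * y⁻¹ = (y + con (b 0)) / y := by rw [con_one]; field_simp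
    rw [h1, con_sub, con_one]
    field_simp
    ring
  fin_cases k
  · exact absurd rfl hk0
  · exact hp.mul_unit (res_div hv hp.right hb.h01) (res_ne hb.h01 hb.h14.symm) h.map_y h.map_x
  · exact (hzero _ hp.right hp.symm).symm
  · exact (hzero _ hp.right hp.symm).symm
  · exact absurd rfl hk4
  · exact hp.mul_unit (res_div hv hp.right hb.h45) (res_ne hb.h45 hb.h05) h.map_y h.map_x_inv
  · exact (hinf _ hp.symm).symm
  · exact (hinf _ hp.symm).symm

/-- The inverse is an elementary transformation for `elemPts b`, whose centers are the points to
which the lines are contracted. So the contraction is read off from the blow-up on the other side.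
-/
theorem horOrd_zero_comp (h : IsElem b Φ) (hb' : Good (elemPts b)) :
    horOrd (b 0) ∘ Φ = exc (elemPts b) 4 := by
  have e : exc (elemPts b) 4 ∘ Φ.symm = horOrd (b 0) := h.symm.exc_four_comp hb'
  rw [← e, symm_comp]

theorem horOrd_four_comp (h : IsElem b Φ) (hb' : Good (elemPts b)) :
    horOrd (b 4) ∘ Φ = exc (elemPts b) 0 := by
  have e : exc (elemPts b) 0 ∘ Φ.symm = horOrd (b 4) := h.symm.exc_zero_comp hb'
  rw [← e, symm_comp]

theorem maps (h : IsElem b Φ) (hb : Good b) (hb' : Good (elemPts b)) (hv : v ∈ primes b) :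
    v ∘ Φ ∈ primes (elemPts b) := by
  rcases hv with hv | ⟨k, rfl⟩
  · have hval := hv.isVal
    by_cases hy : RT v y
    · exact Or.inl (hv.comp Φ (Or.inr (by rwa [h.map_y])))
    have hx : RT v x := hv.rt.resolve_right hy
    -- Only horizontal lines remain. Those through neither center are mapped to curves, as the
    -- multiplier has a nonzero constant residue on them; the two others become exceptional curves.
    rcases exists_of_not_RT y_add_con_ne_zero hy hval with hneg | ⟨c, hc⟩
    · refine Or.inl (hv.comp Φ (Or.inl ?_))
      rw [h.map_x]
      have hyi : Res v y⁻¹ 0 := Res.of_pos (Or.inr (by rw [hval.inv]; omega))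
      have hr : ∀ c, Res v (con 1 + con c * y⁻¹) 1 := by
        intro c
        have hr := (Res.const v 1).add hval ((Res.const _ c).mul hval hyi)
        rwa [mul_zero, add_zero] at hr
      have e : (y + con (b 4)) / (y + con (b 0))
          = (con 1 + con (b 4) * y⁻¹) / (con 1 + con (b 0) * y⁻¹) := by
        have hy := y_ne_zero
        have h1 : ∀ c, con 1 + con c * y⁻¹ = (y + con c) / y := fun c => by
          rw [con_one]; field_simp
        rw [h1, h1, div_div_div_cancel_right₀ hy]
      rw [e]
      exact hx.mul_res hval ((hr (b 4)).div hval (hr (b 0)) one_ne_zero) (by simp)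
    · have hcv := hv.eq_horOrd hc
      by_cases h0 : b 0 = c
      · subst h0
        right
        refine ⟨4, ?_⟩
        rw [hcv, h.horOrd_zero_comp hb']
      by_cases h4 : b 4 = c
      · subst h4
        right
        refine ⟨0, ?_⟩
        rw [hcv, h.horOrd_four_comp hb']
      refine Or.inl (hv.comp Φ (Or.inl ?_))
      rw [h.map_x]
      have hc1 : v (y + con c) = 1 := by rw [hcv]; exact (isGauss_horOrd c).val
      exact hx.mul_res hval (res_div hval hc1 h0) (res_ne h0 h4)
  · by_cases h0 : k = 0
    · rw [h0, h.exc_zero_comp hb]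
      exact Or.inl (isGauss_horOrd _).isCurve_x
    by_cases h4 : k = 4
    · rw [h4, h.exc_four_comp hb]
      exact Or.inl (isGauss_horOrd _).isCurve_x
    exact Or.inr ⟨k, (h.exc_comp hb k h0 h4).symm⟩

theorem lifts (h : IsElem b Φ) (hb : Good b) (hb' : Good (elemPts b)) :
    Lifts Φ (primes b) (primes (elemPts b)) :=
  Lifts.of_maps (fun _ hv => h.maps hb hb' hv) fun v hv => by
    have e := elemPts_elemPts (hb.ne 0) (hb.ne 4)
    have := h.symm.maps hb' (e.symm ▸ hb) hv
    rwa [e] at this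

theorem line_zero (h : IsElem b Φ) : lineOrd 0 ∘ Φ = lineOrd 0 := by
  have h0 := isGauss_line_zero
  have hv := h0.isVal
  refine (IsGauss.comp hv Φ (by rw [h.map_y]; exact h0.rt) ?_).unique h0 isCoord_xy.swap
  have h1 := h0.rt (b 4)
  have h2 := h0.rt (b 0)
  rw [h.map_x, hv.mul x_ne_zero (div_ne_zero h1.1 h2.1), hv.div h1.1 h2.1, h1.2, h2.2, h0.val]; rfl

theorem line_one (h : IsElem b Φ) (hb : Good b) : lineOrd 1 ∘ Φ = lineOrd 1 := by
  have h0 := isGauss_line_one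
  have hv := h0.isVal
  have hy : Res (lineOrd 1) y 0 := Res.of_pos (Or.inr (by rw [h0.val]; norm_num))
  refine (IsGauss.comp hv Φ ?_ (by rw [h.map_y]; exact h0.val)).unique h0 isCoord_xy
  rw [h.map_x]
  have h1 := hy.add hv (Res.const _ (b 4))
  have h2 := hy.add hv (Res.const _ (b 0))
  rw [zero_add] at h1 h2
  exact h0.rt.mul_res hv (h1.div hv h2 (hb.ne 0)) (div_ne_zero (hb.ne 4) (hb.ne 0))

theorem actsOn (h : IsElem b Φ) (hb : Good b) (hb' : Good (elemPts b)) :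
    ActsOn Φ (primes b) (primes (elemPts b)) (exc b) (exc (elemPts b)) (w 2) := by
  have hE : ∀ k, k ≠ 0 → k ≠ 4 → (w 2) (E k) = E k := by decide
  have hE0 : (w 2) (E 0) = H 1 - E 4 := by decide
  have hE4 : (w 2) (E 4) = H 1 - E 0 := by decide
  have h0 : (w 2) (H 0) = H 0 + (H 1 - E 4) - E 0 := by decide
  have h1 : (w 2) (H 1) = H 1 := by decide
  -- `b 0` is entry 4 of `elemPts b`, and `b 4` is entry 0; therefore left and right are exchanged.
  have c0 : cls (primes (elemPts b)) (horOrd (b 0)) = _ := cls_horOrd_right hb'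
  have c4 : cls (primes (elemPts b)) (horOrd (b 4)) = _ := cls_horOrd_left hb'
  refine ActsOn.of_basis (h.lifts hb hb') ?_ ?_ fun k => ?_
  · rw [h0, h.line_zero, h.exc_zero_comp hb, h.exc_comp hb 1 (by decide) (by decide), c0,
      map_sub _ (_ + _), _root_.map_add, mark_H, mark_E, fibreCls, Matrix.cons_val_zero]
    abel
  · rw [h1, mark_H, h.line_one hb, h.exc_comp hb 2 (by decide) (by decide),
      h.exc_comp hb 3 (by decide) (by decide)]
    rfl
  · by_cases hk0 : k = 0
    · rw [hk0, hE0, h.exc_zero_comp hb, c0]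
    by_cases hk4 : k = 4
    · rw [hk4, hE4, h.exc_four_comp hb, c4]
    rw [hE k hk0 hk4, h.exc_comp hb k hk0 hk4, mark_E]

end IsElem

end

noncomputable section

variable {v : FunField → ℤ} {b : Fin 8 → ℂ}

/-! The marking is bijective. -/

/-- A rational function without zeros and poles in the affine plane is constant. -/
theorem exists_eq_con {f : FunField} (hf : f ≠ 0)
    (h : ∀ P : Poly, Irreducible P → ordAlong x y (Ideal.span {P}) f = 0) : ∃ c, f = con c := by
  -- In a reduced fraction an irreducible factor of the numerator would also divide the denominator,
  -- as the multiplicities agree. So numerator and denominator are both units, that is, constants.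
  have key : ∀ A B : Poly, A ≠ 0 → IsRelPrime A B →
      (∀ P : Poly, Irreducible P → multiplicity P A = multiplicity P B) →
      ∃ c, c ≠ 0 ∧ A = C c := by
    intro A B hA hAB hP
    have hu : IsUnit A := by
      by_contra hu
      obtain ⟨P, hP1, hP2⟩ := WfDvdMonoid.exists_irreducible_factor hu hA
      refine hP1.not_isUnit (hAB hP2 ?_)
      have h1 := hP P hP1
      exact multiplicity_ne_zero.1 (h1 ▸ multiplicity_ne_zero.2 hP2)
    obtain ⟨c, hc, rfl⟩ := MvPolynomial.isUnit_iff_eq_C_of_isReduced.1 hu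
    exact ⟨c, hc.ne_zero, rfl⟩
  obtain ⟨A, B, hAB, rfl⟩ := IsFractionRing.exists_reduced_fraction (A := Poly) f
  have hB : (B : Poly) ≠ 0 := nonZeroDivisors.ne_zero B.2
  rw [IsFractionRing.mk'_eq_div] at hf h ⊢
  have hA : A ≠ 0 := by rintro rfl; simp at hf
  have hm : ∀ P : Poly, Irreducible P → multiplicity P A = multiplicity P (B : Poly) := by
    intro P hP
    have h1 := h P hP
    rw [ordAlong_span_div hP hA hB] at h1
    omega
  obtain ⟨a, ha, rfl⟩ := key A B hA hAB hm
  obtain ⟨c, hc, hBc⟩ := key B _ hB hAB.symm fun P hP => (hm P hP).symm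
  rw [hBc, algebraMap_C, algebraMap_C, ← con_div]
  exact ⟨_, rfl⟩

theorem verInf_x : verInf x = -1 := by
  have h := isGauss_verInf.val
  rw [isGauss_verInf.isVal.inv] at h
  omega

theorem horInf_inv_y : horInf y = -1 := by
  have h := horInf_y 0
  rwa [con_zero, add_zero] at h

/-- Rewrites the total transforms by ten distinct prime divisors: the coefficient of `H 0` is added
to those of `E 0, E 1`, that of `H 1` to those of `E 2, E 3`. -/
theorem mark_eq_sum (b : Fin 8 → ℂ) (D : Lat) : mark (primes b) (exc b) D
    = ∑ i, Sum.elim (![D.2 0 + D.1 0, D.2 1 + D.1 0, D.2 2 + D.1 1, D.2 3 + D.1 1, D.2 4, D.2 5,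
      D.2 6, D.2 7] : Fin 8 → ℤ) D.1 i • cls (primes b) (Sum.elim (exc b) lineOrd i) := by
  rw [mark_apply, Fintype.sum_sum_type]
  simp only [Fin.sum_univ_eight, Fin.sum_univ_two, Sum.elim_inl, Sum.elim_inr, Matrix.cons_val,
    fibreCls, add_zsmul, zsmul_add]
  abel

theorem isCurve_lineOrd (i : Fin 2) : IsCurve (lineOrd i) := by
  fin_cases i
  exacts [isGauss_line_zero.isCurve_y, isGauss_line_one.isCurve_x]

theorem lineOrd_injective : Function.Injective lineOrd := by
  have hne : lineOrd 0 ≠ lineOrd 1 := by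
    intro h
    have h1 := isGauss_line_zero.val
    rw [h, isGauss_line_one.rt.val] at h1
    omega
  intro i j hij
  fin_cases i <;> fin_cases j
  exacts [rfl, (hne hij).elim, (hne hij.symm).elim, rfl]

/-- A relation is the divisor of some `f`. Dividing `f` by suitable powers of `x` and `y` removes
all zeros and poles in the affine plane, so `f` is a constant times a monomial. It has order zero
along `x = ∞` and `y = ∞`, hence the exponents vanish, `f` is constant, and all coefficients are
zero. -/
theorem mark_injective (hb : Good b) : Function.Injective (mark (primes b) (exc b)) := by
  rw [injective_iff_map_eq_zero]
  intro D hD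
  rw [mark_eq_sum] at hD
  obtain ⟨f, hf, hfu, hf0⟩ := exists_of_sum_cls_eq_zero (fun v hv => isVal_of_mem_primes hv)
    (injective_sumElim hb lineOrd_injective isCurve_lineOrd) (sumElim_mem isCurve_lineOrd) hD
  have hx := x_ne_zero
  have hy := y_ne_zero
  have hg : f * x ^ (-D.1 0) * y ^ (-D.1 1) ≠ 0 :=
    mul_ne_zero (mul_ne_zero hf (zpow_ne_zero _ hx)) (zpow_ne_zero _ hy)
  have hval : ∀ v, IsVal v → v (f * x ^ (-D.1 0) * y ^ (-D.1 1))
      = v f - D.1 0 * v x - D.1 1 * v y := by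
    intro v hv
    rw [hv.mul (mul_ne_zero hf (zpow_ne_zero _ hx)) (zpow_ne_zero _ hy),
      hv.mul hf (zpow_ne_zero _ hx), hv.zpow hx, hv.zpow hy]
    ring
  have hcurve : ∀ v, IsCurve v → v ≠ lineOrd 0 → v ≠ lineOrd 1 → v f = 0 := by
    intro v hv h0 h1
    refine hf0 v (Or.inl hv) ?_
    rintro ⟨k | i, rfl⟩
    · exact not_isCurve_exc b k hv
    · fin_cases i
      exacts [h0 rfl, h1 rfl]
  obtain ⟨c, hc⟩ := exists_eq_con hg fun P hP => by
    have hcv := isCurve_ordAlong (Or.inl rfl) (Or.inl rfl) hP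
    have hv := hcv.isVal
    rw [hval _ hv]
    by_cases h0 : ordAlong x y (Ideal.span {P}) = lineOrd 0
    · have h1 := hfu (Sum.inr 0)
      simp only [Sum.elim_inr] at h1
      rw [h0, h1, isGauss_line_zero.val, isGauss_line_zero.rt.val]
      ring
    by_cases h1 : ordAlong x y (Ideal.span {P}) = lineOrd 1
    · have h2 := hfu (Sum.inr 1)
      simp only [Sum.elim_inr] at h2
      rw [h1, h2, isGauss_line_one.val, isGauss_line_one.rt.val]
      ring
    have hX : ∀ i, ordAlong x y (Ideal.span {P}) (![x, y] i) = multiplicity P (X i) := by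
      intro i
      have := isCoord_xy.ordAlong_aeval hP (X_ne_zero i)
      rwa [aeval_X] at this
    have hx0 : ordAlong x y (Ideal.span {P}) x = 0 := by
      have h3 : ¬ 0 < ordAlong x y (Ideal.span {P}) x := fun h => h0 (hcv.eq_line_zero h)
      have h4 := hX 0
      rw [Matrix.cons_val_zero] at h4
      omega
    have hy0 : ordAlong x y (Ideal.span {P}) y = 0 := by
      have h3 : ¬ 0 < ordAlong x y (Ideal.span {P}) y := fun h => h1 (hcv.eq_line_one h)
      have h4 := hX 1
      rw [Matrix.cons_val_one, Matrix.cons_val_zero] at h4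
      omega
    rw [hcurve _ hcv h0 h1, hx0, hy0]
    ring
  have hzero : ∀ v, IsVal v → v f = D.1 0 * v x + D.1 1 * v y := by
    intro v hv
    have := hval v hv
    rw [hc, hv.const] at this
    omega
  have h0 : D.1 0 = 0 := by
    have h1 := hzero _ isGauss_verInf.isVal
    rw [hcurve verInf isGauss_verInf.isCurve_y, verInf_x, isGauss_verInf.rt.val] at h1
    · omega
    · intro h
      have := isGauss_line_zero.val
      rw [← h, verInf_x] at this
      omega
    · intro h
      have := isGauss_line_one.rt.val
      rw [← h, verInf_x] at this
      omega
  have h1 : D.1 1 = 0 := by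
    have h1 := hzero _ isGauss_horInf.isVal
    rw [hcurve horInf isGauss_horInf.isCurve_x, horInf_inv_y, isGauss_horInf.rt.val] at h1
    · omega
    · intro h
      have := isGauss_line_zero.rt.val
      rw [← h, horInf_inv_y] at this
      omega
    · intro h
      have := isGauss_line_one.val
      rw [← h, horInf_inv_y] at this
      omega
  have h2 : ∀ k, exc b k f = 0 := fun k => by
    rw [hzero _ (isPt_exc b k).isVal, h0, h1]; ring
  have h3 : ∀ k, (![D.2 0 + D.1 0, D.2 1 + D.1 0, D.2 2 + D.1 1, D.2 3 + D.1 1, D.2 4, D.2 5,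
      D.2 6, D.2 7] : Fin 8 → ℤ) k = 0 := fun k => by rw [← h2 k]; exact (hfu (Sum.inl k)).symm
  simp only [h0, h1, add_zero] at h3
  refine Prod.ext (funext fun i => ?_) (funext fun k => ?_)
  · fin_cases i
    exacts [h0, h1]
  · have := h3 k
    fin_cases k <;> exact this

/-- A curve not at infinity has an irreducible affine equation `P`. The divisor of `P` is this curve
plus multiples of the two lines at infinity and of exceptional curves, whose classes are already in
the image. -/
theorem mark_surjective (hb : Good b) : Function.Surjective (mark (primes b) (exc b)) := by
  suffices h : ∀ v ∈ primes b, cls (primes b) v ∈ (mark (primes b) (exc b)).range by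
    intro a
    induction a using PicOn.induction with
    | h0 => exact (mark (primes b) (exc b)).range.zero_mem
    | hadd a a' ha ha' => exact (mark (primes b) (exc b)).range.add_mem ha ha'
    | hneg a ha => exact (mark (primes b) (exc b)).range.neg_mem ha
    | hcls v hv => exact h v hv
  have hexc : ∀ k, cls (primes b) (exc b k) ∈ (mark (primes b) (exc b)).range :=
    fun k => ⟨E k, mark_E _ _ k⟩
  rintro v (hv | ⟨k, rfl⟩)
  swap
  · exact hexc k
  by_cases hvx : v x < 0
  · rw [hv.eq_verInf hvx]
    exact ⟨_, (cls_verInf hb).symm⟩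
  by_cases hvy : v y < 0
  · rw [hv.eq_horInf hvy]
    exact ⟨_, (cls_horInf hb).symm⟩
  obtain ⟨P, hP, hvP⟩ := exists_eq_ordAlong isCoord_xy hv.isVal (not_lt.1 hvx) (not_lt.1 hvy)
    hv.rt hv.exists_eq_one
  have huc : ∀ i, IsCurve ((![v, verInf, horInf] : Fin 3 → FunField → ℤ) i) := by
    intro i
    fin_cases i
    exacts [hv, isGauss_verInf.isCurve_y, isGauss_horInf.isCurve_x]
  have hu : Function.Injective (![v, verInf, horInf] : Fin 3 → FunField → ℤ) := by
    have h1 : v ≠ verInf := by rintro rfl; rw [verInf_x] at hvx; omega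
    have h2 : v ≠ horInf := by rintro rfl; rw [horInf_inv_y] at hvy; omega
    have h3 : verInf ≠ horInf := by
      intro h
      have := isGauss_horInf.rt.val
      rw [← h, verInf_x] at this
      omega
    intro i j hij
    fin_cases i <;> fin_cases j
    exacts [rfl, (h1 hij).elim, (h2 hij).elim, (h1 hij.symm).elim, rfl, (h3 hij).elim,
      (h2 hij.symm).elim, (h3 hij.symm).elim, rfl]
  have h := sum_cls_eq_zero (f := algebraMap Poly FunField P) (injective_sumElim hb hu huc)
    (sumElim_mem huc) (algebraMap_poly_ne_zero hP.ne_zero) ?_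
  · rw [Fintype.sum_sum_type, Fin.sum_univ_three] at h
    simp only [Sum.elim_inl, Sum.elim_inr, Matrix.cons_val] at h
    have h1 : v (algebraMap Poly FunField P) = 1 := by rw [hvP, ordAlong_span_self hP]
    rw [h1, one_zsmul, cls_verInf hb, cls_horInf hb] at h
    have e : cls (primes b) v = -(∑ k, exc b k (algebraMap Poly FunField P) • cls (primes b) (exc b k)
        + (verInf (algebraMap Poly FunField P) • mark (primes b) (exc b) (H 0 - E 4 - E 5)
        + horInf (algebraMap Poly FunField P) • mark (primes b) (exc b) (H 1 - E 6 - E 7))) := by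
      rw [eq_neg_iff_add_eq_zero, ← h]
      abel
    rw [e]
    exact neg_mem (add_mem (sum_mem fun k _ => zsmul_mem (hexc k) _)
      (add_mem (zsmul_mem (AddMonoidHom.mem_range.2 ⟨_, rfl⟩) _)
        (zsmul_mem (AddMonoidHom.mem_range.2 ⟨_, rfl⟩) _)))
  · rintro v' (hv' | ⟨k, rfl⟩) hvu
    · by_cases hx : v' x < 0
      · exact (hvu ⟨Sum.inr 1, (hv'.eq_verInf hx).symm⟩).elim
      by_cases hy : v' y < 0
      · exact (hvu ⟨Sum.inr 2, (hv'.eq_horInf hy).symm⟩).elim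
      obtain ⟨Q, hQ, rfl⟩ := exists_eq_ordAlong isCoord_xy hv'.isVal (not_lt.1 hx) (not_lt.1 hy)
        hv'.rt hv'.exists_eq_one
      rw [ordAlong_span_algebraMap hQ hP.ne_zero, Nat.cast_eq_zero, multiplicity_eq_zero]
      intro hQP
      refine hvu ⟨Sum.inr 0, ?_⟩
      change v = _
      rw [hvP, Ideal.span_singleton_eq_span_singleton.2 (hQ.associated_of_dvd hP hQP)]
    · exact (hvu ⟨Sum.inl k, rfl⟩).elim

end

noncomputable section

/-! The points of the surface, and generic parameters. -/

/-- The parameters of the eight points, with the signs of `ptCoord`. -/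
def Params.pts (p : Params) : Fin 8 → ℂ :=
  ![p.d * p.a₃, p.a₁, 1 / p.a₀, p.c / p.a₂, 1 / p.a₁, p.d / p.a₃, p.c * p.a₂, p.a₀]

theorem excOrd_eq (p : Params) : excOrd p = exc p.pts := rfl

theorem primeDivisors_eq (p : Params) : primeDivisors p = primes p.pts := by
  rw [primeDivisors, primes, excOrd_eq]
  congr 1
  ext v
  exact isCurve_iff.symm

theorem Params.IsGeneric.ne_of_root {p : Params} (hp : p.IsGeneric) (n : Fin 6 → ℤ)
    (hn : inter (∑ i, n i • α i) (∑ i, n i • α i) = -2) {A B : ℂ} (hB : B ≠ 0)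
    (h : ∏ i, p.rootVar i ^ n i = A / B) : A ≠ B := by
  rintro rfl
  rw [div_self hB] at h
  exact hp.root_ne n hn h

/-- Turns a condition on a root, in the form `L ≠ R`, into the distinctness of two coordinates with
`A / B = L / R`. -/
theorem ne_of_mul_eq {A B L R : ℂ} (hLR : L ≠ R) (hB : B ≠ 0) (h : L * B = R * A) : A ≠ B := by
  rintro rfl
  exact hLR (mul_right_cancel₀ hB h)

/-- The conditions on the parameters that the elementary transformations need. -/
structure Params.Nondegenerate (p : Params) : Prop where
  r0 : p.a₃ ≠ p.a₁ * p.d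
  r1 : p.a₁ ≠ p.d * p.a₃
  r2 : p.a₁ * p.a₃ * p.d ≠ 1
  r3 : p.a₀ * p.a₂ * p.c ≠ 1
  r4 : p.a₂ ≠ p.a₀ * p.c
  r5 : p.a₀ ≠ p.c * p.a₂
  r02 : p.a₃ ^ 2 ≠ 1
  r12 : p.a₁ ^ 2 ≠ 1
  r012 : p.a₁ * p.a₃ ≠ p.d
  r35 : p.a₀ ^ 2 ≠ 1
  r34 : p.a₂ ^ 2 ≠ 1
  r345 : p.a₀ * p.a₂ ≠ p.c
  r23 : p.a₀ * p.a₁ * p.a₂ * p.a₃ * p.c * p.d ≠ 1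
  r235 : p.a₀ ^ 2 * p.a₁ * p.a₃ * p.d ≠ 1
  r234 : p.a₁ * p.a₂ ^ 2 * p.a₃ * p.d ≠ 1
  r2345 : p.a₀ * p.a₁ * p.a₂ * p.a₃ * p.d ≠ p.c
  r023 : p.a₀ * p.a₂ * p.a₃ ^ 2 * p.c ≠ 1
  r123 : p.a₀ * p.a₁ ^ 2 * p.a₂ * p.c ≠ 1
  r01223 : p.a₀ * p.a₁ ^ 2 * p.a₂ * p.a₃ ^ 2 * p.c ≠ 1
  r23345 : p.a₀ ^ 2 * p.a₁ * p.a₂ ^ 2 * p.a₃ * p.d ≠ 1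

/-- The digits in the name of a field list the simple roots, with multiplicity, whose sum is the
real root in question: `r01223` belongs to `α 0 + α 1 + 2 α 2 + α 3`. -/
theorem Params.IsGeneric.nondegenerate {p : Params} (hp : p.IsGeneric) : p.Nondegenerate := by
  have h0 := hp.a₀_ne
  have h1 := hp.a₁_ne
  have h2 := hp.a₂_ne
  have h3 := hp.a₃_ne
  have hc := hp.c_ne
  have hd := hp.d_ne
  constructor
  · refine hp.ne_of_root ![1, 0, 0, 0, 0, 0] (by decide) (mul_ne_zero h1 hd) ?_
    simp [Fin.prod_univ_six, Params.rootVar]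
  · refine hp.ne_of_root ![0, 1, 0, 0, 0, 0] (by decide) (mul_ne_zero hd h3) ?_
    simp [Fin.prod_univ_six, Params.rootVar]
  · refine hp.ne_of_root ![0, 0, 1, 0, 0, 0] (by decide) one_ne_zero ?_
    simp [Fin.prod_univ_six, Params.rootVar]
  · refine hp.ne_of_root ![0, 0, 0, 1, 0, 0] (by decide) one_ne_zero ?_
    simp [Fin.prod_univ_six, Params.rootVar]
  · refine hp.ne_of_root ![0, 0, 0, 0, 1, 0] (by decide) (mul_ne_zero h0 hc) ?_
    simp [Fin.prod_univ_six, Params.rootVar]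
  · refine hp.ne_of_root ![0, 0, 0, 0, 0, 1] (by decide) (mul_ne_zero hc h2) ?_
    simp [Fin.prod_univ_six, Params.rootVar]
  · refine hp.ne_of_root ![1, 0, 1, 0, 0, 0] (by decide) one_ne_zero ?_
    simp [Fin.prod_univ_six, Params.rootVar]; field_simp
  · refine hp.ne_of_root ![0, 1, 1, 0, 0, 0] (by decide) one_ne_zero ?_
    simp [Fin.prod_univ_six, Params.rootVar]; field_simp
  · refine hp.ne_of_root ![1, 1, 1, 0, 0, 0] (by decide) hd ?_
    simp [Fin.prod_univ_six, Params.rootVar]; field_simp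
  · refine hp.ne_of_root ![0, 0, 0, 1, 0, 1] (by decide) one_ne_zero ?_
    simp [Fin.prod_univ_six, Params.rootVar]; field_simp
  · refine hp.ne_of_root ![0, 0, 0, 1, 1, 0] (by decide) one_ne_zero ?_
    simp [Fin.prod_univ_six, Params.rootVar]; field_simp
  · refine hp.ne_of_root ![0, 0, 0, 1, 1, 1] (by decide) hc ?_
    simp [Fin.prod_univ_six, Params.rootVar]; field_simp
  · refine hp.ne_of_root ![0, 0, 1, 1, 0, 0] (by decide) one_ne_zero ?_
    simp [Fin.prod_univ_six, Params.rootVar]; field_simp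
  · refine hp.ne_of_root ![0, 0, 1, 1, 0, 1] (by decide) one_ne_zero ?_
    simp [Fin.prod_univ_six, Params.rootVar]; field_simp
  · refine hp.ne_of_root ![0, 0, 1, 1, 1, 0] (by decide) one_ne_zero ?_
    simp [Fin.prod_univ_six, Params.rootVar]; field_simp
  · refine hp.ne_of_root ![0, 0, 1, 1, 1, 1] (by decide) hc ?_
    simp [Fin.prod_univ_six, Params.rootVar]; field_simp
  · refine hp.ne_of_root ![1, 0, 1, 1, 0, 0] (by decide) one_ne_zero ?_
    simp [Fin.prod_univ_six, Params.rootVar]; field_simp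
  · refine hp.ne_of_root ![0, 1, 1, 1, 0, 0] (by decide) one_ne_zero ?_
    simp [Fin.prod_univ_six, Params.rootVar]; field_simp
  · refine hp.ne_of_root ![1, 1, 2, 1, 0, 0] (by decide) one_ne_zero ?_
    simp [Fin.prod_univ_six, Params.rootVar, zpow_ofNat]; field_simp
  · refine hp.ne_of_root ![0, 0, 1, 2, 1, 1] (by decide) one_ne_zero ?_
    simp [Fin.prod_univ_six, Params.rootVar, zpow_ofNat]; field_simp

/-- The action of the mapping on roots, in the root basis. -/
def rootStep (n : Fin 6 → ℤ) : Fin 6 → ℤ :=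
  ![-n 1 + n 2, -n 0 + n 2, -n 0 - n 1 + 2 * n 2 + n 3 - n 4 - n 5,
    -n 0 - n 1 + n 2 + 2 * n 3 - n 4 - n 5, n 3 - n 5, n 3 - n 4]

theorem inter_root (n : Fin 6 → ℤ) : inter (∑ i, n i • α i) (∑ i, n i • α i)
    = -2 * (n 0 ^ 2 + n 1 ^ 2 + n 2 ^ 2 + n 3 ^ 2 + n 4 ^ 2 + n 5 ^ 2 - n 0 * n 2 - n 1 * n 2
      - n 2 * n 3 - n 3 * n 4 - n 3 * n 5) := by
  simp [inter, Fin.sum_univ_six, Fin.sum_univ_eight, α, H, E, Pi.single_apply]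
  ring

theorem Params.IsGeneric.next {p : Params} (hp : p.IsGeneric) : p.next.IsGeneric := by
  have h0 := hp.a₀_ne
  have h1 := hp.a₁_ne
  have h2 := hp.a₂_ne
  have h3 := hp.a₃_ne
  have hc := hp.c_ne
  have hd := hp.d_ne
  have hq : p.q ≠ 0 := one_div_ne_zero (mul_ne_zero (mul_ne_zero (mul_ne_zero h0 h1) h2) h3)
  refine ⟨h0, h1, h2, h3, div_ne_zero hd hq, div_ne_zero hc hq, fun n hn => ?_⟩
  -- `rootStep` is an isometry; on the root lattice it is the inverse of the push-forward, so it
  -- carries roots for `p.next` back to roots for `p`.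
  have hn' : inter (∑ i, rootStep n i • α i) (∑ i, rootStep n i • α i) = -2 := by
    rw [inter_root] at hn ⊢
    simp only [rootStep, Matrix.cons_val]
    linear_combination hn
  have h := hp.root_ne _ hn'
  have hr : ∀ i, p.rootVar i ≠ 0 := by
    intro i
    fin_cases i <;> simp [Params.rootVar, h0, h1, h2, h3, hc, hd]
  have e : ∏ i, p.next.rootVar i ^ n i = ∏ i, p.rootVar i ^ rootStep n i := by
    have f0 : p.next.rootVar 0 = (p.rootVar 1 * p.rootVar 2 * p.rootVar 3)⁻¹ := by
      simp [Params.rootVar, Params.next, Params.q]; field_simp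
    have f1 : p.next.rootVar 1 = (p.rootVar 0 * p.rootVar 2 * p.rootVar 3)⁻¹ := by
      simp [Params.rootVar, Params.next, Params.q]; field_simp
    have f2 : p.next.rootVar 2 = p.rootVar 0 * p.rootVar 1 * p.rootVar 2 ^ 2 * p.rootVar 3 := by
      simp [Params.rootVar, Params.next, Params.q]; field_simp
    have f3 : p.next.rootVar 3 = p.rootVar 2 * p.rootVar 3 ^ 2 * p.rootVar 4 * p.rootVar 5 := by
      simp [Params.rootVar, Params.next, Params.q]; field_simp
    have f4 : p.next.rootVar 4 = (p.rootVar 2 * p.rootVar 3 * p.rootVar 5)⁻¹ := by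
      simp [Params.rootVar, Params.next, Params.q]; field_simp
    have f5 : p.next.rootVar 5 = (p.rootVar 2 * p.rootVar 3 * p.rootVar 4)⁻¹ := by
      simp [Params.rootVar, Params.next, Params.q]; field_simp
    simp only [Fin.prod_univ_six, f0, f1, f2, f3, f4, f5, rootStep, Matrix.cons_val]
    -- Logarithms turn the identity of monomials with integer exponents into a linear identity for
    -- `ring`.
    obtain ⟨l, hl⟩ : ∃ l : Fin 6 → ℂ, ∀ i, p.rootVar i = Complex.exp (l i) :=
      ⟨fun i => Complex.log (p.rootVar i), fun i => (Complex.exp_log (hr i)).symm⟩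
    simp only [hl, ← Complex.exp_int_mul, ← Complex.exp_nat_mul, ← Complex.exp_neg,
      ← Complex.exp_add]
    congr 1
    push_cast
    ring
  rw [e]
  exact h

theorem Params.IsGeneric.good {p : Params} (hp : p.IsGeneric) : Good p.pts := by
  have h0 := hp.a₀_ne
  have h1 := hp.a₁_ne
  have h2 := hp.a₂_ne
  have h3 := hp.a₃_ne
  have hc := hp.c_ne
  have hd := hp.d_ne
  have r := hp.nondegenerate
  constructor
  · intro k
    fin_cases k <;> simp [Params.pts, h0, h1, h2, h3, hc, hd]
  · exact r.r1.symm
  · refine ne_of_mul_eq r.r2 (one_div_ne_zero h1) ?_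
    simp [Params.pts]; field_simp
  · refine ne_of_mul_eq r.r02 (div_ne_zero hd h3) ?_
    simp [Params.pts]; field_simp
  · refine ne_of_mul_eq r.r12 (one_div_ne_zero h1) ?_
    simp [Params.pts]; field_simp
  · refine ne_of_mul_eq r.r012 (div_ne_zero hd h3) ?_
    simp [Params.pts]; field_simp
  · refine ne_of_mul_eq r.r0 (div_ne_zero hd h3) ?_
    simp [Params.pts]; field_simp
  · refine ne_of_mul_eq r.r4 (div_ne_zero hc h2) ?_
    simp [Params.pts]; field_simp
  · refine ne_of_mul_eq r.r3.symm (mul_ne_zero hc h2) ?_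
    simp [Params.pts]; field_simp
  · refine ne_of_mul_eq r.r35.symm h0 ?_
    simp [Params.pts]; field_simp
  · refine ne_of_mul_eq r.r34.symm (mul_ne_zero hc h2) ?_
    simp [Params.pts]; field_simp
  · refine ne_of_mul_eq r.r345.symm h0 ?_
    simp [Params.pts]; field_simp
  · exact r.r5.symm

/-- The points after the first elementary transformation. -/
def Params.pts₁ (p : Params) : Fin 8 → ℂ :=
  ![1 / p.a₁, p.a₁, 1 / (p.a₀ * p.a₁ * p.a₃ * p.d), p.c / (p.a₁ * p.a₂ * p.a₃ * p.d),
    p.d * p.a₃, p.d / p.a₃, p.c * p.a₂, p.a₀]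

/-- The points after the second elementary transformation. -/
def Params.pts₂ (p : Params) : Fin 8 → ℂ :=
  ![p.a₀ * p.a₂ * p.a₃ * p.c * p.d, p.a₀ * p.a₁ ^ 2 * p.a₂ * p.a₃ * p.c * p.d, p.c * p.a₂,
    p.c / (p.a₁ * p.a₂ * p.a₃ * p.d), p.d * p.a₃, p.d / p.a₃, 1 / (p.a₀ * p.a₁ * p.a₃ * p.d), p.a₀]

/-- The points after the third elementary transformation. -/
def Params.pts₃ (p : Params) : Fin 8 → ℂ :=
  ![p.d * p.a₃, p.a₀ * p.a₁ ^ 2 * p.a₂ * p.a₃ * p.c * p.d, 1 / p.a₀,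
    1 / (p.a₀ * p.a₁ * p.a₂ ^ 2 * p.a₃ * p.d), p.a₀ * p.a₂ * p.a₃ * p.c * p.d, p.d / p.a₃,
    1 / (p.a₀ * p.a₁ * p.a₃ * p.d), p.a₀]

/-- The multiplier of the second coordinate. -/
def Params.ρ (p : Params) : ℂ := p.a₀ * p.a₁ * p.a₂ * p.a₃ * p.c * p.d

section

variable {p : Params}

theorem elemPts_pts (hp : p.IsGeneric) : elemPts p.pts = p.pts₁ := by
  have h0 := hp.a₀_ne
  have h1 := hp.a₁_ne
  have h2 := hp.a₂_ne
  have h3 := hp.a₃_ne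
  have hc := hp.c_ne
  have hd := hp.d_ne
  funext k
  fin_cases k <;> simp [elemPts, Params.pts, Params.pts₁] <;> field_simp

/-- The second transformation multiplies `y`, hence it is conjugated with the exchange of the
factors. -/
theorem elemPts_pts₁ (hp : p.IsGeneric) : elemPts (swapPts p.pts₁) = swapPts p.pts₂ := by
  have h0 := hp.a₀_ne
  have h1 := hp.a₁_ne
  have h2 := hp.a₂_ne
  have h3 := hp.a₃_ne
  have hc := hp.c_ne
  have hd := hp.d_ne
  funext k
  fin_cases k <;> simp [elemPts, swapPts, Params.pts₁, Params.pts₂] <;> field_simp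

theorem elemPts_pts₂ (hp : p.IsGeneric) : elemPts p.pts₂ = p.pts₃ := by
  have h0 := hp.a₀_ne
  have h1 := hp.a₁_ne
  have h2 := hp.a₂_ne
  have h3 := hp.a₃_ne
  have hc := hp.c_ne
  have hd := hp.d_ne
  funext k
  fin_cases k <;> simp [elemPts, Params.pts₂, Params.pts₃] <;> field_simp

/-- The choice `ρ = c d / q` makes the points again of the original shape, with `c, d` replaced by
`d / q, c / q`. -/
theorem invPts_pts₃ (hp : p.IsGeneric) : invPts p.ρ p.pts₃ = p.next.pts := by
  have h0 := hp.a₀_ne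
  have h1 := hp.a₁_ne
  have h2 := hp.a₂_ne
  have h3 := hp.a₃_ne
  have hc := hp.c_ne
  have hd := hp.d_ne
  funext k
  fin_cases k <;> simp [invPts, Params.pts₃, Params.pts, Params.next, Params.q, Params.ρ] <;>
    field_simp

end

end

/-! ### Nondegeneracy of the intermediate configurations. -/

noncomputable section

theorem Params.IsGeneric.good_pts₁ {p : Params} (hp : p.IsGeneric) : Good p.pts₁ := by
  have h0 := hp.a₀_ne
  have h1 := hp.a₁_ne
  have h2 := hp.a₂_ne
  have h3 := hp.a₃_ne
  have hc := hp.c_ne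
  have hd := hp.d_ne
  have r := hp.nondegenerate
  have hne : ∀ k, p.pts₁ k ≠ 0 := by
    intro k
    fin_cases k <;> simp [Params.pts₁, h0, h1, h2, h3, hc, hd]
  constructor
  · exact hne
  · refine ne_of_mul_eq r.r12.symm (hne 1) ?_
    simp [Params.pts₁]; field_simp
  · refine ne_of_mul_eq r.r2.symm (hne 4) ?_
    simp [Params.pts₁]; field_simp
  · refine ne_of_mul_eq r.r0 (hne 5) ?_
    simp [Params.pts₁]; field_simp
  · refine ne_of_mul_eq r.r1 (hne 4) ?_
    simp [Params.pts₁]; field_simp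
  · refine ne_of_mul_eq r.r012 (hne 5) ?_
    simp [Params.pts₁]; field_simp
  · refine ne_of_mul_eq r.r02 (hne 5) ?_
    simp [Params.pts₁]; field_simp
  · refine ne_of_mul_eq r.r4 (hne 3) ?_
    simp [Params.pts₁]; field_simp
  · refine ne_of_mul_eq r.r23.symm (hne 6) ?_
    simp [Params.pts₁]; field_simp
  · refine ne_of_mul_eq r.r235.symm (hne 7) ?_
    simp [Params.pts₁]; field_simp
  · refine ne_of_mul_eq r.r234.symm (hne 6) ?_
    simp [Params.pts₁]; field_simp
  · refine ne_of_mul_eq r.r2345.symm (hne 7) ?_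
    simp [Params.pts₁]; field_simp
  · refine ne_of_mul_eq r.r5.symm (hne 7) ?_
    simp [Params.pts₁]; field_simp

theorem Params.IsGeneric.good_pts₂ {p : Params} (hp : p.IsGeneric) : Good p.pts₂ := by
  have h0 := hp.a₀_ne
  have h1 := hp.a₁_ne
  have h2 := hp.a₂_ne
  have h3 := hp.a₃_ne
  have hc := hp.c_ne
  have hd := hp.d_ne
  have r := hp.nondegenerate
  have hne : ∀ k, p.pts₂ k ≠ 0 := by
    intro k
    fin_cases k <;> simp [Params.pts₂, h0, h1, h2, h3, hc, hd]
  constructor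
  · exact hne
  · refine ne_of_mul_eq r.r12.symm (hne 1) ?_
    simp [Params.pts₂]; field_simp
  · refine ne_of_mul_eq r.r3 (hne 4) ?_
    simp [Params.pts₂]; field_simp
  · refine ne_of_mul_eq r.r023 (hne 5) ?_
    simp [Params.pts₂]; field_simp
  · refine ne_of_mul_eq r.r123 (hne 4) ?_
    simp [Params.pts₂]; field_simp
  · refine ne_of_mul_eq r.r01223 (hne 5) ?_
    simp [Params.pts₂]; field_simp
  · refine ne_of_mul_eq r.r02 (hne 5) ?_
    simp [Params.pts₂]; field_simp
  · refine ne_of_mul_eq r.r234 (hne 3) ?_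
    simp [Params.pts₂]; field_simp
  · refine ne_of_mul_eq r.r23 (hne 6) ?_
    simp [Params.pts₂]; field_simp
  · refine ne_of_mul_eq r.r5.symm (hne 7) ?_
    simp [Params.pts₂]; field_simp
  · refine ne_of_mul_eq r.r4.symm (hne 6) ?_
    simp [Params.pts₂]; field_simp
  · refine ne_of_mul_eq r.r2345.symm (hne 7) ?_
    simp [Params.pts₂]; field_simp
  · refine ne_of_mul_eq r.r235.symm (hne 7) ?_
    simp [Params.pts₂]; field_simp

theorem Params.IsGeneric.good_pts₃ {p : Params} (hp : p.IsGeneric) : Good p.pts₃ := by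
  have h0 := hp.a₀_ne
  have h1 := hp.a₁_ne
  have h2 := hp.a₂_ne
  have h3 := hp.a₃_ne
  have hc := hp.c_ne
  have hd := hp.d_ne
  have r := hp.nondegenerate
  have hne : ∀ k, p.pts₃ k ≠ 0 := by
    intro k
    fin_cases k <;> simp [Params.pts₃, h0, h1, h2, h3, hc, hd]
  constructor
  · exact hne
  · refine ne_of_mul_eq r.r123.symm (hne 1) ?_
    simp [Params.pts₃]; field_simp
  · refine ne_of_mul_eq r.r3.symm (hne 4) ?_
    simp [Params.pts₃]; field_simp
  · refine ne_of_mul_eq r.r02 (hne 5) ?_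
    simp [Params.pts₃]; field_simp
  · refine ne_of_mul_eq r.r12 (hne 4) ?_
    simp [Params.pts₃]; field_simp
  · refine ne_of_mul_eq r.r01223 (hne 5) ?_
    simp [Params.pts₃]; field_simp
  · refine ne_of_mul_eq r.r023 (hne 5) ?_
    simp [Params.pts₃]; field_simp
  · refine ne_of_mul_eq r.r234 (hne 3) ?_
    simp [Params.pts₃]; field_simp
  · refine ne_of_mul_eq r.r2 (hne 6) ?_
    simp [Params.pts₃]; field_simp
  · refine ne_of_mul_eq r.r35.symm (hne 7) ?_
    simp [Params.pts₃]; field_simp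
  · refine ne_of_mul_eq r.r34.symm (hne 6) ?_
    simp [Params.pts₃]; field_simp
  · refine ne_of_mul_eq r.r23345.symm (hne 7) ?_
    simp [Params.pts₃]; field_simp
  · refine ne_of_mul_eq r.r235.symm (hne 7) ?_
    simp [Params.pts₃]; field_simp

/-- `X₁` and `Y₁` are the coordinates changed by the first and the second transformation. The
factors `y + 1 / a₁`, `y + d * a₃` and `U` cancel, which leaves the formula for the first component.
-/
theorem xbar_identity {K : Type*} [Field K] {a₀ a₁ a₂ a₃ c d q x y X₁ Y₁ : K} (h0 : a₀ ≠ 0)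
    (h1 : a₁ ≠ 0) (h2 : a₂ ≠ 0) (h3 : a₃ ≠ 0) (hd : d ≠ 0) (hq : q * (a₀ * a₁ * a₂ * a₃) = 1)
    (hx : x ≠ 0) (hP : y + d * a₃ ≠ 0) (hP' : y + 1 / a₁ ≠ 0)
    (hX : X₁ = x * ((y + 1 / a₁) / (y + d * a₃)))
    (hU : X₁ + 1 / (a₀ * a₁ * a₃ * d) ≠ 0)
    (hY : Y₁ = y * ((X₁ + c * a₂) / (X₁ + 1 / (a₀ * a₁ * a₃ * d))))
    (hN : Y₁ + d * a₃ ≠ 0) :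
    (X₁ * ((Y₁ + d * a₃) / (Y₁ + a₀ * a₂ * a₃ * c * d)))⁻¹
      = (q * a₀ * a₁ * x * y + c * (d + a₀ * d * x + q * a₀ * a₁ * a₂ * y)) /
        (q * x * (1 + a₀ * (x + a₁ * a₂ * c * y + a₁ * x * y))) := by
  have hq' : q = 1 / (a₀ * a₁ * a₂ * a₃) := by field_simp; linear_combination hq
  set U := X₁ + 1 / (a₀ * a₁ * a₃ * d) with hUdef
  have e1 : Y₁ + d * a₃ = (1 + a₀ * (x + a₁ * a₂ * c * y + a₁ * x * y)) / (a₀ * a₁ * U) := by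
    rw [hY, eq_div_iff (mul_ne_zero (mul_ne_zero h0 h1) hU)]
    field_simp
    rw [hUdef, hX]
    field_simp
    ring
  have e2 : Y₁ + a₀ * a₂ * a₃ * c * d
      = (y + 1 / a₁) * (x * (y + a₀ * a₂ * a₃ * c * d) + c * a₂ * (y + d * a₃))
        / ((y + d * a₃) * U) := by
    rw [hY, eq_div_iff (mul_ne_zero hP hU)]
    field_simp
    rw [hUdef, hX]
    field_simp
    ring
  have hD : 1 + a₀ * (x + a₁ * a₂ * c * y + a₁ * x * y) ≠ 0 := by
    intro h
    rw [h, zero_div] at e1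
    exact hN e1
  have e3 : x * (y + a₀ * a₂ * a₃ * c * d) + c * a₂ * (y + d * a₃) = a₂ * a₃ *
      (q * a₀ * a₁ * x * y + c * (d + a₀ * d * x + q * a₀ * a₁ * a₂ * y)) := by
    rw [hq']
    field_simp
    ring
  rw [e1, e2, e3, hX]
  generalize 1 + a₀ * (x + a₁ * a₂ * c * y + a₁ * x * y) = D at hD
  -- This factor need not be nonzero: with the conventions for division by zero both sides vanish
  -- with it.
  generalize q * a₀ * a₁ * x * y + c * (d + a₀ * d * x + q * a₀ * a₁ * a₂ * y) = M
  generalize y + 1 / a₁ = P' at hP'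
  generalize y + d * a₃ = P at hP
  rw [hq']
  field_simp

theorem ybar_identity {K : Type*} [Field K] {a₀ a₁ a₂ a₃ c d q x y X₁ : K} (h0 : a₀ ≠ 0)
    (h1 : a₁ ≠ 0) (h2 : a₂ ≠ 0) (h3 : a₃ ≠ 0) (hd : d ≠ 0) (hq : q * (a₀ * a₁ * a₂ * a₃) = 1)
    (hy : y ≠ 0) (hP : y + d * a₃ ≠ 0)
    (hX : X₁ = x * ((y + 1 / a₁) / (y + d * a₃)))
    (hW : X₁ + c * a₂ ≠ 0) :
    a₀ * a₁ * a₂ * a₃ * c * d * (y * ((X₁ + c * a₂) / (X₁ + 1 / (a₀ * a₁ * a₃ * d))))⁻¹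
      = (c * (d + a₀ * d * x + a₀ * a₁ * d * x * y + q * a₀ * a₁ * a₂ * y)) /
        (y * (q * a₀ * x * (1 + a₁ * y) + c * (d + q * a₀ * a₁ * a₂ * y))) := by
  have hq' : q = 1 / (a₀ * a₁ * a₂ * a₃) := by field_simp; linear_combination hq
  have e1 : X₁ + c * a₂ = a₂ * a₃ * (q * a₀ * x * (1 + a₁ * y) + c * (d + q * a₀ * a₁ * a₂ * y))
      / (y + d * a₃) := by
    rw [hX, hq', eq_div_iff hP]
    field_simp
    ring
  have e2 : X₁ + 1 / (a₀ * a₁ * a₃ * d) =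
      (d + a₀ * d * x + a₀ * a₁ * d * x * y + q * a₀ * a₁ * a₂ * y) / (a₀ * a₁ * d * (y + d * a₃)) := by
    rw [hX, hq', eq_div_iff (mul_ne_zero (mul_ne_zero (mul_ne_zero h0 h1) hd) hP)]
    field_simp
    ring
  have hD : q * a₀ * x * (1 + a₁ * y) + c * (d + q * a₀ * a₁ * a₂ * y) ≠ 0 := by
    intro h
    rw [h, mul_zero, zero_div] at e1
    exact hW e1
  rw [e1, e2]
  generalize q * a₀ * x * (1 + a₁ * y) + c * (d + q * a₀ * a₁ * a₂ * y) = D at hD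
  generalize y + d * a₃ = P at hP
  field_simp

/-! ### The lattice computation and the composition of the six mappings. -/

theorem w_three_eq : w 3 = σ₅₄₃₂₁₀ * w 2 * σ₅₄₃₂₁₀ := by
  apply lat_equiv_ext
  · decide
  · decide

/-- The action of the mapping on the lattice. -/
def weylElement : Lat ≃ₗ[ℤ] Lat :=
  σ₅₄ * σ₁₀ * w 5 * w 4 * w 1 * w 0 * w 2 * w 3 * w 2

set_option maxRecDepth 100000 in
/-- The square of the action is a translation. -/
theorem weylElement_sq_α (i : Fin 6) : (weylElement * weylElement) (α i)
    = α i + (![1, 1, -1, -1, 1, 1] : Fin 6 → ℤ) i • antiK := by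
  revert i; decide

theorem weylElement_mem : weylElement ∈ extendedWeylGroup := by
  have hw : ∀ i, w i ∈ extendedWeylGroup := fun i =>
    Subgroup.subset_closure (Or.inl ⟨i, rfl⟩)
  have h1 : σ₁₀ ∈ extendedWeylGroup := Subgroup.subset_closure (Or.inr (Or.inl rfl))
  have h2 : σ₅₄₃₂₁₀ ∈ extendedWeylGroup := Subgroup.subset_closure (Or.inr (Or.inr rfl))
  have h3 : σ₅₄ ∈ extendedWeylGroup := mul_mem (mul_mem h2 h1) h2
  exact mul_mem (mul_mem (mul_mem (mul_mem (mul_mem (mul_mem (mul_mem (mul_mem h3 h1)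
    (hw 5)) (hw 4)) (hw 1)) (hw 0)) (hw 2)) (hw 3)) (hw 2)

/-- The mapping lifts to an isomorphism, and its action on the lattice. -/
theorem Params.IsGeneric.exists_actsOn {p : Params} (hp : p.IsGeneric) :
    ∃ Φ : FunField ≃ₐ[ℂ] FunField, IsPullback p Φ ∧
      ActsOn Φ (primes p.pts) (primes p.next.pts) (exc p.pts) (exc p.next.pts) weylElement := by
  have h0 := hp.a₀_ne
  have h1 := hp.a₁_ne
  have h2 := hp.a₂_ne
  have h3 := hp.a₃_ne
  have hc := hp.c_ne
  have hd := hp.d_ne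
  have hρ : p.ρ ≠ 0 := by simp [Params.ρ, h0, h1, h2, h3, hc, hd]
  obtain ⟨S, hS⟩ := exists_isSwap
  obtain ⟨Φ₁, hΦ₁⟩ := exists_isElem p.pts
  obtain ⟨Φ₂, hΦ₂⟩ := exists_isElem (swapPts p.pts₁)
  obtain ⟨Φ₃, hΦ₃⟩ := exists_isElem p.pts₂
  obtain ⟨Φ₄, hΦ₄⟩ := exists_isInv hρ
  have g := hp.next.good
  have t1 := hΦ₁.actsOn hp.good (by rw [elemPts_pts hp]; exact hp.good_pts₁)
  rw [elemPts_pts hp] at t1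
  have t2 := hS.actsOn p.pts₁
  have t3 := hΦ₂.actsOn hp.good_pts₁.swapPts
    (by rw [elemPts_pts₁ hp]; exact hp.good_pts₂.swapPts)
  rw [elemPts_pts₁ hp] at t3
  have t4 := hS.actsOn (swapPts p.pts₂)
  rw [swapPts_swapPts] at t4
  have t5 := hΦ₃.actsOn hp.good_pts₂ (by rw [elemPts_pts₂ hp]; exact hp.good_pts₃)
  rw [elemPts_pts₂ hp] at t5
  have t6 := hΦ₄.actsOn hρ hp.good_pts₃.ne (by rw [invPts_pts₃ hp]; exact g)
  rw [invPts_pts₃ hp] at t6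
  -- The two exchanges around the second transformation turn its `w 2` into `w 3`. Push-forwards
  -- multiply on the left, pull-backs compose in the opposite order.
  have t := ((((t1.trans t2).trans t3).trans t4).trans t5).trans t6
  have e : (σ₅₄ * σ₁₀ * w 5 * w 4 * w 1 * w 0) * (w 2 * (σ₅₄₃₂₁₀ * (w 2 * (σ₅₄₃₂₁₀ * w 2))))
      = weylElement := by
    rw [weylElement, w_three_eq]
    simp only [mul_assoc]
  rw [e] at t
  refine ⟨_, ?_, t⟩
  have hx1 : Φ₁ x = x * ((y + 1 / con p.a₁) / (y + con p.d * con p.a₃)) := by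
    rw [← con_one, ← con_div, ← con_mul]; exact hΦ₁.map_x
  have hx2 : Φ₂ x = x * ((y + con p.c * con p.a₂) /
      (y + 1 / (con p.a₀ * con p.a₁ * con p.a₃ * con p.d))) := by
    rw [← con_one, ← con_mul, ← con_mul, ← con_mul, ← con_mul, ← con_div]; exact hΦ₂.map_x
  have hx3 : Φ₃ x = x * ((y + con p.d * con p.a₃) /
      (y + con p.a₀ * con p.a₂ * con p.a₃ * con p.c * con p.d)) := by
    simp only [← con_mul]; exact hΦ₃.map_x
  have hq : con p.q * (con p.a₀ * con p.a₁ * con p.a₂ * con p.a₃) = 1 := by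
    simp only [← con_mul]
    rw [← con_one, Params.q]
    congr 1
    field_simp
  have c0 := con_ne_zero h0
  have c1 := con_ne_zero h1
  have c2 := con_ne_zero h2
  have c3 := con_ne_zero h3
  have cd := con_ne_zero hd
  have hxc : ∀ c, x + con c ≠ 0 := isCoord_xy.add_con_ne_zero
  have hyc := y_add_con_ne_zero
  have hX : ∀ c, Φ₁ x + con c ≠ 0 := fun c => by
    rw [← algEquiv_con Φ₁ c, ← map_add, Ne, EmbeddingLike.map_eq_zero_iff]; exact hxc c
  have hP : y + con p.d * con p.a₃ ≠ 0 := by rw [← con_mul]; exact hyc _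
  have hP' : y + 1 / con p.a₁ ≠ 0 := by rw [← con_one, ← con_div]; exact hyc _
  have hU : Φ₁ x + 1 / (con p.a₀ * con p.a₁ * con p.a₃ * con p.d) ≠ 0 := by
    rw [← con_one, ← con_mul, ← con_mul, ← con_mul, ← con_div]; exact hX _
  have hW : Φ₁ x + con p.c * con p.a₂ ≠ 0 := by rw [← con_mul]; exact hX _
  -- The second coordinate after two transformations: between the exchanges it plays the role of
  -- `x`, and `Φ₁` leaves `y` unchanged.
  have hY : Φ₁ (S (Φ₂ x)) = y * ((Φ₁ x + con p.c * con p.a₂) /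
      (Φ₁ x + 1 / (con p.a₀ * con p.a₁ * con p.a₃ * con p.d))) := by
    rw [hx2]
    simp only [map_mul, map_div₀, map_add, map_one, algEquiv_con, hS.map_x, hS.map_y, hΦ₁.map_y]
  have hN : Φ₁ (S (Φ₂ x)) + con p.d * con p.a₃ ≠ 0 := by
    rw [← con_mul, ← algEquiv_con Φ₁, ← algEquiv_con S, ← algEquiv_con Φ₂, ← map_add, ← map_add,
      ← map_add, Ne, EmbeddingLike.map_eq_zero_iff, EmbeddingLike.map_eq_zero_iff,
      EmbeddingLike.map_eq_zero_iff]
    exact hxc _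
  constructor
  · have hl := xbar_identity (c := con p.c) c0 c1 c2 c3 cd hq x_ne_zero hP hP' hx1 hU hY hN
    simp only [xbar, con_mul]
    rw [← hl]
    simp only [AlgEquiv.trans_apply, hΦ₄.map_x, map_inv₀, hx3, map_mul, map_div₀, map_add,
      algEquiv_con, hS.map_x, hS.map_y, hΦ₂.map_y]
  · have hl := ybar_identity (c := con p.c) c0 c1 c2 c3 cd hq y_ne_zero hP hx1 hW
    simp only [ybar, con_mul]
    rw [← hl, ← hY]
    simp only [AlgEquiv.trans_apply, hΦ₄.map_y, map_inv₀, map_mul, algEquiv_con, hS.map_y,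
      hΦ₃.map_y, Params.ρ, con_mul]

theorem Params.IsGeneric.marking_bijective {p : Params} (hp : p.IsGeneric) :
    Function.Bijective (marking p) := by
  have key : Function.Bijective (mark (primeDivisors p) (excOrd p)) := by
    rw [primeDivisors_eq, excOrd_eq]
    exact ⟨mark_injective hp.good, mark_surjective hp.good⟩
  rw [marking_eq_mark]
  exact key

theorem Params.IsGeneric.actsBy {p p' : Params} (hp : p.IsGeneric) (hp' : p'.IsGeneric)
    {Φ : FunField ≃ₐ[ℂ] FunField} {L : Lat ≃ₗ[ℤ] Lat}
    (h : ActsOn Φ (primes p.pts) (primes p'.pts) (exc p.pts) (exc p'.pts) L) :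
    ActsBy Φ p p' L := by
  refine actsBy_of_actsOn hp.marking_bijective hp'.marking_bijective ?_
  rw [primeDivisors_eq, primeDivisors_eq, excOrd_eq, excOrd_eq]
  exact h

end

end QSurface

theorem mainTheorem3 (p : QSurface.Params) (hp : p.IsGeneric) :
    ∃ Φ Φ' : QSurface.FunField ≃ₐ[ℂ] QSurface.FunField, ∃ L L₂ : QSurface.Lat ≃ₗ[ℤ] QSurface.Lat,
      QSurface.IsPullback p Φ ∧ QSurface.IsPullback p.next Φ' ∧
      -- the action of `φ`
      QSurface.ActsBy Φ p p.next L ∧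
      -- the action of `φ²`, for which `f ∘ φ² = Φ (Φ' f)`
      QSurface.ActsBy (Φ'.trans Φ) p p.next.next L₂ ∧
      -- the translation
      L₂ (QSurface.α 0) = QSurface.α 0 + QSurface.antiK ∧
      L₂ (QSurface.α 1) = QSurface.α 1 + QSurface.antiK ∧
      L₂ (QSurface.α 2) = QSurface.α 2 - QSurface.antiK ∧
      L₂ (QSurface.α 3) = QSurface.α 3 - QSurface.antiK ∧
      L₂ (QSurface.α 4) = QSurface.α 4 + QSurface.antiK ∧
      L₂ (QSurface.α 5) = QSurface.α 5 + QSurface.antiK ∧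
      QSurface.antiK = QSurface.α 0 + QSurface.α 1 + (2 : ℤ) • QSurface.α 2
        + (2 : ℤ) • QSurface.α 3 + QSurface.α 4 + QSurface.α 5 ∧
      -- the expression by generators
      L ∈ QSurface.extendedWeylGroup ∧
      L = QSurface.σ₅₄ * QSurface.σ₁₀ * QSurface.w 5 * QSurface.w 4 * QSurface.w 1 * QSurface.w 0
        * QSurface.w 2 * QSurface.w 3 * QSurface.w 2 := by
  obtain ⟨Φ, h1, h2⟩ := hp.exists_actsOn
  obtain ⟨Φ', h1', h2'⟩ := hp.next.exists_actsOn
  have h := QSurface.weylElement_sq_α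
  -- The lattice element does not depend on the parameters, so the two steps from `p` and from
  -- `p.next` contribute the same factor and `L₂` is its square.
  exact ⟨Φ, Φ', QSurface.weylElement, QSurface.weylElement * QSurface.weylElement, h1, h1',
    hp.actsBy hp.next h2, hp.actsBy hp.next.next (h2.trans h2'), (h 0).trans (by simp),
    (h 1).trans (by simp), (h 2).trans (by simp [sub_eq_add_neg]),
    (h 3).trans (by simp [sub_eq_add_neg]), (h 4).trans (by simp), (h 5).trans (by simp), by decide,
    QSurface.weylElement_mem, rfl⟩
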